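/- All alphabets $\mathcal S,\hat{\mathcal S}_1,\hat{\mathcal S}_2,\mathcal X,\mathcal Y,\mathcal Z$ are finite, with $\mathcal X$ non-empty; logarithms are to base 2. Let $S^n$ be i.i.d. with law $P_S$, let $P_{YZ|X}=P_{Y|X}P_{Z|Y}$ be a memoryless degraded broadcast channel, let $d_i:\mathcal S\times\hat{\mathcal S}_i\to[0,\infty)$, $i=1,2$, be distortion measures (in particular, $\hat{\mathcal S}_1=\hat{\mathcal S}_2$ and $d_1=d_2$ is allowed), extended to sequences by $d_i(s^n,\hat s^n)=\frac1n\sum_{j=1}^n d_i(s_j,\hat s_j)$, and let $R\ge 0$, $\rho\ge 0$, $D_1,D_2\in\mathbb R$. A source code of rate $R$, block length $n\ge1$ and channel length $l\ge 0$ with a separation-based helper observing $T^n=S^n$ consists of the message set $\mathcal M=\{1,\dots,\lfloor 2^{nR}\rfloor\}$, finite sets $\mathcal M_1,\mathcal M_2$, a source encoder $f_1:\mathcal S^n\to\mathcal M$, helper encoders $f_{21}:\mathcal S^n\to\mathcal M_1\times\mathcal M_2$ and $f_{22}:\mathcal M_1\times\mathcal M_2\to\mathcal X^l$, and decoders $g_{11}:\mathcal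 Z^l\to\mathcal M_1$, $g_{12}:\mathcal M\times\mathcal M_1\to\hat{\mathcal S}_1^n$, $g_{21}:\mathcal Y^l\to\mathcal M_2$, $g_{22}:\mathcal M\times\mathcal M_2\to\hat{\mathcal S}_2^n$. Put $M=f_1(S^n)$ and $(M_1,M_2)=f_{21}(S^n)$; let $(Y^l,Z^l)$ be the channel output for the input $f_{22}(M_1,M_2)$, and put $\hat M_1=g_{11}(Z^l)$, $\hat M_2=g_{21}(Y^l)$, $\hat S_1^n=g_{12}(M,\hat M_1)$, $\hat S_2^n=g_{22}(M,\hat M_2)$. The quadruple $(R,D_1,D_2,\rho)$ is achievable with a separation-based helper if for every $\epsilon>0$ there is such a code with $$\frac ln\le\rho+\epsilon,\quad \Pr\{(M_1,M_2)\ne(\hat M_1,\hat M_2)\}\le\epsilon,\quad \mathbb E[d_1(S^n,\hat S_1^n)]\le D_1+\epsilon,\quad \mathbb E[d_2(S^n,\hat S_2^n)]\le D_2+\epsilon .$$ Then $(R,D_1,D_2,\rho)$ is achievable with a separation-based helper observing $T=S$ if and only if there are a joint law $P_{S\hat S_1\hat S_2}$ on $\mathcal S\times\hat{\mathcal S}_1\times\hat{\mathcal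 S}_2$ with $\mathcal S$-marginal $P_S$, a random variable $W$ with a finite alphabet and law $P_W$, and a conditional law $P_{X|W}$ such that $\mathbb E[d_1(S,\hat S_1)]\le D_1$, $\mathbb E[d_2(S,\hat S_2)]\le D_2$ and, for $(W,X,Y,Z)\sim P_WP_{X|W}P_{Y|X}P_{Z|Y}$, $$R+\rho I(W;Z)\ge I(\hat S_1;S),\qquad R+\rho I(W;Z)+\rho I(X;Y|W)\ge I(\hat S_1,\hat S_2;S).$$ -/

import Mathlib

open scoped NNReal

noncomputable section

namespace HelperBC

/-! Probability mass functions on a finite type `Ω` are the elements of `stdSimplex ℝ Ω`; a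
channel from `X` to `Y` is a map `V : X → Y → ℝ` all of whose rows `V x` are such elements.
Random variables are functions on the finite sample space `Ω`. -/

section Information

variable {Ω A B C : Type*} [Fintype Ω] [Fintype A] [Fintype B] [Fintype C]

/-- The probability of an event `E` under the mass function `p`. -/
def prob (p : Ω → ℝ) (E : Set Ω) : ℝ :=
  open Classical in ∑ ω, if ω ∈ E then p ω else 0

/-- The expectation of `f` under the mass function `p`. -/
def expect (p : Ω → ℝ) (f : Ω → ℝ) : ℝ := ∑ ω, p ω * f ω

/-- The distribution (mass function) of the random variable `U` under `p`. -/
def law (p : Ω → ℝ) (U : Ω → A) : A → ℝ := fun a => prob p {ω | U ω = a}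

/-- The Shannon entropy `H(U)` in bits. -/
def entropy (p : Ω → ℝ) (U : Ω → A) : ℝ :=
  -∑ a, law p U a * Real.logb 2 (law p U a)

/-- The mutual information `I(U;V) = H(U) + H(V) - H(U,V)` in bits. -/
def mutualInfo (p : Ω → ℝ) (U : Ω → A) (V : Ω → B) : ℝ :=
  entropy p U + entropy p V - entropy p (fun ω => (U ω, V ω))

/-- The conditional mutual information `I(U;V|W) = H(U,W) + H(V,W) - H(U,V,W) - H(W)` in bits. -/
def condMutualInfo (p : Ω → ℝ) (U : Ω → A) (V : Ω → B) (W : Ω → C) : ℝ :=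
  entropy p (fun ω => (U ω, W ω)) + entropy p (fun ω => (V ω, W ω))
    - entropy p (fun ω => (U ω, V ω, W ω)) - entropy p W

end Information

/-- The message set `[1 : 2^{nR}]`, that is, a set with `⌊2^{nR}⌋` elements. -/
abbrev Message (n : ℕ) (R : ℝ) : Type := Fin ⌊(2 : ℝ) ^ ((n : ℝ) * R)⌋₊

/-- A source code of block length `n` and rate `R` for the source alphabet `S`, with a
separation-based helper that observes a sequence over `T` and uses the broadcast channel `l` times.
The helper's message sets are `M₁ = Fin k₁` and `M₂ = Fin k₂`. -/
structure SepCode (S T S₁ S₂ X Y Z : Type*) (R : ℝ) (n l : ℕ) where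
  /-- size of the helper message set `M₁` -/
  k₁ : ℕ
  /-- size of the helper message set `M₂` -/
  k₂ : ℕ
  /-- source encoder -/
  f₁ : (Fin n → S) → Message n R
  /-- quantizer (source encoder) of the helper -/
  f₂₁ : (Fin n → T) → Fin k₁ × Fin k₂
  /-- channel encoder of the helper -/
  f₂₂ : Fin k₁ × Fin k₂ → (Fin l → X)
  /-- channel decoder of the weak receiver -/
  g₁₁ : (Fin l → Z) → Fin k₁
  /-- source decoder of the weak receiver -/
  g₁₂ : Message n R × Fin k₁ → (Fin n → S₁)
  /-- channel decoder of the strong receiver -/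
  g₂₁ : (Fin l → Y) → Fin k₂
  /-- source decoder of the strong receiver -/
  g₂₂ : Message n R × Fin k₂ → (Fin n → S₂)

namespace SepCode

variable {S T S₁ S₂ X Y Z : Type*} {R : ℝ} {n l : ℕ} (c : SepCode S T S₁ S₂ X Y Z R n l)

/-- The outcomes `(sⁿ, tⁿ, yˡ, zˡ)` of one use of a code. -/
abbrev Outcome (S T Y Z : Type*) (n l : ℕ) : Type _ :=
  (Fin n → S) × (Fin n → T) × (Fin l → Y) × (Fin l → Z)

/-- The joint mass function of `(Sⁿ, Tⁿ, Yˡ, Zˡ)`: the pairs `(Sᵢ, Tᵢ)` are i.i.d. with mass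
function `PST`, and the codeword of the helper is sent over the memoryless degraded broadcast
channel `P_{YZ|X} = P_{Y|X} P_{Z|Y}`. -/
def outcomeLaw (PST : S × T → ℝ) (PYX : X → Y → ℝ) (PZY : Y → Z → ℝ) :
    Outcome S T Y Z n l → ℝ :=
  fun ω => (∏ i, PST (ω.1 i, ω.2.1 i)) *
    ∏ j, (PYX (c.f₂₂ (c.f₂₁ ω.2.1) j) (ω.2.2.1 j) * PZY (ω.2.2.1 j) (ω.2.2.2 j))

/-- The decoded helper message of the weak receiver and that of the strong receiver. -/
def decoded (ω : Outcome S T Y Z n l) : Fin c.k₁ × Fin c.k₂ :=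
  (c.g₁₁ ω.2.2.2, c.g₂₁ ω.2.2.1)

/-- The reconstruction of the weak receiver, from the source message and its decoded message. -/
def recon₁ (ω : Outcome S T Y Z n l) : Fin n → S₁ :=
  c.g₁₂ (c.f₁ ω.1, (c.decoded ω).1)

/-- The reconstruction of the strong receiver, from the source message and its decoded message. -/
def recon₂ (ω : Outcome S T Y Z n l) : Fin n → S₂ :=
  c.g₂₂ (c.f₁ ω.1, (c.decoded ω).2)

end SepCode

/-- The per-letter distortion `d(sⁿ, ŝⁿ) = (1/n) ∑ᵢ d(sᵢ, ŝᵢ)` of a pair of sequences. -/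
def avgDist {S A : Type*} (d : S → A → ℝ≥0) {n : ℕ} (s : Fin n → S) (a : Fin n → A) : ℝ :=
  (∑ i, (d (s i) (a i) : ℝ)) / n

/-- Achievability of `(R, D₁, D₂, ρ)` with a separation-based helper, for the correlated sources
`(S,T) ∼ PST`, the degraded broadcast channel `P_{Y|X} P_{Z|Y}`, and the distortion measures `d₁`
at the weak and `d₂` at the strong receiver. -/
def SepAchievable {S T S₁ S₂ X Y Z : Type*} [Fintype S] [Fintype T] [Fintype Y] [Fintype Z]
    (PST : S × T → ℝ) (PYX : X → Y → ℝ) (PZY : Y → Z → ℝ)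
    (d₁ : S → S₁ → ℝ≥0) (d₂ : S → S₂ → ℝ≥0) (R D₁ D₂ ρ : ℝ) : Prop :=
  ∀ ε : ℝ, 0 < ε → ∃ (n l : ℕ) (c : SepCode S T S₁ S₂ X Y Z R n l),
    0 < n ∧
    (l : ℝ) / n ≤ ρ + ε ∧
    prob (c.outcomeLaw PST PYX PZY) {ω | c.f₂₁ ω.2.1 ≠ c.decoded ω} ≤ ε ∧
    expect (c.outcomeLaw PST PYX PZY) (fun ω => avgDist d₁ ω.1 (c.recon₁ ω)) ≤ D₁ + ε ∧
    expect (c.outcomeLaw PST PYX PZY) (fun ω => avgDist d₂ ω.1 (c.recon₂ ω)) ≤ D₂ + ε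

/-- The joint mass function of `(S, T)` when `T = S` and `S ∼ PS`. -/
def diagLaw {S : Type*} (PS : S → ℝ) : S × S → ℝ :=
  open Classical in fun st => if st.1 = st.2 then PS st.1 else 0

/-- The joint mass function `P_W P_{X|W} P_{Y|X} P_{Z|Y}` of `(W, X, Y, Z)`. -/
def chanLaw {W X Y Z : Type*} (PW : W → ℝ) (PXW : W → X → ℝ) (PYX : X → Y → ℝ)
    (PZY : Y → Z → ℝ) : W × X × Y × Z → ℝ :=
  fun ω => PW ω.1 * PXW ω.1 ω.2.1 * PYX ω.2.1 ω.2.2.1 * PZY ω.2.2.1 ω.2.2.2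

end HelperBC

end

/-! Direct part. The source is quantized with a superposition codebook. A cloud index, made of the
source message and the first helper index, selects a word for Ŝ₁; a satellite index, the second
helper index, refines it to a word for Ŝ₂. Almost every source word is covered once there are more
than 2^(n I(Ŝ₁;S)) clouds and more than 2^(n I(Ŝ₁,Ŝ₂;S)) satellites in total (`exists_covering`,
`eventually_exists_source_code`). The helper indices cross the channel by superposition coding, at
rates below ρ I(W;Z) and ρ I(X;Y|W) per source letter, and by degradedness the strong receiver
decodes both (`exists_superposition_code`, `eventually_exists_channel_code`). These indices are not
uniform, so the random coding bound is proved for every fixed message and then averaged over the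
actual message law.

This settles strict inequalities. For equality, the reconstruction is replaced by a constant with
small probability θ. By convexity the source informations shrink by the factor 1 - θ, which gives
strictness whenever the right-hand side is positive (`mutualInfo_perturb_lt`). If R + ρ I(W;Z) = 0,
then Ŝ₁ is independent of S and may be taken constant; the same applies to Ŝ₂ if ρ I(X;Y|W) vanishes
as well (`sepAchievable_of_le`).

Converse. The helper messages are functions of Sⁿ and the decoded ones are functions of the channel
outputs, so Fano's inequality applies although the message sets have no size bound (`fano`,
`entropy_decoded_le`). Up to Fano terms, n I(Ŝ₁;S) ≤ H(Ŝ₁ⁿ) ≤ nR + I(M₁;Zˡ), and for the pair of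
reconstructions I(M₁,M₂;Yˡ,Zˡ|M₁) is added. With Wᵢ = (M₁, Yⁱ⁻¹, Zⁱ⁻¹) both channel terms split into
single-letter ones (`exists_rate_bound`).

The alphabet of Wᵢ grows with the block length, which obstructs a passage to the limit. Therefore
(W,X) is recorded only by the point (P_X, H(Z|W), H(Y|W)), which ranges over the convex hull of a
compact set. That hull is compact, both rates are continuous on it, averaging over positions stays
inside it, and each of its points comes from a finite W (`isCompact_entropyRegion`,
`exists_average`, `exists_auxPoint`). A limit point of codes with error tending to 0 gives the
theorem. -/

set_option linter.unusedSectionVars false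

noncomputable section

namespace HelperBC

open Filter Topology

/-! ### Entropy inequalities on a finite sample space -/

section EntropyBasics

variable {Ω Ω' A B C : Type*} [Fintype Ω]

theorem prob_eq_sum (p : Ω → ℝ) (E : Set Ω) [DecidablePred (· ∈ E)] :
    prob p E = ∑ ω, if ω ∈ E then p ω else 0 := by
  unfold prob
  exact Finset.sum_congr rfl fun ω _ => by split_ifs <;> rfl

theorem law_eq_sum [DecidableEq A] (p : Ω → ℝ) (U : Ω → A) (a : A) :
    law p U a = ∑ ω, if U ω = a then p ω else 0 := by
  classical
  unfold law
  rw [prob_eq_sum]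
  exact Finset.sum_congr rfl fun ω _ => by simp

theorem law_nonneg {p : Ω → ℝ} (hp : ∀ ω, 0 ≤ p ω) (U : Ω → A) (a : A) : 0 ≤ law p U a := by
  classical
  rw [law_eq_sum]
  exact Finset.sum_nonneg fun ω _ => by split_ifs <;> simp [hp]

variable [Fintype Ω'] [Fintype A] [Fintype B] [Fintype C]

theorem sum_law_mul (p : Ω → ℝ) (U : Ω → A) (f : A → ℝ) :
    ∑ a, law p U a * f a = ∑ ω, p ω * f (U ω) := by
  classical
  simp_rw [law_eq_sum, Finset.sum_mul]
  rw [Finset.sum_comm]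
  refine Finset.sum_congr rfl fun ω _ => ?_
  simp [ite_mul]

theorem sum_law (p : Ω → ℝ) (U : Ω → A) : ∑ a, law p U a = ∑ ω, p ω := by
  simpa using sum_law_mul p U (fun _ => 1)

theorem law_mem_stdSimplex {p : Ω → ℝ} (hp : p ∈ stdSimplex ℝ Ω) (U : Ω → A) :
    law p U ∈ stdSimplex ℝ A :=
  ⟨law_nonneg hp.1 U, by rw [sum_law, hp.2]⟩

theorem law_law (p : Ω → ℝ) (U : Ω → A) (g : A → B) :
    law (law p U) g = law p (fun ω => g (U ω)) := by
  classical
  funext b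
  have h := sum_law_mul p U (fun a => if g a = b then 1 else 0)
  rw [law_eq_sum, law_eq_sum]
  simpa using h

theorem law_id (p : Ω → ℝ) : law p (fun ω => ω) = p := by
  classical
  funext a
  rw [law_eq_sum]
  simp

theorem le_law {p : Ω → ℝ} (hp : ∀ ω, 0 ≤ p ω) (U : Ω → A) (ω : Ω) : p ω ≤ law p U (U ω) := by
  classical
  rw [law_eq_sum]
  have := Finset.single_le_sum (f := fun ω' => if U ω' = U ω then p ω' else 0)
    (fun ω' _ => by split_ifs <;> simp [hp]) (Finset.mem_univ ω)
  simpa using this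

theorem law_le_law_comp {p : Ω → ℝ} (hp : ∀ ω, 0 ≤ p ω) (U : Ω → A) (g : A → B) (a : A) :
    law p U a ≤ law p (fun ω => g (U ω)) (g a) := by
  rw [← law_law p U g]
  exact le_law (law_nonneg hp U) g a

theorem sum_law_fst (p : Ω → ℝ) (U : Ω → A) (V : Ω → B) (b : B) :
    ∑ a, law p (fun ω => (U ω, V ω)) (a, b) = law p V b := by
  classical
  simp_rw [law_eq_sum]
  rw [Finset.sum_comm]
  refine Finset.sum_congr rfl fun ω _ => ?_
  by_cases h : V ω = b <;> simp [h]

theorem sum_law_snd (p : Ω → ℝ) (U : Ω → A) (V : Ω → B) (a : A) :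
    ∑ b, law p (fun ω => (U ω, V ω)) (a, b) = law p U a := by
  classical
  simp_rw [law_eq_sum]
  rw [Finset.sum_comm]
  refine Finset.sum_congr rfl fun ω _ => ?_
  by_cases h : U ω = a <;> simp [h]

theorem entropy_eq_sum (p : Ω → ℝ) (U : Ω → A) :
    entropy p U = -∑ ω, p ω * Real.logb 2 (law p U (U ω)) := by
  unfold entropy
  rw [sum_law_mul p U (fun a => Real.logb 2 (law p U a))]

theorem entropy_law (p : Ω → ℝ) (U : Ω → A) (g : A → B) :
    entropy (law p U) g = entropy p (fun ω => g (U ω)) := by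
  unfold entropy
  rw [law_law]

theorem expect_law (p : Ω → ℝ) (U : Ω → A) (f : A → ℝ) :
    expect (law p U) f = expect p (fun ω => f (U ω)) := sum_law_mul p U f

theorem mutualInfo_law (p : Ω → ℝ) (U : Ω → A) (g : A → B) (h : A → C) :
    mutualInfo (law p U) g h = mutualInfo p (fun ω => g (U ω)) (fun ω => h (U ω)) := by
  unfold mutualInfo
  simp only [entropy_law]

theorem logb_two_le_div (x : ℝ) (hx : 0 < x) : Real.logb 2 x ≤ (x - 1) / Real.log 2 := by
  unfold Real.logb
  have := Real.log_le_sub_one_of_pos hx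
  have h2 : 0 < Real.log 2 := Real.log_pos (by norm_num)
  gcongr

/-- Gibbs' inequality: entropy is at most cross-entropy. -/
theorem entropy_le_cross {p : Ω → ℝ} (hp : p ∈ stdSimplex ℝ Ω) (U : Ω → A) (q : A → ℝ)
    (hq0 : ∀ a, 0 ≤ q a) (hq : ∑ a, q a ≤ 1) (hpos : ∀ ω, 0 < p ω → 0 < q (U ω)) :
    entropy p U ≤ -∑ ω, p ω * Real.logb 2 (q (U ω)) := by
  have h2 : 0 < Real.log 2 := Real.log_pos (by norm_num)
  have hl := law_mem_stdSimplex hp U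
  unfold entropy
  rw [neg_le_neg_iff, ← sum_law_mul p U (fun a => Real.logb 2 (q a)), ← sub_nonpos,
    ← Finset.sum_sub_distrib]
  -- This is log x ≤ x - 1 at x = q/p, weighted by p; the right-hand sides sum to at most 0.
  have key : ∀ a, law p U a * Real.logb 2 (q a) - law p U a * Real.logb 2 (law p U a)
      ≤ (q a - law p U a) / Real.log 2 := by
    intro a
    rcases (hl.1 a).eq_or_lt with h0 | h0
    · rw [← h0]; simp only [zero_mul, sub_zero]; exact div_nonneg (hq0 a) h2.le
    · have hqa : 0 < q a := by
        classical
        rw [law_eq_sum] at h0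
        obtain ⟨ω, -, hω⟩ := Finset.exists_lt_of_sum_lt (s := Finset.univ)
          (f := fun _ : Ω => (0 : ℝ)) (by simpa using h0)
        split_ifs at hω with h
        · exact h ▸ hpos ω hω
        · exact absurd hω (lt_irrefl _)
      have := logb_two_le_div (q a / law p U a) (div_pos hqa h0)
      rw [Real.logb_div hqa.ne' h0.ne'] at this
      calc _ = law p U a * (Real.logb 2 (q a) - Real.logb 2 (law p U a)) := by ring
        _ ≤ law p U a * ((q a / law p U a - 1) / Real.log 2) := by gcongr
        _ = _ := by field_simp
  calc _ ≤ ∑ a, (q a - law p U a) / Real.log 2 := Finset.sum_le_sum fun a _ => key a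
    _ = (∑ a, q a - 1) / Real.log 2 := by
      rw [← Finset.sum_div, Finset.sum_sub_distrib, hl.2]
    _ ≤ 0 := div_nonpos_of_nonpos_of_nonneg (by linarith) h2.le

theorem law_pos {p : Ω → ℝ} (hp : ∀ ω, 0 ≤ p ω) (U : Ω → A) {ω : Ω} (h : 0 < p ω) :
    0 < law p U (U ω) := h.trans_le (le_law hp U ω)

/-- Applying a function does not increase entropy. -/
theorem entropy_comp_le {p : Ω → ℝ} (hp : p ∈ stdSimplex ℝ Ω) (U : Ω → A) (g : A → B) :
    entropy p (fun ω => g (U ω)) ≤ entropy p U := by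
  rw [entropy_eq_sum, entropy_eq_sum, neg_le_neg_iff]
  refine Finset.sum_le_sum fun ω _ => ?_
  rcases (hp.1 ω).eq_or_lt with h0 | h0
  · simp [← h0]
  · have := law_le_law_comp hp.1 U g (U ω)
    have h1 := law_pos hp.1 U h0
    gcongr
    norm_num

theorem entropy_le_of_comp {p : Ω → ℝ} (hp : p ∈ stdSimplex ℝ Ω) {U : Ω → A} {V : Ω → B}
    (g : A → B) (h : ∀ ω, V ω = g (U ω)) : entropy p V ≤ entropy p U := by
  rw [show V = fun ω => g (U ω) from funext h]
  exact entropy_comp_le hp U g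

theorem entropy_eq_of_comp {p : Ω → ℝ} (hp : p ∈ stdSimplex ℝ Ω) {U : Ω → A} {V : Ω → B}
    (g : A → B) (g' : B → A) (h : ∀ ω, V ω = g (U ω)) (h' : ∀ ω, U ω = g' (V ω)) :
    entropy p V = entropy p U :=
  le_antisymm (entropy_le_of_comp hp g h) (entropy_le_of_comp hp g' h')

theorem entropy_le_logb_card {p : Ω → ℝ} (hp : p ∈ stdSimplex ℝ Ω) (U : Ω → A) :
    entropy p U ≤ Real.logb 2 (Fintype.card A) := by
  cases isEmpty_or_nonempty A with
  | inl h =>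
    have : IsEmpty Ω := ⟨fun ω => h.elim (U ω)⟩
    exact absurd hp.2 (by simp)
  | inr h =>
  have hc : (0 : ℝ) < Fintype.card A := by exact_mod_cast Fintype.card_pos
  have := entropy_le_cross hp U (fun _ => (Fintype.card A : ℝ)⁻¹) (fun _ => by positivity)
    (by simp) (fun _ _ => by positivity)
  simpa [← Finset.sum_mul, hp.2, Real.logb_inv] using this

/-- Strong subadditivity of entropy. -/
theorem entropy_submodular {p : Ω → ℝ} (hp : p ∈ stdSimplex ℝ Ω) (U : Ω → A) (V : Ω → B)
    (W : Ω → C) :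
    entropy p (fun ω => (U ω, V ω, W ω)) + entropy p W
      ≤ entropy p (fun ω => (U ω, W ω)) + entropy p (fun ω => (V ω, W ω)) := by
  have hUW := law_mem_stdSimplex hp (fun ω => (U ω, W ω))
  have hVW := law_mem_stdSimplex hp (fun ω => (V ω, W ω))
  have hW := law_mem_stdSimplex hp W
  -- Gibbs' inequality is applied with the law p(u,w) p(v,w) / p(w), under which U and V are
  -- conditionally independent given W.
  have := entropy_le_cross hp (fun ω => (U ω, V ω, W ω))
    (fun t => law p (fun ω => (U ω, W ω)) (t.1, t.2.2) * law p (fun ω => (V ω, W ω)) (t.2.1, t.2.2)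
      / law p W t.2.2)
    (fun t => div_nonneg (mul_nonneg (hUW.1 _) (hVW.1 _)) (hW.1 _))
    (by
      rw [Fintype.sum_prod_type_right, Fintype.sum_prod_type_right]
      simp_rw [← Finset.sum_div, ← Finset.sum_mul, sum_law_fst, ← Finset.mul_sum, sum_law_fst]
      calc _ ≤ ∑ w, law p W w := Finset.sum_le_sum fun w _ => ?_
        _ = 1 := hW.2
        _ ≤ 1 := le_rfl
      rcases eq_or_ne (law p W w) 0 with h | h
      · simp [h]
      · rw [mul_div_assoc, div_self h, mul_one])
    (fun ω h => div_pos (mul_pos (law_pos hp.1 (fun ω => (U ω, W ω)) h)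
      (law_pos hp.1 (fun ω => (V ω, W ω)) h)) (law_pos hp.1 W h))
  have e : ∑ ω, p ω * Real.logb 2 (law p (fun ω => (U ω, W ω)) (U ω, W ω)
        * law p (fun ω => (V ω, W ω)) (V ω, W ω) / law p W (W ω))
      = ∑ ω, p ω * Real.logb 2 (law p (fun ω => (U ω, W ω)) (U ω, W ω))
        + ∑ ω, p ω * Real.logb 2 (law p (fun ω => (V ω, W ω)) (V ω, W ω))
        - ∑ ω, p ω * Real.logb 2 (law p W (W ω)) := by
    rw [← Finset.sum_add_distrib, ← Finset.sum_sub_distrib]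
    refine Finset.sum_congr rfl fun ω _ => ?_
    rcases (hp.1 ω).eq_or_lt with h0 | h0
    · simp [← h0]
    · have h1 := law_pos hp.1 (fun ω => (U ω, W ω)) h0
      have h2 := law_pos hp.1 (fun ω => (V ω, W ω)) h0
      have h3 := law_pos hp.1 W h0
      rw [Real.logb_div (mul_pos h1 h2).ne' h3.ne', Real.logb_mul h1.ne' h2.ne']
      ring
  dsimp only at this
  rw [e] at this
  rw [entropy_eq_sum p (fun ω => (U ω, W ω)), entropy_eq_sum p (fun ω => (V ω, W ω)),
    entropy_eq_sum p W]
  linarith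

theorem condMutualInfo_nonneg {p : Ω → ℝ} (hp : p ∈ stdSimplex ℝ Ω) (U : Ω → A) (V : Ω → B)
    (W : Ω → C) : 0 ≤ condMutualInfo p U V W := by
  unfold condMutualInfo
  linarith [entropy_submodular hp U V W]

theorem entropy_const {p : Ω → ℝ} (hp : p ∈ stdSimplex ℝ Ω) (a : A) :
    entropy p (fun _ => a) = 0 := by
  classical
  rw [entropy_eq_sum]
  simp [law_eq_sum, hp.2]

theorem entropy_pair_le {p : Ω → ℝ} (hp : p ∈ stdSimplex ℝ Ω) (U : Ω → A) (V : Ω → B) :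
    entropy p (fun ω => (U ω, V ω)) ≤ entropy p U + entropy p V := by
  have h := entropy_submodular hp U V (fun _ => ())
  rw [entropy_const hp] at h
  rw [entropy_eq_of_comp hp (U := fun ω => (U ω, V ω)) (fun t => (t.1, t.2, ()))
    (fun t => (t.1, t.2.1)) (fun _ => rfl) (fun _ => rfl)] at h
  rw [entropy_eq_of_comp hp (U := U) (V := fun ω => (U ω, ())) (fun t => (t, ())) Prod.fst
    (fun _ => rfl) (fun _ => rfl),
    entropy_eq_of_comp hp (U := V) (V := fun ω => (V ω, ())) (fun t => (t, ())) Prod.fst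
    (fun _ => rfl) (fun _ => rfl)] at h
  linarith

theorem mutualInfo_nonneg {p : Ω → ℝ} (hp : p ∈ stdSimplex ℝ Ω) (U : Ω → A) (V : Ω → B) :
    0 ≤ mutualInfo p U V := by
  unfold mutualInfo
  linarith [entropy_pair_le hp U V]

/-- Fano's inequality, for a random variable `U` that is a function of a random variable with
at most `N` values. -/
theorem fano {p : Ω → ℝ} (hp : p ∈ stdSimplex ℝ Ω) (U V : Ω → A) (Φ : Ω → B) (φ : B → A)
    (hU : ∀ ω, U ω = φ (Φ ω)) {ε : ℝ} (hε0 : 0 < ε) (hε1 : ε < 1)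
    (hε : prob p {ω | U ω ≠ V ω} ≤ ε) :
    entropy p (fun ω => (U ω, V ω)) - entropy p V
      ≤ -Real.logb 2 (1 - ε) + ε * (Real.logb 2 (Fintype.card B) - Real.logb 2 ε) := by
  classical
  have hB : Nonempty B := by
    by_contra hB
    rw [not_nonempty_iff] at hB
    have : IsEmpty Ω := ⟨fun ω => hB.elim (Φ ω)⟩
    exact absurd hp.2 (by simp)
  have hN : (1 : ℝ) ≤ Fintype.card B := by exact_mod_cast Fintype.card_pos
  have hN0 : (0 : ℝ) < Fintype.card B := by linarith
  have hV := law_mem_stdSimplex hp V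
  -- A test conditional law of U given V: mass 1 - ε on the guess U = V and mass ε spread over the
  -- image of φ. Only the size of B enters, not that of A.
  let r : A → A → ℝ := fun u v => (if u = v then 1 - ε else 0)
    + (if u ∈ Finset.univ.image φ then ε / Fintype.card B else 0)
  have hr0 : ∀ u v, 0 ≤ r u v := fun u v => by
    dsimp only [r]
    have : 0 ≤ ε / Fintype.card B := by positivity
    split_ifs <;> linarith
  have hr1 : ∀ v, ∑ u, r u v ≤ 1 := fun v => by
    dsimp only [r]
    rw [Finset.sum_add_distrib, Finset.sum_ite_eq' , Finset.sum_ite_mem]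
    have : ((Finset.univ.image φ).card : ℝ) ≤ Fintype.card B := by
      exact_mod_cast Finset.card_image_le
    simp only [Finset.mem_univ, if_true, Finset.univ_inter, Finset.sum_const, nsmul_eq_mul]
    have : ((Finset.univ.image φ).card : ℝ) * (ε / Fintype.card B) ≤ ε := by
      rw [mul_div_assoc', div_le_iff₀ hN0]; nlinarith
    linarith
  have hrpos : ∀ ω, ε / Fintype.card B ≤ r (U ω) (V ω) := fun ω => by
    dsimp only [r]
    have hm : U ω ∈ Finset.univ.image φ := by
      rw [hU]; exact Finset.mem_image_of_mem _ (Finset.mem_univ _)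
    rw [if_pos hm]
    split_ifs <;> linarith
  have hεN : 0 < ε / Fintype.card B := by positivity
  have hrpos' : ∀ ω, 0 < r (U ω) (V ω) := fun ω => hεN.trans_le (hrpos ω)
  have := entropy_le_cross hp (fun ω => (U ω, V ω)) (fun t => law p V t.2 * r t.1 t.2)
    (fun t => mul_nonneg (hV.1 _) (hr0 _ _))
    (by
      rw [Fintype.sum_prod_type_right]
      simp_rw [← Finset.mul_sum]
      calc _ ≤ ∑ v, law p V v * 1 :=
            Finset.sum_le_sum fun v _ => mul_le_mul_of_nonneg_left (hr1 v) (hV.1 v)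
        _ = 1 := by simp [hV.2]
        _ ≤ 1 := le_rfl)
    (fun ω h => mul_pos (law_pos hp.1 V h) (hrpos' ω))
  have e : ∑ ω, p ω * Real.logb 2 (law p V (V ω) * r (U ω) (V ω))
      = ∑ ω, p ω * Real.logb 2 (law p V (V ω)) + ∑ ω, p ω * Real.logb 2 (r (U ω) (V ω)) := by
    rw [← Finset.sum_add_distrib]
    refine Finset.sum_congr rfl fun ω _ => ?_
    rcases (hp.1 ω).eq_or_lt with h0 | h0
    · simp [← h0]
    · rw [Real.logb_mul (law_pos hp.1 V h0).ne' (hrpos' ω).ne']; ring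
  dsimp only at this
  rw [e] at this
  rw [entropy_eq_sum p V]
  have hl1 : Real.logb 2 (1 - ε) ≤ 0 :=
    Real.logb_nonpos (by norm_num) (by linarith) (by linarith)
  have hlN : 0 ≤ Real.logb 2 (Fintype.card B) - Real.logb 2 ε := by
    have h1 := Real.logb_nonneg (b := 2) (by norm_num) hN
    have h2 := Real.logb_nonpos (b := 2) (by norm_num) hε0.le hε1.le
    linarith
  have key : ∀ ω, -(p ω * Real.logb 2 (r (U ω) (V ω)))
      ≤ p ω * -Real.logb 2 (1 - ε) + (if ω ∈ {ω | U ω ≠ V ω} then p ω else 0)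
        * (Real.logb 2 (Fintype.card B) - Real.logb 2 ε) := by
    intro ω
    have h0 := hp.1 ω
    by_cases h : U ω = V ω
    · have h1 : 1 - ε ≤ r (U ω) (V ω) := by
        dsimp only [r]
        rw [if_pos h]
        split_ifs <;> linarith
      have : Real.logb 2 (1 - ε) ≤ Real.logb 2 (r (U ω) (V ω)) :=
        Real.logb_le_logb_of_le (by norm_num) (by linarith) h1
      simp only [Set.mem_ofPred_eq, ne_eq, h, not_true_eq_false, if_false, zero_mul, add_zero]
      rw [h] at this
      nlinarith
    · have : Real.logb 2 (ε / Fintype.card B) ≤ Real.logb 2 (r (U ω) (V ω)) :=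
        Real.logb_le_logb_of_le (by norm_num) hεN (hrpos ω)
      rw [Real.logb_div hε0.ne' hN0.ne'] at this
      simp only [Set.mem_ofPred_eq, ne_eq, h, not_false_eq_true, if_true]
      nlinarith
  have hs := Finset.sum_le_sum fun ω (_ : ω ∈ Finset.univ) => key ω
  rw [Finset.sum_neg_distrib, Finset.sum_add_distrib, ← Finset.sum_mul, ← Finset.sum_mul, hp.2,
    ← prob_eq_sum] at hs
  nlinarith [mul_le_mul_of_nonneg_right hε hlN]

end EntropyBasics

/-! ### Probabilities of events and product laws -/

section Prob

variable {Ω A B C : Type*} [Fintype Ω] [Fintype A] [Fintype B] [Fintype C]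

theorem prob_mono {p : Ω → ℝ} (hp : ∀ ω, 0 ≤ p ω) {E F : Set Ω} (h : E ⊆ F) :
    prob p E ≤ prob p F := by
  classical
  rw [prob_eq_sum, prob_eq_sum]
  refine Finset.sum_le_sum fun ω _ => ?_
  by_cases hE : ω ∈ E
  · simp [hE, h hE]
  · have := hp ω
    simp only [hE, if_false]
    split_ifs <;> simp [this]

theorem prob_union_le {p : Ω → ℝ} (hp : ∀ ω, 0 ≤ p ω) (E F : Set Ω) :
    prob p (E ∪ F) ≤ prob p E + prob p F := by
  classical
  rw [prob_eq_sum, prob_eq_sum, prob_eq_sum, ← Finset.sum_add_distrib]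
  refine Finset.sum_le_sum fun ω _ => ?_
  have := hp ω
  by_cases hE : ω ∈ E <;> by_cases hF : ω ∈ F <;> simp [hE, hF, this]

theorem prob_compl {p : Ω → ℝ} (hp : p ∈ stdSimplex ℝ Ω) (E : Set Ω) :
    prob p Eᶜ = 1 - prob p E := by
  classical
  rw [prob_eq_sum, prob_eq_sum, ← hp.2, ← Finset.sum_sub_distrib]
  refine Finset.sum_congr rfl fun ω _ => ?_
  by_cases hE : ω ∈ E <;> simp [hE]

theorem prob_law (p : Ω → ℝ) (U : Ω → A) (E : Set A) :
    prob (law p U) E = prob p {ω | U ω ∈ E} := by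
  classical
  have h := sum_law_mul p U (fun a => if a ∈ E then 1 else 0)
  rw [prob_eq_sum, prob_eq_sum]
  simpa using h

/-- A weighted average is at least one of the averaged values. -/
theorem exists_le_of_expect_le {p : Ω → ℝ} (hp : p ∈ stdSimplex ℝ Ω) (F : Ω → ℝ) {t : ℝ}
    (h : ∑ ω, p ω * F ω ≤ t) : ∃ ω, F ω ≤ t := by
  by_contra! hc
  have h0 : ∃ ω, 0 < p ω := by
    by_contra! h0
    have : ∑ ω, p ω ≤ 0 := Finset.sum_nonpos fun ω _ => h0 ω
    rw [hp.2] at this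
    linarith
  obtain ⟨ω₀, h0⟩ := h0
  have : ∑ ω, p ω * t < ∑ ω, p ω * F ω :=
    Finset.sum_lt_sum (fun ω _ => mul_le_mul_of_nonneg_left (hc ω).le (hp.1 ω))
      ⟨ω₀, Finset.mem_univ _, mul_lt_mul_of_pos_left (hc ω₀) h0⟩
  rw [← Finset.sum_mul, hp.2, one_mul] at this
  linarith

end Prob

section Product

variable {ι A : Type*} [Fintype ι] [DecidableEq ι] [Fintype A]

theorem sum_pi_prod (f : ι → A → ℝ) :
    ∑ φ : ι → A, ∏ i, f i (φ i) = ∏ i, ∑ a, f i a := by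
  rw [Fintype.prod_sum]

theorem pi_mem_stdSimplex {p : ι → A → ℝ} (hp : ∀ i, p i ∈ stdSimplex ℝ A) :
    (fun φ : ι → A => ∏ i, p i (φ i)) ∈ stdSimplex ℝ (ι → A) :=
  ⟨fun φ => Finset.prod_nonneg fun i _ => (hp i).1 _, by
    rw [sum_pi_prod]; exact Finset.prod_eq_one fun i _ => (hp i).2⟩

theorem sum_pi_prod_mul_apply {p : ι → A → ℝ} (hp : ∀ i, p i ∈ stdSimplex ℝ A) (i₀ : ι)
    (F : A → ℝ) :
    ∑ φ : ι → A, (∏ i, p i (φ i)) * F (φ i₀) = ∑ a, p i₀ a * F a := by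
  have h := sum_pi_prod (fun i a => p i a * if i = i₀ then F a else 1)
  rw [Fintype.prod_eq_single i₀] at h
  · simp only [if_true] at h
    rw [← h]
    refine Finset.sum_congr rfl fun φ _ => ?_
    rw [Finset.prod_mul_distrib]
    congr 1
    simp
  · intro i hi
    simp [hi, (hp i).2]

theorem sum_pi_prod_mul_apply_mul_apply {p : ι → A → ℝ} (hp : ∀ i, p i ∈ stdSimplex ℝ A)
    {i₀ i₁ : ι} (hne : i₀ ≠ i₁) (F G : A → ℝ) :
    ∑ φ : ι → A, (∏ i, p i (φ i)) * (F (φ i₀) * G (φ i₁))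
      = (∑ a, p i₀ a * F a) * ∑ a, p i₁ a * G a := by
  have h := sum_pi_prod (fun i a => p i a * ((if i = i₀ then F a else 1)
    * (if i = i₁ then G a else 1)))
  rw [Fintype.prod_eq_mul i₀ i₁ hne] at h
  · simp only [if_true, hne, hne.symm, if_false, mul_one, one_mul] at h
    rw [← h]
    refine Finset.sum_congr rfl fun φ _ => ?_
    rw [Finset.prod_mul_distrib, Finset.prod_mul_distrib]
    congr 2 <;> simp
  · intro i hi
    simp [hi.1, hi.2, (hp i).2]

theorem sum_pi_prod_mul_apply₂ {p : ι → A → ℝ} (hp : ∀ i, p i ∈ stdSimplex ℝ A)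
    {i₀ i₁ : ι} (hne : i₀ ≠ i₁) (F : A → A → ℝ) :
    ∑ φ : ι → A, (∏ i, p i (φ i)) * F (φ i₀) (φ i₁)
      = ∑ a, p i₀ a * ∑ b, p i₁ b * F a b := by
  classical
  -- Expanding in indicators of the first coordinate reduces a general function of two coordinates
  -- to products.
  have e : ∀ φ : ι → A, F (φ i₀) (φ i₁)
      = ∑ a, (if φ i₀ = a then 1 else 0) * F a (φ i₁) := fun φ => by simp
  simp_rw [e, Finset.mul_sum]
  rw [Finset.sum_comm]
  refine Finset.sum_congr rfl fun a _ => ?_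
  rw [sum_pi_prod_mul_apply_mul_apply hp hne (fun a' => if a' = a then 1 else 0) (F a)]
  simp [Finset.mul_sum]

/-- Independent centred variables are uncorrelated, so the off-diagonal terms of the square vanish
and only the variances remain. -/
theorem sum_pi_prod_mul_sum_sq {p : A → ℝ} (hp : p ∈ stdSimplex ℝ A) (g : A → ℝ)
    (hg : ∑ a, p a * g a = 0) :
    ∑ φ : ι → A, (∏ i, p (φ i)) * (∑ i, g (φ i)) ^ 2
      = Fintype.card ι * ∑ a, p a * g a ^ 2 := by
  simp_rw [sq (∑ i, _), Finset.sum_mul_sum, Finset.mul_sum]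
  rw [Finset.sum_comm]
  simp_rw [Finset.sum_comm (s := (Finset.univ : Finset (ι → A)))]
  have : ∀ i j : ι, ∑ φ : ι → A, (∏ i, p (φ i)) * (g (φ i) * g (φ j))
      = if i = j then ∑ a, p a * g a ^ 2 else 0 := by
    intro i j
    split_ifs with h
    · subst h
      rw [sum_pi_prod_mul_apply (p := fun _ => p) (fun _ => hp) i (fun a => g a * g a)]
      simp_rw [sq]
    · rw [sum_pi_prod_mul_apply_mul_apply (p := fun _ => p) (fun _ => hp) h, hg, zero_mul]
  simp_rw [this]
  simp [Finset.mul_sum]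

/-- Chebyshev's inequality for sums of i.i.d. random variables. -/
theorem chebyshev {p : A → ℝ} (hp : p ∈ stdSimplex ℝ A) (g : A → ℝ) {δ : ℝ} (hδ : 0 < δ) :
    prob (fun φ : ι → A => ∏ i, p (φ i))
      {φ | Fintype.card ι * ((∑ a, p a * g a) + δ) < ∑ i, g (φ i)} * (Fintype.card ι * δ ^ 2)
      ≤ ∑ a, p a * (g a - ∑ b, p b * g b) ^ 2 := by
  classical
  set m := ∑ a, p a * g a with hm
  set n : ℝ := ((Fintype.card ι : ℕ) : ℝ)
  have hn : 0 ≤ n := Nat.cast_nonneg _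
  have hV : 0 ≤ ∑ a, p a * (g a - m) ^ 2 :=
    Finset.sum_nonneg fun a _ => mul_nonneg (hp.1 a) (sq_nonneg _)
  have hmean : ∑ a, p a * (g a - m) = 0 := by
    simp_rw [mul_sub, Finset.sum_sub_distrib, ← Finset.sum_mul, hp.2, ← hm]
    ring
  have hsq := sum_pi_prod_mul_sum_sq (ι := ι) hp (fun a => g a - m) hmean
  have h1 : prob (fun φ : ι → A => ∏ i, p (φ i)) {φ | n * (m + δ) < ∑ i, g (φ i)} * (n * δ) ^ 2
      ≤ n * ∑ a, p a * (g a - m) ^ 2 := by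
    rw [← hsq, prob_eq_sum, Finset.sum_mul]
    refine Finset.sum_le_sum fun φ _ => ?_
    have hφ : 0 ≤ ∏ i, p (φ i) := Finset.prod_nonneg fun i _ => hp.1 _
    simp only [Set.mem_ofPred_eq]
    split_ifs with h
    · refine mul_le_mul_of_nonneg_left ?_ hφ
      have : n * δ ≤ ∑ i, (g (φ i) - m) := by
        rw [Finset.sum_sub_distrib, Finset.sum_const, Finset.card_univ, nsmul_eq_mul]
        linarith
      have h0 : 0 ≤ n * δ := by positivity
      nlinarith
    · rw [zero_mul]
      positivity
  rcases hn.eq_or_lt with h0 | h0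
  · rw [← h0]
    simpa using hV
  · refine le_of_mul_le_mul_left ?_ h0
    calc _ = _ := by ring
      _ ≤ _ := h1

end Product

/-! ### Superposition codebooks and covering -/

/-- Follows from 1 - β ≤ exp(-β) and exp(-y) ≤ 1/(1+y) ≤ 1 - y/2 on [0,1]. It bounds the probability
that all satellites of one cloud miss, whether that is likely or not. -/
theorem one_sub_pow_le_min {β : ℝ} (h0 : 0 ≤ β) (h1 : β ≤ 1) (N : ℕ) :
    (1 - β) ^ N ≤ 1 - 1 / 2 * min 1 (N * β) := by
  have h := Real.one_sub_le_exp_neg β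
  have h2 : (1 - β) ^ N ≤ Real.exp (-(N * β)) := by
    calc _ ≤ Real.exp (-β) ^ N := pow_le_pow_left₀ (by linarith) h N
      _ = _ := by rw [← Real.exp_nat_mul]; ring_nf
  refine h2.trans ?_
  set x := (N : ℝ) * β
  have hx : 0 ≤ x := by positivity
  set y := min 1 x
  have hy0 : 0 ≤ y := le_min zero_le_one hx
  have hy1 : y ≤ 1 := min_le_left _ _
  have h3 : Real.exp (-x) ≤ Real.exp (-y) := Real.exp_le_exp.2 (neg_le_neg (min_le_right _ _))
  have h4 : Real.exp (-y) ≤ (1 + y)⁻¹ := by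
    rw [Real.exp_neg]
    have := Real.add_one_le_exp y
    gcongr
    linarith
  have h5 : (1 + y)⁻¹ ≤ 1 - 1 / 2 * y := by
    rw [inv_le_iff_one_le_mul₀ (by linarith)]
    nlinarith
  linarith

/-- Convexity of exp along the segment from 0 to -NK. In the covering lemma c is the conditional
probability of the typical set and K the gain of one cloud. -/
theorem one_sub_mul_pow_le {K c : ℝ} (hc0 : 0 ≤ c) (hc1 : c ≤ 1) (h1 : K * c ≤ 1)
    (N : ℕ) : (1 - K * c) ^ N ≤ 1 - c + Real.exp (-(N * K)) := by
  have h := Real.one_sub_le_exp_neg (K * c)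
  have h2 : (1 - K * c) ^ N ≤ Real.exp (-(N * K) * c) := by
    calc _ ≤ Real.exp (-(K * c)) ^ N := pow_le_pow_left₀ (by linarith) h N
      _ = _ := by rw [← Real.exp_nat_mul]; ring_nf
  refine h2.trans ?_
  have hconv := convexOn_exp.2 (Set.mem_univ 0) (Set.mem_univ (-(N * K)))
    (sub_nonneg.2 hc1) hc0 (by ring)
  simp only [smul_eq_mul, mul_zero, zero_add, Real.exp_zero, mul_one] at hconv
  rw [mul_comm c] at hconv
  have := Real.exp_pos (-(N * K))
  nlinarith

section Superposition

variable {U V J : Type*} [Fintype U] [Fintype V] [Fintype J] [DecidableEq J]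

/-- A cloud centre together with its satellites: the letters of a superposition codebook. -/
def cloudLaw (J : Type*) [Fintype J] (Q₁ : U → ℝ) (Q₂ : U → V → ℝ) : U × (J → V) → ℝ :=
  fun c => Q₁ c.1 * ∏ j, Q₂ c.1 (c.2 j)

theorem cloudLaw_mem {Q₁ : U → ℝ} {Q₂ : U → V → ℝ} (h₁ : Q₁ ∈ stdSimplex ℝ U)
    (h₂ : ∀ u, Q₂ u ∈ stdSimplex ℝ V) : cloudLaw J Q₁ Q₂ ∈ stdSimplex ℝ (U × (J → V)) := by
  refine ⟨fun c => mul_nonneg (h₁.1 _) (Finset.prod_nonneg fun j _ => (h₂ _).1 _), ?_⟩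
  rw [Fintype.sum_prod_type]
  simp only [cloudLaw]
  simp_rw [← Finset.mul_sum]
  rw [← h₁.2]
  refine Finset.sum_congr rfl fun u _ => ?_
  rw [(pi_mem_stdSimplex (ι := J) (fun _ => h₂ u)).2, mul_one]

theorem sum_cloudLaw_mul {Q₁ : U → ℝ} {Q₂ : U → V → ℝ} (h₂ : ∀ u, Q₂ u ∈ stdSimplex ℝ V) (j : J)
    (F : U → V → ℝ) :
    ∑ c : U × (J → V), cloudLaw J Q₁ Q₂ c * F c.1 (c.2 j) = ∑ u, Q₁ u * ∑ v, Q₂ u v * F u v := by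
  rw [Fintype.sum_prod_type]
  simp only [cloudLaw, mul_assoc]
  simp_rw [← Finset.mul_sum]
  refine Finset.sum_congr rfl fun u _ => ?_
  rw [sum_pi_prod_mul_apply (p := fun _ => Q₂ u) (fun _ => h₂ u) j (F u)]

theorem sum_cloudLaw_mul_fst {Q₁ : U → ℝ} {Q₂ : U → V → ℝ} (h₂ : ∀ u, Q₂ u ∈ stdSimplex ℝ V)
    (F : U → ℝ) :
    ∑ c : U × (J → V), cloudLaw J Q₁ Q₂ c * F c.1 = ∑ u, Q₁ u * F u := by
  rw [Fintype.sum_prod_type]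
  simp only [cloudLaw]
  refine Finset.sum_congr rfl fun u _ => ?_
  rw [← Finset.sum_mul, ← Finset.mul_sum,
    (pi_mem_stdSimplex (ι := J) (fun _ => h₂ u)).2, mul_one]

theorem sum_cloudLaw_mul₂ {Q₁ : U → ℝ} {Q₂ : U → V → ℝ} (h₂ : ∀ u, Q₂ u ∈ stdSimplex ℝ V)
    {j j' : J} (hj : j ≠ j') (F : U → V → V → ℝ) :
    ∑ c : U × (J → V), cloudLaw J Q₁ Q₂ c * F c.1 (c.2 j) (c.2 j')
      = ∑ u, Q₁ u * ∑ v, Q₂ u v * ∑ v', Q₂ u v' * F u v v' := by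
  rw [Fintype.sum_prod_type]
  simp only [cloudLaw, mul_assoc]
  simp_rw [← Finset.mul_sum]
  refine Finset.sum_congr rfl fun u _ => ?_
  rw [sum_pi_prod_mul_apply₂ (p := fun _ => Q₂ u) (fun _ => h₂ u) hj (F u)]

end Superposition

/-- One-shot covering lemma for superposition codebooks. -/
theorem exists_covering {S U V I J : Type*} [Fintype S] [Fintype U] [Fintype V] [Fintype I]
    [Fintype J] {P : S × U × V → ℝ} (hP : P ∈ stdSimplex ℝ (S × U × V)) (A : Set (S × U × V))
    {Q₁ : U → ℝ} {Q₂ : U → V → ℝ} (hQ₁ : Q₁ ∈ stdSimplex ℝ U) (hQ₂ : ∀ u, Q₂ u ∈ stdSimplex ℝ V)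
    {α β : ℝ} (hα0 : 0 ≤ α) (hβ0 : 0 ≤ β)
    (hα : ∀ s u v, (s, u, v) ∈ A →
      law P (fun ω => (ω.1, ω.2.1)) (s, u) * α ≤ law P (fun ω => ω.1) s * Q₁ u)
    (hβ : ∀ s u v, (s, u, v) ∈ A → P (s, u, v) * β ≤ law P (fun ω => ω.1) s * (Q₁ u * Q₂ u v)) :
    ∃ (cu : I → U) (cv : I → J → V),
      prob (law P (fun ω => ω.1)) {s | ∀ i j, (s, cu i, cv i j) ∉ A}
        ≤ prob P Aᶜ + Real.exp (-(1 / 2 * min (Fintype.card I * α)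
            (Fintype.card I * Fintype.card J * β))) := by
  classical
  set PS := law P (fun ω => ω.1) with hPS
  have hPSm : PS ∈ stdSimplex ℝ S := law_mem_stdSimplex hP _
  set L := cloudLaw J Q₁ Q₂ with hL
  have hLm : L ∈ stdSimplex ℝ (U × (J → V)) := cloudLaw_mem hQ₁ hQ₂
  -- The gain of one cloud: it is limited by the chance α that the centre fits, and by |J| β, the
  -- chance that one of its satellites does.
  set κ := min α (Fintype.card J * β) with hκ
  have hκ0 : 0 ≤ κ := le_min hα0 (by positivity)
  let a : S → U → ℝ := fun s u => ∑ v, if (s, u, v) ∈ A then P (s, u, v) else 0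
  have ha0 : ∀ s u, 0 ≤ a s u := fun s u =>
    Finset.sum_nonneg fun v _ => by split_ifs <;> simp [hP.1]
  have hlawSU : ∀ s u, law P (fun ω => (ω.1, ω.2.1)) (s, u) = ∑ v, P (s, u, v) := by
    intro s u
    have := sum_law_snd P (fun ω => (ω.1, ω.2.1)) (fun ω => ω.2.2) (s, u)
    rw [← this]
    refine Finset.sum_congr rfl fun v _ => ?_
    rw [law_eq_sum, Finset.sum_eq_single (s, u, v)]
    · simp
    · rintro ⟨s', u', v'⟩ - h
      rw [if_neg]
      contrapose! h
      simp only [Prod.mk.injEq] at h ⊢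
      tauto
    · simp
  have hlawS : ∀ s, PS s = ∑ u, ∑ v, P (s, u, v) := by
    intro s
    rw [hPS, ← sum_law_snd P (fun ω => ω.1) (fun ω => ω.2.1) s]
    exact Finset.sum_congr rfl fun u _ => hlawSU s u
  have ha1 : ∀ s, ∑ u, a s u ≤ PS s := by
    intro s
    rw [hlawS]
    refine Finset.sum_le_sum fun u _ => Finset.sum_le_sum fun v _ => ?_
    split_ifs
    · exact le_rfl
    · exact hP.1 _
  let b : S → U → ℝ := fun s u => ∑ v, if (s, u, v) ∈ A then Q₂ u v else 0
  have hb0 : ∀ s u, 0 ≤ b s u := fun s u =>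
    Finset.sum_nonneg fun v _ => by split_ifs <;> simp [(hQ₂ u).1]
  have hb1 : ∀ s u, b s u ≤ 1 := fun s u => by
    rw [← (hQ₂ u).2]
    exact Finset.sum_le_sum fun v _ => by split_ifs <;> simp [(hQ₂ u).1]
  -- the probability that a random cloud misses a source word
  let miss : S → ℝ := fun s => ∑ c, L c * if ∀ j, (s, c.1, c.2 j) ∉ A then 1 else 0
  have hmiss : ∀ s, miss s = ∑ u, Q₁ u * (1 - b s u) ^ Fintype.card J := by
    intro s
    simp only [miss]
    rw [Fintype.sum_prod_type]
    refine Finset.sum_congr rfl fun u _ => ?_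
    simp only [hL, cloudLaw, mul_assoc]
    rw [← Finset.mul_sum]
    congr 1
    have h := sum_pi_prod (fun (_ : J) v => Q₂ u v * if (s, u, v) ∉ A then 1 else 0)
    have e : ∑ v, (Q₂ u v * if (s, u, v) ∉ A then 1 else 0) = 1 - b s u := by
      rw [← (hQ₂ u).2, ← Finset.sum_sub_distrib]
      refine Finset.sum_congr rfl fun v _ => ?_
      by_cases h : (s, u, v) ∈ A <;> simp [h, (hQ₂ u).2]
    rw [e, Finset.prod_const, Finset.card_univ] at h
    rw [← h]
    refine Finset.sum_congr rfl fun φ _ => ?_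
    rw [Finset.prod_mul_distrib]
    congr 1
    rw [Fintype.prod_ite_zero]
    simp
  have hmiss0 : ∀ s, 0 ≤ miss s := fun s =>
    Finset.sum_nonneg fun c _ => mul_nonneg (hLm.1 c) (by split_ifs <;> simp)
  have hmiss_le : ∀ s, 0 < PS s → miss s ≤ 1 - 1 / 2 * κ * ((∑ u, a s u) / PS s) := by
    intro s hs
    rw [hmiss]
    have h1 : ∀ u, Q₁ u * (1 - b s u) ^ Fintype.card J
        ≤ Q₁ u - 1 / 2 * κ * (a s u / PS s) := by
      intro u
      have h2 := mul_le_mul_of_nonneg_left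
        (one_sub_pow_le_min (hb0 s u) (hb1 s u) (Fintype.card J)) (hQ₁.1 u)
      refine h2.trans ?_
      -- The bound with 1 uses `hα` at any single v of the section of `A` at (s,u); an empty section
      -- makes a(s,u) vanish. The bound with |J| b sums `hβ` over the section.
      have h3 : κ * (a s u / PS s) ≤ Q₁ u * min 1 (Fintype.card J * b s u) := by
        rw [mul_div_assoc', div_le_iff₀ hs, mul_min_of_nonneg _ _ (hQ₁.1 u),
          min_mul_of_nonneg _ _ hs.le]
        refine le_min ?_ ?_
        · by_cases hv : ∃ v, (s, u, v) ∈ A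
          · obtain ⟨v, hv⟩ := hv
            have h4 := hα s u v hv
            rw [hlawSU] at h4
            have h5 : a s u ≤ ∑ v, P (s, u, v) := Finset.sum_le_sum fun v _ => by
              split_ifs <;> simp [hP.1]
            calc κ * a s u ≤ α * ∑ v, P (s, u, v) :=
                  mul_le_mul (min_le_left _ _) h5 (ha0 s u) hα0
              _ ≤ _ := by linarith
          · push Not at hv
            have : a s u = 0 := Finset.sum_eq_zero fun v _ => by simp [hv v]
            rw [this]
            have := hQ₁.1 u
            simp only [mul_zero, mul_one]
            positivity
        · calc κ * a s u ≤ (Fintype.card J * β) * a s u :=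
                mul_le_mul_of_nonneg_right (min_le_right _ _) (ha0 s u)
            _ = Fintype.card J * ∑ v, (if (s, u, v) ∈ A then P (s, u, v) * β else 0) := by
                rw [mul_assoc]
                simp only [a]
                congr 1
                rw [Finset.mul_sum]
                refine Finset.sum_congr rfl fun v _ => ?_
                split_ifs <;> ring
            _ ≤ Fintype.card J * ∑ v, (if (s, u, v) ∈ A then PS s * (Q₁ u * Q₂ u v) else 0) := by
                gcongr with v _
                split_ifs with h
                · exact hβ s u v h
                · exact le_rfl
            _ = Q₁ u * (Fintype.card J * b s u) * PS s := by
                simp only [b, Finset.mul_sum, Finset.sum_mul]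
                refine Finset.sum_congr rfl fun v _ => ?_
                split_ifs <;> ring
      nlinarith
    calc _ ≤ ∑ u, (Q₁ u - 1 / 2 * κ * (a s u / PS s)) := Finset.sum_le_sum fun u _ => h1 u
      _ = _ := by
        rw [Finset.sum_sub_distrib, hQ₁.2, ← Finset.mul_sum, ← Finset.sum_div]
  -- average over the codebook
  have havg : ∑ φ : I → U × (J → V), (∏ i, L (φ i)) *
      prob PS {s | ∀ i j, (s, (φ i).1, (φ i).2 j) ∉ A}
      = ∑ s, PS s * miss s ^ Fintype.card I := by
    simp_rw [prob_eq_sum, Finset.mul_sum]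
    rw [Finset.sum_comm]
    refine Finset.sum_congr rfl fun s _ => ?_
    have h := sum_pi_prod (fun (_ : I) c => L c * if ∀ j, (s, c.1, c.2 j) ∉ A then 1 else 0)
    rw [Finset.prod_const, Finset.card_univ] at h
    rw [← h, Finset.mul_sum]
    refine Finset.sum_congr rfl fun φ _ => ?_
    rw [Finset.prod_mul_distrib, Fintype.prod_ite_zero]
    simp only [Set.mem_ofPred_eq, Finset.prod_const_one]
    split_ifs <;> ring
  have hbound : ∑ s, PS s * miss s ^ Fintype.card I
      ≤ prob P Aᶜ + Real.exp (-(1 / 2 * min (Fintype.card I * α)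
            (Fintype.card I * Fintype.card J * β))) := by
    have h1 : ∀ s, PS s * miss s ^ Fintype.card I
        ≤ PS s - ∑ u, a s u + PS s * Real.exp (-(Fintype.card I * (1 / 2 * κ))) := by
      intro s
      rcases (hPSm.1 s).eq_or_lt with h0 | h0
      · have := ha1 s
        rw [← h0] at this ⊢
        linarith
      · have hm := hmiss_le s h0
        have hc0 : 0 ≤ (∑ u, a s u) / PS s :=
          div_nonneg (Finset.sum_nonneg fun u _ => ha0 s u) h0.le
        have hc1 : (∑ u, a s u) / PS s ≤ 1 := (div_le_one h0).2 (ha1 s)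
        -- Here c is P(A | s). After averaging over s, the terms 1 - c add up to the probability of
        -- the complement of `A`.
        have h2 := one_sub_mul_pow_le (K := 1 / 2 * κ) hc0 hc1
          (by linarith [hmiss0 s]) (Fintype.card I)
        have h3 := (pow_le_pow_left₀ (hmiss0 s) hm (Fintype.card I)).trans h2
        calc _ ≤ PS s * _ := mul_le_mul_of_nonneg_left h3 h0.le
          _ = _ := by field_simp
    have hPA : prob P Aᶜ = 1 - ∑ s, ∑ u, a s u := by
      rw [prob_compl hP, prob_eq_sum, Fintype.sum_prod_type]
      simp_rw [Fintype.sum_prod_type]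
      rfl
    calc _ ≤ ∑ s, (PS s - ∑ u, a s u + PS s * Real.exp (-(Fintype.card I * (1 / 2 * κ)))) :=
          Finset.sum_le_sum fun s _ => h1 s
      _ = _ := by
        rw [Finset.sum_add_distrib, Finset.sum_sub_distrib, ← Finset.sum_mul, hPSm.2, hPA, hκ,
          one_mul, mul_assoc, ← mul_min_of_nonneg _ _ (Nat.cast_nonneg (Fintype.card I))]
        ring_nf
  obtain ⟨φ, hφ⟩ := exists_le_of_expect_le
    (pi_mem_stdSimplex (ι := I) (p := fun _ => L) fun _ => hLm) _ (havg.trans_le hbound)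
  exact ⟨fun i => (φ i).1, fun i j => (φ i).2 j, hφ⟩

/-! ### One-shot superposition coding over the degraded channel -/

section Channel

variable {W X Y Z : Type*} [Fintype W] [Fintype X] [Fintype Y] [Fintype Z]

theorem sum_chanLaw_mul (PW : W → ℝ) (PXW : W → X → ℝ) (PYX : X → Y → ℝ) (PZY : Y → Z → ℝ)
    (F : W → X → Y → Z → ℝ) :
    ∑ ω, chanLaw PW PXW PYX PZY ω * F ω.1 ω.2.1 ω.2.2.1 ω.2.2.2
      = ∑ w, PW w * ∑ x, PXW w x * ∑ y, ∑ z, PYX x y * PZY y z * F w x y z := by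
  simp only [Fintype.sum_prod_type, chanLaw, Finset.mul_sum]
  refine Finset.sum_congr rfl fun w _ => Finset.sum_congr rfl fun x _ =>
    Finset.sum_congr rfl fun y _ => Finset.sum_congr rfl fun z _ => ?_
  ring

theorem chanLaw_mem {PW : W → ℝ} {PXW : W → X → ℝ} {PYX : X → Y → ℝ} {PZY : Y → Z → ℝ}
    (hPW : PW ∈ stdSimplex ℝ W) (hPXW : ∀ w, PXW w ∈ stdSimplex ℝ X)
    (hPYX : ∀ x, PYX x ∈ stdSimplex ℝ Y) (hPZY : ∀ y, PZY y ∈ stdSimplex ℝ Z) :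
    chanLaw PW PXW PYX PZY ∈ stdSimplex ℝ (W × X × Y × Z) := by
  refine ⟨fun ω => mul_nonneg (mul_nonneg (mul_nonneg (hPW.1 _) ((hPXW _).1 _)) ((hPYX _).1 _))
    ((hPZY _).1 _), ?_⟩
  have h := sum_chanLaw_mul PW PXW PYX PZY (fun _ _ _ _ => 1)
  simp only [mul_one, ← Finset.mul_sum, (hPZY _).2, (hPYX _).2, (hPXW _).2, hPW.2] at h
  exact h

end Channel

open Classical in
/-- The unique index satisfying `Q`, if there is one. -/
def uniqueOr {K : Type*} (d : K) (Q : K → Prop) : K :=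
  if h : ∃ k, ∀ k', Q k' ↔ k' = k then h.choose else d

theorem uniqueOr_eq {K : Type*} {d : K} {Q : K → Prop} {k : K} (h : Q k)
    (h' : ∀ k', k' ≠ k → ¬Q k') : uniqueOr d Q = k := by
  have hex : ∃ k, ∀ k', Q k' ↔ k' = k :=
    ⟨k, fun k' => ⟨fun hk => by_contra fun hne => h' k' hne hk, fun hk => hk ▸ h⟩⟩
  rw [uniqueOr, dif_pos hex]
  exact ((hex.choose_spec k).1 h).symm

/-- One-shot superposition coding over a degraded broadcast channel, for an arbitrary distribution
of the messages. -/
theorem exists_superposition_code {W X Y Z K₁ K₂ : Type*} [Fintype W] [Fintype X] [Fintype Y]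
    [Fintype Z] [Fintype K₁] [Fintype K₂]
    {PW : W → ℝ} {PXW : W → X → ℝ} {PYX : X → Y → ℝ} {PZY : Y → Z → ℝ}
    (hPW : PW ∈ stdSimplex ℝ W) (hPXW : ∀ w, PXW w ∈ stdSimplex ℝ X)
    (hPYX : ∀ x, PYX x ∈ stdSimplex ℝ Y) (hPZY : ∀ y, PZY y ∈ stdSimplex ℝ Z)
    (T₁ : Set (W × Z)) (T₂ : Set (W × Y)) (T₃ : Set (W × X × Y)) {τ τ' : ℝ}
    (hτ0 : 0 ≤ τ) (hτ'0 : 0 ≤ τ')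
    (h₁ : ∀ w z, (w, z) ∈ T₁ → PW w * law (chanLaw PW PXW PYX PZY) (fun ω => ω.2.2.2) z
      ≤ τ * law (chanLaw PW PXW PYX PZY) (fun ω => (ω.1, ω.2.2.2)) (w, z))
    (h₂ : ∀ w y, (w, y) ∈ T₂ → PW w * law (chanLaw PW PXW PYX PZY) (fun ω => ω.2.2.1) y
      ≤ τ * law (chanLaw PW PXW PYX PZY) (fun ω => (ω.1, ω.2.2.1)) (w, y))
    (h₃ : ∀ w x y, (w, x, y) ∈ T₃ →
      PXW w x * law (chanLaw PW PXW PYX PZY) (fun ω => (ω.1, ω.2.2.1)) (w, y)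
      ≤ τ' * law (chanLaw PW PXW PYX PZY) (fun ω => (ω.1, ω.2.1, ω.2.2.1)) (w, x, y))
    {μ : K₁ × K₂ → ℝ} (hμ : μ ∈ stdSimplex ℝ (K₁ × K₂)) :
    ∃ (f : K₁ × K₂ → X) (g₁ : Z → K₁) (g₂ : Y → K₁ × K₂),
      ∑ m, μ m * prob (fun t : Y × Z => PYX (f m) t.1 * PZY t.1 t.2)
        {t | g₁ t.2 ≠ m.1 ∨ g₂ t.1 ≠ m}
      ≤ prob (chanLaw PW PXW PYX PZY) {ω | (ω.1, ω.2.2.2) ∉ T₁}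
        + prob (chanLaw PW PXW PYX PZY) {ω | (ω.1, ω.2.2.1) ∉ T₂}
        + prob (chanLaw PW PXW PYX PZY) {ω | (ω.1, ω.2.1, ω.2.2.1) ∉ T₃}
        + (Fintype.card K₁ - 1) * (2 * τ) + (Fintype.card K₂ - 1) * τ' := by
  classical
  set Q := chanLaw PW PXW PYX PZY with hQ
  have hQm : Q ∈ stdSimplex ℝ _ := chanLaw_mem hPW hPXW hPYX hPZY
  -- The message set carries a probability law and is therefore nonempty; `d` is the output of a
  -- decoder that finds no unique candidate.
  obtain ⟨d, -⟩ := exists_le_of_expect_le hμ (fun _ => 0) (t := 0) (by simp)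
  set L := cloudLaw K₂ PW PXW with hL
  have hLm : L ∈ stdSimplex ℝ (W × (K₂ → X)) := cloudLaw_mem hPW hPXW
  let enc : (K₁ → W × (K₂ → X)) → K₁ × K₂ → X := fun φ m => (φ m.1).2 m.2
  let dec₁ : (K₁ → W × (K₂ → X)) → Z → K₁ := fun φ z =>
    uniqueOr d.1 fun k => ((φ k).1, z) ∈ T₁
  let dec₂ : (K₁ → W × (K₂ → X)) → Y → K₁ × K₂ := fun φ y =>
    uniqueOr d fun m => ((φ m.1).1, y) ∈ T₂ ∧ ((φ m.1).1, (φ m.1).2 m.2, y) ∈ T₃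
  let err : (K₁ → W × (K₂ → X)) → K₁ × K₂ → ℝ := fun φ m =>
    ∑ y, ∑ z, PYX (enc φ m) y * PZY y z * (if dec₁ φ z ≠ m.1 ∨ dec₂ φ y ≠ m then 1 else 0)
  -- The three terms of the union bound: the true codeword fails a test; a wrong cloud passes at one
  -- of the receivers; a wrong satellite of the right cloud passes at the strong receiver.
  let G₁ : W → X → ℝ := fun w x => ∑ y, ∑ z, PYX x y * PZY y z *
    ((if (w, z) ∉ T₁ then 1 else 0) + (if (w, y) ∉ T₂ then 1 else 0)
      + (if (w, x, y) ∉ T₃ then 1 else 0))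
  let G₂ : X → W → ℝ := fun x w' => ∑ y, ∑ z, PYX x y * PZY y z *
    ((if (w', z) ∈ T₁ then 1 else 0) + (if (w', y) ∈ T₂ then 1 else 0))
  let G₃ : W → X → X → ℝ := fun w x x' => ∑ y, ∑ z, PYX x y * PZY y z *
    (if (w, x', y) ∈ T₃ then 1 else 0)
  have herr : ∀ φ m, err φ m ≤ G₁ (φ m.1).1 ((φ m.1).2 m.2)
      + ∑ k ∈ Finset.univ.erase m.1, G₂ ((φ m.1).2 m.2) (φ k).1
      + ∑ k ∈ Finset.univ.erase m.2, G₃ (φ m.1).1 ((φ m.1).2 m.2) ((φ m.1).2 k) := by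
    intro φ m
    simp only [err, G₁, G₂, G₃]
    rw [Finset.sum_comm (s := Finset.univ.erase m.1), Finset.sum_comm (s := Finset.univ.erase m.2),
      ← Finset.sum_add_distrib, ← Finset.sum_add_distrib]
    refine Finset.sum_le_sum fun y _ => ?_
    rw [Finset.sum_comm (s := Finset.univ.erase m.1), Finset.sum_comm (s := Finset.univ.erase m.2),
      ← Finset.sum_add_distrib, ← Finset.sum_add_distrib]
    refine Finset.sum_le_sum fun z _ => ?_
    rw [← Finset.mul_sum, ← Finset.mul_sum, ← mul_add, ← mul_add]
    refine mul_le_mul_of_nonneg_left ?_ (mul_nonneg ((hPYX _).1 _) ((hPZY _).1 _))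
    have hn2 : ∀ k, (0 : ℝ) ≤ (if ((φ k).1, z) ∈ T₁ then 1 else 0)
        + (if ((φ k).1, y) ∈ T₂ then 1 else 0) := fun k => by split_ifs <;> norm_num
    have hn3 : ∀ k, (0 : ℝ) ≤ (if ((φ m.1).1, (φ m.1).2 k, y) ∈ T₃ then 1 else 0) :=
      fun k => by split_ifs <;> norm_num
    have hs2 := Finset.sum_nonneg fun k (_ : k ∈ Finset.univ.erase m.1) => hn2 k
    have hs3 := Finset.sum_nonneg fun k (_ : k ∈ Finset.univ.erase m.2) => hn3 k
    by_cases c1 : ((φ m.1).1, z) ∈ T₁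
    swap
    · rw [if_pos (show ((φ m.1).1, z) ∉ T₁ from c1)]
      split_ifs <;> linarith
    by_cases c2 : ((φ m.1).1, y) ∈ T₂
    swap
    · rw [if_pos (show ((φ m.1).1, y) ∉ T₂ from c2)]
      split_ifs <;> linarith
    by_cases c3 : ((φ m.1).1, (φ m.1).2 m.2, y) ∈ T₃
    swap
    · rw [if_pos (show ((φ m.1).1, (φ m.1).2 m.2, y) ∉ T₃ from c3)]
      split_ifs <;> linarith
    simp only [c1, c2, c3, not_true_eq_false, if_false, add_zero, zero_add]
    by_cases c4 : ∃ k, k ≠ m.1 ∧ (((φ k).1, z) ∈ T₁ ∨ ((φ k).1, y) ∈ T₂)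
    · obtain ⟨k, hk, hk'⟩ := c4
      have h := Finset.single_le_sum (fun k (_ : k ∈ Finset.univ.erase m.1) => hn2 k)
        (Finset.mem_erase.2 ⟨hk, Finset.mem_univ k⟩)
      have : (1 : ℝ) ≤ (if ((φ k).1, z) ∈ T₁ then 1 else 0)
        + (if ((φ k).1, y) ∈ T₂ then 1 else 0) := by
        rcases hk' with hk' | hk' <;> simp only [hk', if_true] <;> split_ifs <;> norm_num
      split_ifs <;> linarith
    by_cases c5 : ∃ k, k ≠ m.2 ∧ ((φ m.1).1, (φ m.1).2 k, y) ∈ T₃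
    · obtain ⟨k, hk, hk'⟩ := c5
      have h := Finset.single_le_sum (fun k (_ : k ∈ Finset.univ.erase m.2) => hn3 k)
        (Finset.mem_erase.2 ⟨hk, Finset.mem_univ k⟩)
      rw [if_pos hk'] at h
      split_ifs <;> linarith
    push Not at c4 c5
    have e1 : dec₁ φ z = m.1 := uniqueOr_eq c1 fun k hk => (c4 k hk).1
    have e2 : dec₂ φ y = m := by
      refine uniqueOr_eq (And.intro c2 c3) ?_
      rintro k hk ⟨hk1, hk2⟩
      by_cases h : k.1 = m.1
      · rw [h] at hk2
        exact c5 k.2 (fun h' => hk (Prod.ext h h')) hk2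
      · exact (c4 k.1 h).2 hk1
    rw [if_neg (by simp [e1, e2])]
    linarith
  have hLL : ∀ i : K₁, (fun _ : K₁ => L) i ∈ stdSimplex ℝ (W × (K₂ → X)) := fun _ => hLm
  have E1 : ∀ m : K₁ × K₂, ∑ φ : K₁ → W × (K₂ → X), (∏ i, L (φ i))
      * G₁ (φ m.1).1 ((φ m.1).2 m.2)
      = prob Q {ω | (ω.1, ω.2.2.2) ∉ T₁} + prob Q {ω | (ω.1, ω.2.2.1) ∉ T₂}
        + prob Q {ω | (ω.1, ω.2.1, ω.2.2.1) ∉ T₃} := by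
    intro m
    rw [sum_pi_prod_mul_apply hLL m.1 (fun c => G₁ c.1 (c.2 m.2)),
      sum_cloudLaw_mul hPXW m.2 G₁, ← sum_chanLaw_mul, prob_eq_sum, prob_eq_sum, prob_eq_sum,
      ← Finset.sum_add_distrib, ← Finset.sum_add_distrib]
    refine Finset.sum_congr rfl fun ω _ => ?_
    simp only [Set.mem_ofPred_eq, mul_add, mul_ite, mul_one, mul_zero, hQ]
  -- A wrong cloud centre is independent of the outputs, so `h₁` and `h₂` change the product law
  -- into τ times the joint law, whose total mass is 1. The factor 2 counts the two receivers.
  have E2 : ∀ (m : K₁ × K₂) (k : K₁), k ≠ m.1 → ∑ φ : K₁ → W × (K₂ → X), (∏ i, L (φ i))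
      * G₂ ((φ m.1).2 m.2) (φ k).1 ≤ 2 * τ := by
    intro m k hk
    rw [sum_pi_prod_mul_apply₂ hLL hk.symm (fun c c' => G₂ (c.2 m.2) c'.1)]
    have e' : ∀ x, ∑ c, L c * G₂ x c.1 = ∑ w', PW w' * G₂ x w' := fun x =>
      sum_cloudLaw_mul_fst hPXW (G₂ x)
    simp_rw [e']
    rw [sum_cloudLaw_mul hPXW m.2 (fun w x => ∑ w', PW w' * G₂ x w')]
    have e : ∀ x, ∑ w', PW w' * G₂ x w' = ∑ y, ∑ z, PYX x y * PZY y z *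
        ((∑ w', PW w' * if (w', z) ∈ T₁ then 1 else 0)
          + ∑ w', PW w' * if (w', y) ∈ T₂ then 1 else 0) := by
      intro x
      simp only [G₂, Finset.mul_sum, ← Finset.sum_add_distrib]
      rw [Finset.sum_comm]
      refine Finset.sum_congr rfl fun y _ => ?_
      rw [Finset.sum_comm]
      refine Finset.sum_congr rfl fun z _ => Finset.sum_congr rfl fun w' _ => ?_
      ring
    simp_rw [e]
    rw [← sum_chanLaw_mul PW PXW PYX PZY (fun _ _ y z =>
      ((∑ w', PW w' * if (w', z) ∈ T₁ then 1 else 0)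
          + ∑ w', PW w' * if (w', y) ∈ T₂ then 1 else 0))]
    simp_rw [mul_add]
    rw [Finset.sum_add_distrib, ← hQ,
      ← sum_law_mul Q (fun ω => ω.2.2.2) (fun z => ∑ w', PW w' * if (w', z) ∈ T₁ then 1 else 0),
      ← sum_law_mul Q (fun ω => ω.2.2.1) (fun y => ∑ w', PW w' * if (w', y) ∈ T₂ then 1 else 0),
      two_mul]
    refine add_le_add ?_ ?_
    · calc _ ≤ ∑ z, ∑ w, τ * law Q (fun ω => (ω.1, ω.2.2.2)) (w, z) := by
            refine Finset.sum_le_sum fun z _ => ?_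
            rw [Finset.mul_sum]
            refine Finset.sum_le_sum fun w _ => ?_
            split_ifs with h
            · linarith [h₁ w z h]
            · have := mul_nonneg hτ0 (law_nonneg hQm.1 (fun ω => (ω.1, ω.2.2.2)) (w, z))
              simpa using this
        _ = τ := by
          simp_rw [← Finset.mul_sum, sum_law_fst]
          rw [(law_mem_stdSimplex hQm _).2, mul_one]
    · calc _ ≤ ∑ y, ∑ w, τ * law Q (fun ω => (ω.1, ω.2.2.1)) (w, y) := by
            refine Finset.sum_le_sum fun z _ => ?_
            rw [Finset.mul_sum]
            refine Finset.sum_le_sum fun w _ => ?_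
            split_ifs with h
            · linarith [h₂ w z h]
            · have := mul_nonneg hτ0 (law_nonneg hQm.1 (fun ω => (ω.1, ω.2.2.1)) (w, z))
              simpa using this
        _ = τ := by
          simp_rw [← Finset.mul_sum, sum_law_fst]
          rw [(law_mem_stdSimplex hQm _).2, mul_one]
  -- A wrong satellite is independent of the output given the common centre, so `h₃` changes P(x|w)
  -- P(w,y) into τ' times the joint law.
  have E3 : ∀ (m : K₁ × K₂) (k : K₂), k ≠ m.2 → ∑ φ : K₁ → W × (K₂ → X), (∏ i, L (φ i))
      * G₃ (φ m.1).1 ((φ m.1).2 m.2) ((φ m.1).2 k) ≤ τ' := by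
    intro m k hk
    rw [sum_pi_prod_mul_apply hLL m.1 (fun c => G₃ c.1 (c.2 m.2) (c.2 k)),
      sum_cloudLaw_mul₂ hPXW hk.symm G₃]
    have e : ∀ w x, ∑ x', PXW w x' * G₃ w x x' = ∑ y, ∑ z, PYX x y * PZY y z *
        (∑ x', PXW w x' * if (w, x', y) ∈ T₃ then 1 else 0) := by
      intro w x
      simp only [G₃, Finset.mul_sum]
      rw [Finset.sum_comm]
      refine Finset.sum_congr rfl fun y _ => ?_
      rw [Finset.sum_comm]
      refine Finset.sum_congr rfl fun z _ => Finset.sum_congr rfl fun w' _ => ?_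
      ring
    simp_rw [e]
    rw [← sum_chanLaw_mul PW PXW PYX PZY (fun w _ y _ =>
      (∑ x', PXW w x' * if (w, x', y) ∈ T₃ then 1 else 0)), ← hQ,
      ← sum_law_mul Q (fun ω => (ω.1, ω.2.2.1))
        (fun t => ∑ x', PXW t.1 x' * if (t.1, x', t.2) ∈ T₃ then 1 else 0)]
    calc _ ≤ ∑ t : W × Y, ∑ x, τ' * law Q (fun ω => (ω.1, ω.2.1, ω.2.2.1)) (t.1, x, t.2) := by
          refine Finset.sum_le_sum fun t _ => ?_
          rw [Finset.mul_sum]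
          refine Finset.sum_le_sum fun x _ => ?_
          split_ifs with h
          · linarith [h₃ t.1 x t.2 h]
          · have := mul_nonneg hτ'0
              (law_nonneg hQm.1 (fun ω => (ω.1, ω.2.1, ω.2.2.1)) (t.1, x, t.2))
            simpa using this
      _ = ∑ t : W × X × Y, τ' * law Q (fun ω => (ω.1, ω.2.1, ω.2.2.1)) t := by
          simp_rw [Fintype.sum_prod_type]
          refine Finset.sum_congr rfl fun w _ => ?_
          rw [Finset.sum_comm]
      _ = τ' := by
          rw [← Finset.mul_sum, (law_mem_stdSimplex hQm _).2, mul_one]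
  set Bd := prob Q {ω | (ω.1, ω.2.2.2) ∉ T₁} + prob Q {ω | (ω.1, ω.2.2.1) ∉ T₂}
    + prob Q {ω | (ω.1, ω.2.1, ω.2.2.1) ∉ T₃}
    + (Fintype.card K₁ - 1) * (2 * τ) + (Fintype.card K₂ - 1) * τ' with hBd
  -- The bound holds for each fixed message, hence for any law μ; one codebook is fixed only after
  -- averaging over μ.
  have havg : ∀ m, ∑ φ : K₁ → W × (K₂ → X), (∏ i, L (φ i)) * err φ m ≤ Bd := by
    intro m
    have hc1 : ((Finset.univ.erase m.1).card : ℝ) = Fintype.card K₁ - 1 := by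
      rw [Finset.card_erase_of_mem (Finset.mem_univ _), Finset.card_univ,
        Nat.cast_sub (Fintype.card_pos_iff.2 ⟨m.1⟩), Nat.cast_one]
    have hc2 : ((Finset.univ.erase m.2).card : ℝ) = Fintype.card K₂ - 1 := by
      rw [Finset.card_erase_of_mem (Finset.mem_univ _), Finset.card_univ,
        Nat.cast_sub (Fintype.card_pos_iff.2 ⟨m.2⟩), Nat.cast_one]
    calc _ ≤ ∑ φ : K₁ → W × (K₂ → X), (∏ i, L (φ i)) * (G₁ (φ m.1).1 ((φ m.1).2 m.2)
          + ∑ k ∈ Finset.univ.erase m.1, G₂ ((φ m.1).2 m.2) (φ k).1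
          + ∑ k ∈ Finset.univ.erase m.2, G₃ (φ m.1).1 ((φ m.1).2 m.2) ((φ m.1).2 k)) :=
          Finset.sum_le_sum fun φ _ => mul_le_mul_of_nonneg_left (herr φ m)
            (Finset.prod_nonneg fun i _ => hLm.1 _)
      _ ≤ _ := by
        simp_rw [mul_add, Finset.sum_add_distrib, Finset.mul_sum]
        rw [Finset.sum_comm (t := Finset.univ.erase m.1),
          Finset.sum_comm (t := Finset.univ.erase m.2), E1 m, hBd, ← hc1, ← hc2,
          ← nsmul_eq_mul, ← nsmul_eq_mul]
        refine add_le_add (add_le_add le_rfl ?_) ?_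
        · exact Finset.sum_le_card_nsmul _ _ _ fun k hk => E2 m k (Finset.ne_of_mem_erase hk)
        · exact Finset.sum_le_card_nsmul _ _ _ fun k hk => E3 m k (Finset.ne_of_mem_erase hk)
  have htot : ∑ φ : K₁ → W × (K₂ → X), (∏ i, L (φ i)) * ∑ m, μ m * err φ m ≤ Bd := by
    simp_rw [Finset.mul_sum]
    rw [Finset.sum_comm]
    calc _ = ∑ m, μ m * ∑ φ : K₁ → W × (K₂ → X), (∏ i, L (φ i)) * err φ m := by
          refine Finset.sum_congr rfl fun m _ => ?_
          rw [Finset.mul_sum]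
          exact Finset.sum_congr rfl fun φ _ => by ring
      _ ≤ ∑ m, μ m * Bd := Finset.sum_le_sum fun m _ => mul_le_mul_of_nonneg_left (havg m) (hμ.1 m)
      _ = Bd := by rw [← Finset.sum_mul, hμ.2, one_mul]
  obtain ⟨φ, hφ⟩ := exists_le_of_expect_le (pi_mem_stdSimplex hLL) _ htot
  refine ⟨enc φ, dec₁ φ, dec₂ φ, ?_⟩
  refine le_of_eq_of_le (Finset.sum_congr rfl fun m _ => ?_) hφ
  rw [prob_eq_sum, Fintype.sum_prod_type]
  simp only [err, Set.mem_ofPred_eq, mul_ite, mul_one, mul_zero]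

/-! ### Conditional laws and laws of large numbers -/

section Kernel

variable {Ω A B C : Type*} [Fintype Ω] [Fintype A] [Fintype B] [Fintype C]

/-- The Shannon entropy in bits of a mass function. -/
def pmfEntropy (q : A → ℝ) : ℝ := -∑ a, q a * Real.logb 2 (q a)

theorem entropy_eq_pmfEntropy (p : Ω → ℝ) (U : Ω → A) : entropy p U = pmfEntropy (law p U) := rfl

/-- The chain rule `H(V,Z) = H(V) + H(Z|V)`, when `Z` is the output of a channel with input `V`. -/
theorem entropy_pair_of_kernel (p : Ω → ℝ) (V : Ω → B) (Z : Ω → C) (k : B → C → ℝ)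
    (hk : ∀ b, k b ∈ stdSimplex ℝ C)
    (h : ∀ b c, law p (fun ω => (V ω, Z ω)) (b, c) = law p V b * k b c) :
    entropy p (fun ω => (V ω, Z ω)) = entropy p V + ∑ ω, p ω * pmfEntropy (k (V ω)) := by
  unfold entropy
  rw [← sum_law_mul p V (fun b => pmfEntropy (k b)), Fintype.sum_prod_type, ← sub_eq_iff_eq_add',
    sub_neg_eq_add, neg_add_eq_sub, ← Finset.sum_sub_distrib]
  refine Finset.sum_congr rfl fun b _ => ?_
  simp_rw [h]
  rcases eq_or_ne (law p V b) 0 with h0 | h0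
  · simp [h0]
  · have : ∀ c, law p V b * k b c * Real.logb 2 (law p V b * k b c)
        = law p V b * Real.logb 2 (law p V b) * k b c
          + law p V b * (k b c * Real.logb 2 (k b c)) := by
      intro c
      rcases eq_or_ne (k b c) 0 with h1 | h1
      · simp [h1]
      · rw [Real.logb_mul h0 h1]; ring
    simp_rw [this]
    rw [Finset.sum_add_distrib, ← Finset.mul_sum, ← Finset.mul_sum, (hk b).2, pmfEntropy]
    ring

/-- A conditional law of the second component given the first. -/
theorem exists_kernel {q : A × B → ℝ} (hq : q ∈ stdSimplex ℝ (A × B)) :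
    ∃ k : A → B → ℝ, (∀ a, k a ∈ stdSimplex ℝ B) ∧
      ∀ a b, q (a, b) = law q (fun t => t.1) a * k a b := by
  classical
  obtain ⟨d, -⟩ := exists_le_of_expect_le hq (fun _ => 0) (t := 0) (by simp)
  have hl : ∀ a, law q (fun t => t.1) a = ∑ b, q (a, b) := by
    intro a
    have := sum_law_snd q (fun t => t.1) (fun t => t.2) a
    rw [← this]
    exact Finset.sum_congr rfl fun b _ => by rw [law_id]
  -- On a null value of the first component any law serves; a point mass is taken.
  refine ⟨fun a b => if law q (fun t => t.1) a = 0 then (Pi.single d.2 1 : B → ℝ) b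
    else q (a, b) / law q (fun t => t.1) a, fun a => ?_, fun a b => ?_⟩
  · by_cases h : law q (fun t => t.1) a = 0
    · simp only [h, if_true]
      exact single_mem_stdSimplex ℝ d.2
    · simp only [h, if_false]
      refine ⟨fun b => div_nonneg (hq.1 _) (law_nonneg hq.1 _ _), ?_⟩
      rw [← Finset.sum_div, ← hl, div_self h]
  · dsimp only
    split_ifs with h
    · rw [h, zero_mul]
      rw [hl] at h
      exact (Finset.sum_eq_zero_iff_of_nonneg fun b _ => hq.1 (a, b)).1 h b (Finset.mem_univ b)
    · field_simp

end Kernel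

section IID

variable {Ω A D : Type*} [Fintype Ω] [Fintype A] {n : ℕ}

/-- The law of `n` independent random variables with law `p`. -/
def iid (n : ℕ) (p : Ω → ℝ) : (Fin n → Ω) → ℝ := fun φ => ∏ i, p (φ i)

theorem iid_mem {p : Ω → ℝ} (hp : p ∈ stdSimplex ℝ Ω) : iid n p ∈ stdSimplex ℝ (Fin n → Ω) :=
  pi_mem_stdSimplex fun _ => hp

/-- `Φ` may arrange the components of the letters in any shape, such as a tuple of sequences, as
long as the event `Φ φ = x` fixes each letter under `g` separately. -/
theorem law_iid (p : Ω → ℝ) (Φ : (Fin n → Ω) → D) (x : D) (g : Ω → A) (a : Fin n → A)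
    (h : ∀ φ, Φ φ = x ↔ ∀ i, g (φ i) = a i) :
    law (iid n p) Φ x = ∏ i, law p g (a i) := by
  classical
  rw [law_eq_sum]
  simp_rw [law_eq_sum]
  rw [← sum_pi_prod (fun (i : Fin n) ω => if g ω = a i then p ω else 0)]
  refine Finset.sum_congr rfl fun φ _ => ?_
  rw [Fintype.prod_ite_zero]
  simp only [h, iid]
  split_ifs <;> rfl

/-- The asymptotic equipartition property, as a bound on the tail of a likelihood ratio. -/
theorem exists_aep {p : Ω → ℝ} (hp : p ∈ stdSimplex ℝ Ω) (a b : Ω → ℝ)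
    (ha : ∀ ω, 0 < p ω → 0 < a ω) (hb : ∀ ω, 0 < p ω → 0 < b ω) {δ m : ℝ} (hδ : 0 < δ)
    (hm : ∑ ω, p ω * (Real.logb 2 (a ω) - Real.logb 2 (b ω)) ≤ m) :
    ∃ C : ℝ, 0 ≤ C ∧ ∀ n : ℕ, prob (iid n p)
      {φ | ∏ i, b (φ i) < (2 : ℝ) ^ (-(n * (m + δ))) * ∏ i, a (φ i)} * n ≤ C := by
  classical
  set g : Ω → ℝ := fun ω => Real.logb 2 (a ω) - Real.logb 2 (b ω) with hg
  set m' := ∑ ω, p ω * g ω with hm'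
  have hV : 0 ≤ ∑ ω, p ω * (g ω - m') ^ 2 :=
    Finset.sum_nonneg fun a _ => mul_nonneg (hp.1 a) (sq_nonneg _)
  refine ⟨(∑ ω, p ω * (g ω - m') ^ 2) / δ ^ 2, by positivity, fun n => ?_⟩
  have h := chebyshev (ι := Fin n) hp g hδ
  rw [Fintype.card_fin, ← mul_assoc] at h
  rw [le_div_iff₀ (by positivity)]
  refine le_trans ?_ h
  refine mul_le_mul_of_nonneg_right (mul_le_mul_of_nonneg_right ?_ (Nat.cast_nonneg n))
    (sq_nonneg δ)
  change prob (iid n p) _ ≤ prob (iid n p) _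
  rw [prob_eq_sum, prob_eq_sum]
  refine Finset.sum_le_sum fun φ _ => ?_
  -- Sequences of probability zero are discarded first, so that all logarithms below have positive
  -- arguments.
  rcases ((iid_mem hp).1 φ).eq_or_lt with h0 | h0
  · simp [← h0]
  have hpos : ∀ i, 0 < p (φ i) := fun i => (hp.1 _).lt_of_ne' fun hi => by
    rw [iid, Finset.prod_eq_zero (Finset.mem_univ i) hi] at h0
    exact lt_irrefl _ h0
  simp only [Set.mem_ofPred_eq]
  by_cases hlt : ∏ i, b (φ i) < (2 : ℝ) ^ (-(n * (m + δ))) * ∏ i, a (φ i)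
  swap
  · rw [if_neg hlt]
    split_ifs
    exacts [h0.le, le_rfl]
  rw [if_pos hlt, if_pos]
  have hB : 0 < ∏ i, b (φ i) := Finset.prod_pos fun i _ => hb _ (hpos i)
  have hA : 0 < ∏ i, a (φ i) := Finset.prod_pos fun i _ => ha _ (hpos i)
  have h2 : (0 : ℝ) < (2 : ℝ) ^ (-(n * (m + δ))) := by positivity
  have hlog := Real.logb_lt_logb (b := 2) (by norm_num) hB hlt
  rw [Real.logb_mul h2.ne' hA.ne', Real.logb_rpow (by norm_num) (by norm_num),
    Real.logb_prod _ _ fun i _ => (hb _ (hpos i)).ne',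
    Real.logb_prod _ _ fun i _ => (ha _ (hpos i)).ne'] at hlog
  rw [← hm', hg]
  simp only
  rw [Finset.sum_sub_distrib]
  have : (n : ℝ) * (m' + δ) ≤ n * (m + δ) := by gcongr
  linarith

/-- The weak law of large numbers. -/
theorem exists_weak_law {p : Ω → ℝ} (hp : p ∈ stdSimplex ℝ Ω) (g : Ω → ℝ) {δ m : ℝ} (hδ : 0 < δ)
    (hm : ∑ ω, p ω * g ω ≤ m) :
    ∃ C : ℝ, 0 ≤ C ∧ ∀ n : ℕ, prob (iid n p) {φ | n * (m + δ) < ∑ i, g (φ i)} * n ≤ C := by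
  set m' := ∑ ω, p ω * g ω with hm'
  have hV : 0 ≤ ∑ ω, p ω * (g ω - m') ^ 2 :=
    Finset.sum_nonneg fun a _ => mul_nonneg (hp.1 a) (sq_nonneg _)
  refine ⟨(∑ ω, p ω * (g ω - m') ^ 2) / δ ^ 2, by positivity, fun n => ?_⟩
  have h := chebyshev (ι := Fin n) hp g hδ
  rw [Fintype.card_fin, ← mul_assoc] at h
  rw [le_div_iff₀ (by positivity)]
  refine le_trans ?_ h
  refine mul_le_mul_of_nonneg_right (mul_le_mul_of_nonneg_right ?_ (Nat.cast_nonneg n))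
    (sq_nonneg δ)
  refine prob_mono (iid_mem hp).1 fun φ hφ => ?_
  simp only [Set.mem_ofPred_eq] at hφ ⊢
  refine lt_of_le_of_lt ?_ hφ
  rw [← hm']
  gcongr

end IID

/-! ### Marginals of the channel law and degradedness -/

section ChannelInformation

variable {W X Y Z : Type*} [Fintype W] [Fintype X] [Fintype Y] [Fintype Z]
  {PW : W → ℝ} {PXW : W → X → ℝ} {PYX : X → Y → ℝ} {PZY : Y → Z → ℝ}

theorem law_chanLaw_WX (hPYX : ∀ x, PYX x ∈ stdSimplex ℝ Y) (hPZY : ∀ y, PZY y ∈ stdSimplex ℝ Z)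
    (w : W) (x : X) :
    law (chanLaw PW PXW PYX PZY) (fun ω => (ω.1, ω.2.1)) (w, x) = PW w * PXW w x := by
  classical
  simp only [law_eq_sum, Fintype.sum_prod_type, Prod.mk.injEq, ite_and, chanLaw,
    Finset.sum_ite_irrel, Finset.sum_const_zero, Finset.sum_ite_eq', Finset.mem_univ, if_true,
    ← Finset.mul_sum, (hPZY _).2, (hPYX _).2, mul_one]

theorem law_chanLaw_W (hPXW : ∀ w, PXW w ∈ stdSimplex ℝ X) (hPYX : ∀ x, PYX x ∈ stdSimplex ℝ Y)
    (hPZY : ∀ y, PZY y ∈ stdSimplex ℝ Z) (w : W) :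
    law (chanLaw PW PXW PYX PZY) (fun ω => ω.1) w = PW w := by
  rw [← sum_law_snd (chanLaw PW PXW PYX PZY) (fun ω => ω.1) (fun ω => ω.2.1) w]
  simp_rw [law_chanLaw_WX hPYX hPZY, ← Finset.mul_sum, (hPXW _).2, mul_one]

theorem law_chanLaw_WXY (hPZY : ∀ y, PZY y ∈ stdSimplex ℝ Z) (w : W) (x : X) (y : Y) :
    law (chanLaw PW PXW PYX PZY) (fun ω => (ω.1, ω.2.1, ω.2.2.1)) (w, x, y)
      = PW w * PXW w x * PYX x y := by
  classical
  simp only [law_eq_sum, Fintype.sum_prod_type, Prod.mk.injEq, ite_and, chanLaw,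
    Finset.sum_ite_irrel, Finset.sum_const_zero, Finset.sum_ite_eq', Finset.mem_univ, if_true,
    ← Finset.mul_sum, (hPZY _).2, mul_one]

theorem law_chanLaw_WY (hPZY : ∀ y, PZY y ∈ stdSimplex ℝ Z) (w : W) (y : Y) :
    law (chanLaw PW PXW PYX PZY) (fun ω => (ω.1, ω.2.2.1)) (w, y)
      = PW w * ∑ x, PXW w x * PYX x y := by
  rw [← sum_law_fst (chanLaw PW PXW PYX PZY) (fun ω => ω.2.1) (fun ω => (ω.1, ω.2.2.1)) (w, y), Finset.mul_sum]
  refine Finset.sum_congr rfl fun x _ => ?_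
  rw [← mul_assoc, ← law_chanLaw_WXY hPZY]
  unfold law
  congr 1
  ext ω
  simp only [Set.mem_ofPred_eq, Prod.mk.injEq]
  tauto

theorem law_chanLaw_WYZ (hPZY : ∀ y, PZY y ∈ stdSimplex ℝ Z) (w : W) (y : Y) (z : Z) :
    law (chanLaw PW PXW PYX PZY) (fun ω => ((ω.1, ω.2.2.1), ω.2.2.2)) ((w, y), z)
      = law (chanLaw PW PXW PYX PZY) (fun ω => (ω.1, ω.2.2.1)) (w, y) * PZY y z := by
  classical
  rw [law_chanLaw_WY hPZY]
  simp only [law_eq_sum, Fintype.sum_prod_type, Prod.mk.injEq, ite_and, chanLaw,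
    Finset.sum_ite_irrel, Finset.sum_const_zero, Finset.sum_ite_eq', Finset.mem_univ, if_true]
  rw [Finset.mul_sum, Finset.sum_mul]
  exact Finset.sum_congr rfl fun x _ => by ring

/-- The stronger receiver of a degraded broadcast channel gets more information. -/
theorem mutualInfo_degraded (hPW : PW ∈ stdSimplex ℝ W) (hPXW : ∀ w, PXW w ∈ stdSimplex ℝ X)
    (hPYX : ∀ x, PYX x ∈ stdSimplex ℝ Y) (hPZY : ∀ y, PZY y ∈ stdSimplex ℝ Z) :
    mutualInfo (chanLaw PW PXW PYX PZY) (fun ω => ω.1) (fun ω => ω.2.2.2)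
      ≤ mutualInfo (chanLaw PW PXW PYX PZY) (fun ω => ω.1) (fun ω => ω.2.2.1) := by
  set Q := chanLaw PW PXW PYX PZY
  have hQ : Q ∈ stdSimplex ℝ _ := chanLaw_mem hPW hPXW hPYX hPZY
  -- Given Y, the output Z does not depend on W: conditioning Z on (W,Y) and on Y produces the same
  -- average of row entropies, which cancels in the final inequality.
  have h1 := entropy_pair_of_kernel Q (fun ω => (ω.1, ω.2.2.1)) (fun ω => ω.2.2.2)
    (fun t => PZY t.2) (fun t => hPZY t.2) (fun t z => law_chanLaw_WYZ hPZY t.1 t.2 z)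
  have h2 := entropy_pair_of_kernel Q (fun ω => ω.2.2.1) (fun ω => ω.2.2.2)
    PZY hPZY (fun y z => by
      rw [← sum_law_fst Q (fun ω => ω.1) (fun ω => ω.2.2.1),
        ← sum_law_fst Q (fun ω => ω.1) (fun ω => (ω.2.2.1, ω.2.2.2)), Finset.sum_mul]
      refine Finset.sum_congr rfl fun w _ => ?_
      rw [← law_chanLaw_WYZ hPZY]
      unfold law
      congr 1
      ext ω
      simp only [Set.mem_ofPred_eq, Prod.mk.injEq]
      tauto)
  have h3 := entropy_submodular hQ (fun ω => ω.1) (fun ω => ω.2.2.1) (fun ω => ω.2.2.2)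
  have h4 := entropy_eq_of_comp hQ (U := fun ω => ((ω.1, ω.2.2.1), ω.2.2.2))
    (V := fun ω => (ω.1, ω.2.2.1, ω.2.2.2)) (fun t => (t.1.1, t.1.2, t.2))
    (fun t => ((t.1, t.2.1), t.2.2)) (fun _ => rfl) (fun _ => rfl)
  unfold mutualInfo
  linarith

end ChannelInformation

theorem tendsto_two_rpow_neg_mul {c : ℝ} (hc : 0 < c) :
    Tendsto (fun n : ℕ => (2 : ℝ) ^ (-(n * c))) atTop (𝓝 0) := by
  have h : Tendsto (fun n : ℕ => ((2 : ℝ) ^ (-c)) ^ n) atTop (𝓝 0) :=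
    tendsto_pow_atTop_nhds_zero_of_lt_one (by positivity)
      (Real.rpow_lt_one_of_one_lt_of_neg (by norm_num) (by linarith))
  refine h.congr fun n => ?_
  rw [← Real.rpow_natCast, ← Real.rpow_mul (by norm_num)]
  congr 1
  ring

/-- Memoryless extension of a channel. -/
def block {A B : Type*} (n : ℕ) (k : A → B → ℝ) : (Fin n → A) → (Fin n → B) → ℝ :=
  fun a b => ∏ i, k (a i) (b i)

theorem block_mem {A B : Type*} [Fintype B] {n : ℕ} {k : A → B → ℝ}
    (hk : ∀ a, k a ∈ stdSimplex ℝ B) (a : Fin n → A) : block n k a ∈ stdSimplex ℝ (Fin n → B) :=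
  pi_mem_stdSimplex fun i => hk (a i)

/-! ### Block coding theorem for the degraded channel -/

section Channel

variable {W X Y Z : Type*} [Fintype W] [Fintype X] [Fintype Y] [Fintype Z]
  {PW : W → ℝ} {PXW : W → X → ℝ} {PYX : X → Y → ℝ} {PZY : Y → Z → ℝ}

/-- The l-fold channel with i.i.d. codebook letters is an instance of the one-shot problem, and its
likelihood ratios are products to which the equipartition bound applies. -/
theorem chanLaw_block (l : ℕ) :
    chanLaw (iid l PW) (block l PXW) (block l PYX) (block l PZY)
      = law (iid l (chanLaw PW PXW PYX PZY)) (fun φ => (fun i => (φ i).1, fun i => (φ i).2.1,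
          fun i => (φ i).2.2.1, fun i => (φ i).2.2.2)) := by
  funext ω
  obtain ⟨w, x, y, z⟩ := ω
  rw [law_iid (chanLaw PW PXW PYX PZY) _ _ (fun t => t) (fun i => (w i, x i, y i, z i))]
  · simp only [law_id, chanLaw, iid, block, Finset.prod_mul_distrib]
  · intro φ
    simp only [Prod.ext_iff, funext_iff, forall_and]

/-- The mean of the log-likelihood ratio of product law to joint law, in the form that `exists_aep`
expects. -/
theorem sum_mul_logb_sub {Ω A B : Type*} [Fintype Ω] [Fintype A] [Fintype B] {p : Ω → ℝ}
    (hp : p ∈ stdSimplex ℝ Ω) (U : Ω → A) (V : Ω → B) :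
    ∑ ω, p ω * (Real.logb 2 (law p U (U ω) * law p V (V ω))
      - Real.logb 2 (law p (fun ω => (U ω, V ω)) (U ω, V ω))) = -mutualInfo p U V := by
  unfold mutualInfo
  rw [entropy_eq_sum, entropy_eq_sum, entropy_eq_sum, ← neg_add, sub_neg_eq_add, neg_add, neg_neg,
    ← Finset.sum_add_distrib, ← sub_eq_add_neg, ← Finset.sum_sub_distrib]
  refine Finset.sum_congr rfl fun ω _ => ?_
  rcases (hp.1 ω).eq_or_lt with h0 | h0
  · simp [← h0]
  · rw [Real.logb_mul (law_pos hp.1 U h0).ne' (law_pos hp.1 V h0).ne']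
    ring

/-- The conditional analogue, for the ratio P(x|w) P(w,y) / P(w,x,y) that tests satellites of a
common cloud. -/
theorem sum_mul_logb_sub_cond (hPW : PW ∈ stdSimplex ℝ W) (hPXW : ∀ w, PXW w ∈ stdSimplex ℝ X)
    (hPYX : ∀ x, PYX x ∈ stdSimplex ℝ Y) (hPZY : ∀ y, PZY y ∈ stdSimplex ℝ Z) :
    ∑ ω, chanLaw PW PXW PYX PZY ω * (Real.logb 2 (PXW ω.1 ω.2.1
        * law (chanLaw PW PXW PYX PZY) (fun ω => (ω.1, ω.2.2.1)) (ω.1, ω.2.2.1))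
      - Real.logb 2 (law (chanLaw PW PXW PYX PZY) (fun ω => (ω.1, ω.2.1, ω.2.2.1))
          (ω.1, ω.2.1, ω.2.2.1)))
      = -condMutualInfo (chanLaw PW PXW PYX PZY) (fun ω => ω.2.1) (fun ω => ω.2.2.1)
          (fun ω => ω.1) := by
  set Q := chanLaw PW PXW PYX PZY with hQd
  have hQ : Q ∈ stdSimplex ℝ _ := chanLaw_mem hPW hPXW hPYX hPZY
  have e1 := entropy_eq_of_comp hQ (U := fun ω => (ω.1, ω.2.1)) (V := fun ω => (ω.2.1, ω.1))
    Prod.swap Prod.swap (fun _ => rfl) (fun _ => rfl)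
  have e2 := entropy_eq_of_comp hQ (U := fun ω => (ω.1, ω.2.2.1)) (V := fun ω => (ω.2.2.1, ω.1))
    Prod.swap Prod.swap (fun _ => rfl) (fun _ => rfl)
  have e3 := entropy_eq_of_comp hQ (U := fun ω => (ω.1, ω.2.1, ω.2.2.1))
    (V := fun ω => (ω.2.1, ω.2.2.1, ω.1)) (fun t => (t.2.1, t.2.2, t.1))
    (fun t => (t.2.2, t.1, t.2.1)) (fun _ => rfl) (fun _ => rfl)
  unfold condMutualInfo
  rw [e1, e2, e3, entropy_eq_sum, entropy_eq_sum, entropy_eq_sum, entropy_eq_sum]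
  have : ∀ a b c d : ℝ, -(-a + -b - -c - -d) = a + b - c - d := fun a b c d => by ring
  rw [this, ← Finset.sum_add_distrib, ← Finset.sum_sub_distrib, ← Finset.sum_sub_distrib]
  refine Finset.sum_congr rfl fun ω _ => ?_
  rcases (hQ.1 ω).eq_or_lt with h0 | h0
  · simp [← h0]
  · have h1 := law_pos hQ.1 (fun ω => (ω.1, ω.2.1)) h0
    have h2 := law_pos hQ.1 (fun ω => (ω.1, ω.2.2.1)) h0
    have h3 := law_pos hQ.1 (fun ω => ω.1) h0
    have hx : PXW ω.1 ω.2.1 ≠ 0 := by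
      intro h
      rw [hQd, law_chanLaw_WX hPYX hPZY, h, mul_zero] at h1
      exact lt_irrefl _ h1
    have hw : PW ω.1 ≠ 0 := by
      rw [hQd, law_chanLaw_W hPXW hPYX hPZY] at h3
      exact h3.ne'
    have e4 : law Q (fun ω => (ω.1, ω.2.1)) (ω.1, ω.2.1) = PW ω.1 * PXW ω.1 ω.2.1 :=
      law_chanLaw_WX hPYX hPZY _ _
    have e5 : law Q (fun ω => ω.1) ω.1 = PW ω.1 := law_chanLaw_W hPXW hPYX hPZY _
    rw [e4, e5, Real.logb_mul hx h2.ne', Real.logb_mul hw hx]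
    ring

theorem eventually_le_of_mul_le {C η : ℝ} (hη : 0 < η) (f : ℕ → ℝ) (h : ∀ l : ℕ, f l * l ≤ C) :
    ∀ᶠ l in atTop, f l ≤ η := by
  filter_upwards [eventually_ge_atTop (⌈C / η⌉₊ + 1)] with l hl
  have h1 : C / η ≤ l := (Nat.le_ceil _).trans (by exact_mod_cast (Nat.le_succ _).trans hl)
  have h2 : (0 : ℝ) < l := by exact_mod_cast (Nat.succ_pos _).trans_le hl
  rw [div_le_iff₀ hη] at h1
  refine le_of_mul_le_mul_right ((h l).trans ?_) h2
  linarith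

/-- The number of wrong messages times the chance that one of them passes. At rate 0 there is no
wrong message, so nothing is required of c; this covers channels without positive information. -/
theorem eventually_floor_sub_one_mul_le {r c ρ : ℝ} (hρ : 0 ≤ ρ) (hr : r = 0 ∨ 0 ≤ r ∧ r < ρ * c)
    {η : ℝ} (hη : 0 < η) :
    ∀ᶠ n : ℕ in atTop, ((⌊(2 : ℝ) ^ (n * r)⌋₊ : ℝ) - 1) * (2 : ℝ) ^ (-(⌈ρ * n⌉₊ * c)) ≤ η := by
  rcases hr with hr | ⟨hr0, hr⟩
  · refine Eventually.of_forall fun n => ?_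
    simp [hr, hη.le]
  · have hc : 0 < c := by
      by_contra hc
      nlinarith
    have h := tendsto_two_rpow_neg_mul (c := ρ * c - r) (by linarith)
    filter_upwards [h.eventually_le_const hη] with n hn
    have h1 : (⌊(2 : ℝ) ^ (n * r)⌋₊ : ℝ) - 1 ≤ (2 : ℝ) ^ (n * r) := by
      have := Nat.floor_le (a := (2 : ℝ) ^ (n * r)) (by positivity)
      linarith
    have h2 : (2 : ℝ) ^ (-(⌈ρ * n⌉₊ * c)) ≤ (2 : ℝ) ^ (-(ρ * n * c)) := by
      refine Real.rpow_le_rpow_of_exponent_le (by norm_num) ?_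
      have := Nat.le_ceil (ρ * n)
      nlinarith
    calc _ ≤ (2 : ℝ) ^ (n * r) * (2 : ℝ) ^ (-(ρ * n * c)) := by gcongr
      _ = (2 : ℝ) ^ (-(n * (ρ * c - r))) := by
        rw [← Real.rpow_add (by norm_num)]
        congr 1
        ring
      _ ≤ η := hn

/-- Superposition coding over a memoryless degraded broadcast channel, for arbitrary message
distributions. -/
theorem eventually_exists_channel_code [Nonempty X] (hPW : PW ∈ stdSimplex ℝ W)
    (hPXW : ∀ w, PXW w ∈ stdSimplex ℝ X)
    (hPYX : ∀ x, PYX x ∈ stdSimplex ℝ Y) (hPZY : ∀ y, PZY y ∈ stdSimplex ℝ Z)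
    {ρ r₁ r₂ : ℝ} (hρ : 0 ≤ ρ)
    (hr₁ : r₁ = 0 ∨ 0 ≤ r₁ ∧ r₁ < ρ * mutualInfo (chanLaw PW PXW PYX PZY)
      (fun ω => ω.1) (fun ω => ω.2.2.2))
    (hr₂ : r₂ = 0 ∨ 0 ≤ r₂ ∧ r₂ < ρ * condMutualInfo (chanLaw PW PXW PYX PZY)
      (fun ω => ω.2.1) (fun ω => ω.2.2.1) (fun ω => ω.1))
    {η : ℝ} (hη : 0 < η) :
    ∀ᶠ n : ℕ in atTop,
      ∀ μ ∈ stdSimplex ℝ (Fin ⌊(2 : ℝ) ^ (n * r₁)⌋₊ × Fin ⌊(2 : ℝ) ^ (n * r₂)⌋₊),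
      ∃ (f : Fin ⌊(2 : ℝ) ^ (n * r₁)⌋₊ × Fin ⌊(2 : ℝ) ^ (n * r₂)⌋₊ → Fin ⌈ρ * n⌉₊ → X)
        (g₁ : (Fin ⌈ρ * n⌉₊ → Z) → Fin ⌊(2 : ℝ) ^ (n * r₁)⌋₊)
        (g₂ : (Fin ⌈ρ * n⌉₊ → Y) → Fin ⌊(2 : ℝ) ^ (n * r₁)⌋₊ × Fin ⌊(2 : ℝ) ^ (n * r₂)⌋₊),
        ∑ m, μ m * prob (fun t : (Fin ⌈ρ * n⌉₊ → Y) × (Fin ⌈ρ * n⌉₊ → Z) =>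
            block ⌈ρ * n⌉₊ PYX (f m) t.1 * block ⌈ρ * n⌉₊ PZY t.1 t.2)
          {t | g₁ t.2 ≠ m.1 ∨ g₂ t.1 ≠ m} ≤ η := by
  -- For ρ = 0 the block length of the channel does not grow and the law of large numbers is
  -- useless, but both message sets are singletons.
  rcases hρ.eq_or_lt with hρ0 | hρ0
  · have e₁ : r₁ = 0 := by
      rcases hr₁ with h | ⟨h, h'⟩
      · exact h
      · rw [← hρ0] at h'; linarith
    have e₂ : r₂ = 0 := by
      rcases hr₂ with h | ⟨h, h'⟩
      · exact h
      · rw [← hρ0] at h'; linarith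
    subst e₁ e₂
    refine Eventually.of_forall fun n μ hμ => ?_
    have hsub : Subsingleton (Fin ⌊(2 : ℝ) ^ ((n : ℝ) * 0)⌋₊) := by
      rw [mul_zero, Real.rpow_zero, Nat.floor_one]
      infer_instance
    obtain ⟨d, -⟩ := exists_le_of_expect_le hμ (fun _ => 0) (t := 0) (by simp)
    refine ⟨fun _ _ => Classical.arbitrary X, fun _ => d.1, fun _ => d, ?_⟩
    have : ∀ m : Fin ⌊(2 : ℝ) ^ ((n : ℝ) * 0)⌋₊ × Fin ⌊(2 : ℝ) ^ ((n : ℝ) * 0)⌋₊,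
        ¬(d.1 ≠ m.1 ∨ d ≠ m) := fun m => by
      simp [Subsingleton.elim d m]
    simp [this, hη.le, prob]
  set J := chanLaw PW PXW PYX PZY with hJd
  have hJ : J ∈ stdSimplex ℝ _ := chanLaw_mem hPW hPXW hPYX hPZY
  set I₁ := mutualInfo J (fun ω => ω.1) (fun ω => ω.2.2.2) with hI₁
  set I₂ := condMutualInfo J (fun ω => ω.2.1) (fun ω => ω.2.2.1) (fun ω => ω.1) with hI₂
  have hlW : ∀ w, law J (fun ω => ω.1) w = PW w := law_chanLaw_W hPXW hPYX hPZY
  have hWpos : ∀ ω, 0 < J ω → 0 < PW ω.1 := fun ω h => by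
    rw [← hlW]; exact law_pos hJ.1 (fun ω => ω.1) h
  have hXpos : ∀ ω, 0 < J ω → 0 < PXW ω.1 ω.2.1 := fun ω h => by
    refine ((hPXW _).1 _).lt_of_ne' fun h' => ?_
    rw [hJd, chanLaw, h'] at h
    simp at h
  -- ρ (I₁ - δ₁) is the midpoint of r₁ and ρ I₁; at rate 0 any δ₁ will do. The same choice is made
  -- for δ₂.
  obtain ⟨δ₁, hδ₁, hr₁'⟩ : ∃ δ > 0, r₁ = 0 ∨ 0 ≤ r₁ ∧ r₁ < ρ * (I₁ - δ) := by
    rcases hr₁ with h | ⟨h, h'⟩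
    · exact ⟨1, one_pos, Or.inl h⟩
    · refine ⟨(ρ * I₁ - r₁) / (2 * ρ), div_pos (by linarith) (by linarith), Or.inr ⟨h, ?_⟩⟩
      field_simp
      linarith
  obtain ⟨δ₂, hδ₂, hr₂'⟩ : ∃ δ > 0, r₂ = 0 ∨ 0 ≤ r₂ ∧ r₂ < ρ * (I₂ - δ) := by
    rcases hr₂ with h | ⟨h, h'⟩
    · exact ⟨1, one_pos, Or.inl h⟩
    · refine ⟨(ρ * I₂ - r₂) / (2 * ρ), div_pos (by linarith) (by linarith), Or.inr ⟨h, ?_⟩⟩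
      field_simp
      linarith
  obtain ⟨C₁, -, hC₁⟩ := exists_aep hJ (fun ω => PW ω.1 * law J (fun ω => ω.2.2.2) ω.2.2.2)
    (fun ω => law J (fun ω => (ω.1, ω.2.2.2)) (ω.1, ω.2.2.2)) (m := -I₁) (δ := δ₁)
    (fun ω h => mul_pos (hWpos ω h) (law_pos hJ.1 (fun ω => ω.2.2.2) h))
    (fun ω h => law_pos hJ.1 (fun ω => (ω.1, ω.2.2.2)) h) hδ₁
    (by
      have := sum_mul_logb_sub hJ (fun ω => ω.1) (fun ω => ω.2.2.2)
      simp only [hlW] at this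
      exact this.le)
  -- The strong receiver tests clouds at the threshold I(W;Z) of the weak one, which is allowed
  -- because I(W;Z) ≤ I(W;Y).
  obtain ⟨C₂, -, hC₂⟩ := exists_aep hJ (fun ω => PW ω.1 * law J (fun ω => ω.2.2.1) ω.2.2.1)
    (fun ω => law J (fun ω => (ω.1, ω.2.2.1)) (ω.1, ω.2.2.1)) (m := -I₁) (δ := δ₁)
    (fun ω h => mul_pos (hWpos ω h) (law_pos hJ.1 (fun ω => ω.2.2.1) h))
    (fun ω h => law_pos hJ.1 (fun ω => (ω.1, ω.2.2.1)) h) hδ₁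
    (by
      have := sum_mul_logb_sub hJ (fun ω => ω.1) (fun ω => ω.2.2.1)
      simp only [hlW] at this
      have h' := mutualInfo_degraded hPW hPXW hPYX hPZY
      rw [this, neg_le_neg_iff]
      exact h')
  obtain ⟨C₃, -, hC₃⟩ := exists_aep hJ
    (fun ω => PXW ω.1 ω.2.1 * law J (fun ω => (ω.1, ω.2.2.1)) (ω.1, ω.2.2.1))
    (fun ω => law J (fun ω => (ω.1, ω.2.1, ω.2.2.1)) (ω.1, ω.2.1, ω.2.2.1)) (m := -I₂) (δ := δ₂)
    (fun ω h => mul_pos (hXpos ω h) (law_pos hJ.1 (fun ω => (ω.1, ω.2.2.1)) h))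
    (fun ω h => law_pos hJ.1 (fun ω => (ω.1, ω.2.1, ω.2.2.1)) h) hδ₂
    (sum_mul_logb_sub_cond hPW hPXW hPYX hPZY).le
  have hl : Tendsto (fun n : ℕ => ⌈ρ * n⌉₊) atTop atTop :=
    tendsto_nat_ceil_atTop.comp (tendsto_natCast_atTop_atTop.const_mul_atTop hρ0)
  -- Three tests failed by the true codeword, twice the wrong clouds and once the wrong satellites:
  -- six shares of η/7 at most.
  have hη7 : 0 < η / 7 := by positivity
  filter_upwards [hl.eventually (eventually_le_of_mul_le hη7 _ hC₁),
    hl.eventually (eventually_le_of_mul_le hη7 _ hC₂),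
    hl.eventually (eventually_le_of_mul_le hη7 _ hC₃),
    eventually_floor_sub_one_mul_le hρ hr₁' hη7, eventually_floor_sub_one_mul_le hρ hr₂' hη7]
    with n b₁ b₂ b₃ b₄ b₅ μ hμ
  set l := ⌈ρ * n⌉₊
  set K₁ := Fin ⌊(2 : ℝ) ^ (n * r₁)⌋₊
  set K₂ := Fin ⌊(2 : ℝ) ^ (n * r₂)⌋₊
  set JL := chanLaw (iid l PW) (block l PXW) (block l PYX) (block l PZY) with hJL
  have hZ : ∀ z, law JL (fun ω => ω.2.2.2) z = ∏ i, law J (fun ω => ω.2.2.2) (z i) := fun z => by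
    rw [hJL, chanLaw_block, law_law]
    exact law_iid _ _ _ _ _ fun φ => by simp [funext_iff]
  have hY : ∀ y, law JL (fun ω => ω.2.2.1) y = ∏ i, law J (fun ω => ω.2.2.1) (y i) := fun z => by
    rw [hJL, chanLaw_block, law_law]
    exact law_iid _ _ _ _ _ fun φ => by simp [funext_iff]
  have hWZ : ∀ w z, law JL (fun ω => (ω.1, ω.2.2.2)) (w, z)
      = ∏ i, law J (fun ω => (ω.1, ω.2.2.2)) (w i, z i) := fun w z => by
    rw [hJL, chanLaw_block, law_law]
    exact law_iid _ _ _ _ (fun i => (w i, z i)) fun φ => by simp [funext_iff, forall_and]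
  have hWY : ∀ w y, law JL (fun ω => (ω.1, ω.2.2.1)) (w, y)
      = ∏ i, law J (fun ω => (ω.1, ω.2.2.1)) (w i, y i) := fun w z => by
    rw [hJL, chanLaw_block, law_law]
    exact law_iid _ _ _ _ (fun i => (w i, z i)) fun φ => by simp [funext_iff, forall_and]
  have hWXY : ∀ w x y, law JL (fun ω => (ω.1, ω.2.1, ω.2.2.1)) (w, x, y)
      = ∏ i, law J (fun ω => (ω.1, ω.2.1, ω.2.2.1)) (w i, x i, y i) := fun w x z => by
    rw [hJL, chanLaw_block, law_law]
    exact law_iid _ _ _ _ (fun i => (w i, x i, z i)) fun φ => by simp [funext_iff, forall_and]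
  have hsplit : ∀ t d : ℝ, -((l : ℝ) * (-t + d)) = l * (t - d) := fun t d => by ring
  obtain ⟨f, g₁, g₂, hfg⟩ := exists_superposition_code (K₁ := K₁) (K₂ := K₂) (iid_mem hPW)
    (block_mem hPXW) (block_mem hPYX) (block_mem hPZY)
    {t | iid l PW t.1 * law JL (fun ω => ω.2.2.2) t.2
      ≤ (2 : ℝ) ^ (-(l * (I₁ - δ₁))) * law JL (fun ω => (ω.1, ω.2.2.2)) t}
    {t | iid l PW t.1 * law JL (fun ω => ω.2.2.1) t.2
      ≤ (2 : ℝ) ^ (-(l * (I₁ - δ₁))) * law JL (fun ω => (ω.1, ω.2.2.1)) t}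
    {t | block l PXW t.1 t.2.1 * law JL (fun ω => (ω.1, ω.2.2.1)) (t.1, t.2.2)
      ≤ (2 : ℝ) ^ (-(l * (I₂ - δ₂))) * law JL (fun ω => (ω.1, ω.2.1, ω.2.2.1)) t}
    (by positivity) (by positivity) (fun w z h => h) (fun w y h => h) (fun w x y h => h) hμ
  refine ⟨f, g₁, g₂, ?_⟩
  have hflip : ∀ (t d A B : ℝ), ¬(A ≤ (2 : ℝ) ^ (-(l * (t - d))) * B) →
      B < (2 : ℝ) ^ (-((l : ℝ) * (-t + d))) * A := by
    intro t d A B h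
    have hpos : (0 : ℝ) < (2 : ℝ) ^ ((l : ℝ) * (t - d)) := by positivity
    rw [not_le, Real.rpow_neg (by norm_num), inv_mul_lt_iff₀ hpos] at h
    rwa [hsplit]
  have hp : ∀ ω, 0 ≤ iid l J ω := (iid_mem hJ).1
  have p₁ : prob JL {ω | (ω.1, ω.2.2.2) ∉ {t : (Fin l → W) × (Fin l → Z) |
      iid l PW t.1 * law JL (fun ω => ω.2.2.2) t.2
      ≤ (2 : ℝ) ^ (-(l * (I₁ - δ₁))) * law JL (fun ω => (ω.1, ω.2.2.2)) t}} ≤ η / 7 := by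
    refine le_trans ?_ b₁
    rw [hJL, chanLaw_block, prob_law, ← chanLaw_block, ← hJL]
    refine prob_mono hp fun φ hφ => ?_
    simp only [Set.mem_ofPred_eq, hZ, hWZ] at hφ ⊢
    rw [Finset.prod_mul_distrib]
    exact hflip _ _ _ _ hφ
  have p₂ : prob JL {ω | (ω.1, ω.2.2.1) ∉ {t : (Fin l → W) × (Fin l → Y) |
      iid l PW t.1 * law JL (fun ω => ω.2.2.1) t.2
      ≤ (2 : ℝ) ^ (-(l * (I₁ - δ₁))) * law JL (fun ω => (ω.1, ω.2.2.1)) t}} ≤ η / 7 := by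
    refine le_trans ?_ b₂
    rw [hJL, chanLaw_block, prob_law, ← chanLaw_block, ← hJL]
    refine prob_mono hp fun φ hφ => ?_
    simp only [Set.mem_ofPred_eq, hY, hWY] at hφ ⊢
    rw [Finset.prod_mul_distrib]
    exact hflip _ _ _ _ hφ
  have p₃ : prob JL {ω | (ω.1, ω.2.1, ω.2.2.1) ∉ {t : (Fin l → W) × (Fin l → X) × (Fin l → Y) |
      block l PXW t.1 t.2.1 * law JL (fun ω => (ω.1, ω.2.2.1)) (t.1, t.2.2)
      ≤ (2 : ℝ) ^ (-(l * (I₂ - δ₂))) * law JL (fun ω => (ω.1, ω.2.1, ω.2.2.1)) t}} ≤ η / 7 := by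
    refine le_trans ?_ b₃
    rw [hJL, chanLaw_block, prob_law, ← chanLaw_block, ← hJL]
    refine prob_mono hp fun φ hφ => ?_
    simp only [Set.mem_ofPred_eq, hWY, hWXY] at hφ ⊢
    rw [Finset.prod_mul_distrib]
    exact hflip _ _ _ _ hφ
  rw [Fintype.card_fin, Fintype.card_fin] at hfg
  rw [← hJL] at hfg
  have b₄' : ∀ a t : ℝ, (a - 1) * t ≤ η / 7 → (a - 1) * (2 * t) ≤ 2 * (η / 7) :=
    fun a t h => by linarith
  calc _ ≤ _ := hfg
    _ ≤ η / 7 + η / 7 + η / 7 + 2 * (η / 7) + η / 7 :=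
      add_le_add (add_le_add (add_le_add (add_le_add p₁ p₂) p₃) (b₄' _ _ b₄)) b₅
    _ ≤ η := by linarith

end Channel

/-! ### Source coding with a superposition codebook -/

section Source

variable {Ω A B : Type*} [Fintype Ω] [Fintype A] [Fintype B]

theorem mutualInfo_comm {p : Ω → ℝ} (hp : p ∈ stdSimplex ℝ Ω) (U : Ω → A) (V : Ω → B) :
    mutualInfo p U V = mutualInfo p V U := by
  unfold mutualInfo
  rw [entropy_eq_of_comp hp (U := fun ω => (U ω, V ω)) (V := fun ω => (V ω, U ω))
    Prod.swap Prod.swap (fun _ => rfl) (fun _ => rfl)]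
  ring

theorem tendsto_exp_neg_mul_two_rpow {κ δ : ℝ} (hκ : 0 < κ) (hδ : 0 < δ) :
    Tendsto (fun n : ℕ => Real.exp (-(κ * (2 : ℝ) ^ (n * δ)))) atTop (𝓝 0) := by
  refine Real.tendsto_exp_neg_atTop_nhds_zero.comp (Tendsto.const_mul_atTop hκ ?_)
  have h : Tendsto (fun n : ℕ => ((2 : ℝ) ^ δ) ^ n) atTop atTop :=
    tendsto_pow_atTop_atTop_of_one_lt (Real.one_lt_rpow (by norm_num) hδ)
  refine h.congr fun n => ?_
  rw [← Real.rpow_natCast, ← Real.rpow_mul (by norm_num)]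
  congr 1
  ring

/-- Source coding with a superposition codebook: almost every source word is covered by a pair of
reconstructions, if the codebook has more than `2 ^ (n I(U;S))` clouds and more than
`2 ^ (n I(U,V;S))` satellites. -/
theorem eventually_exists_source_code {S U V : Type*} [Fintype S] [Fintype U] [Fintype V]
    {P : S × U × V → ℝ} (hP : P ∈ stdSimplex ℝ (S × U × V)) (d₁ : S → U → ℝ) (d₂ : S → V → ℝ)
    {c₁ c₂ : ℝ} (hc₁ : mutualInfo P (fun ω => ω.2.1) (fun ω => ω.1) < c₁)
    (hc₂ : mutualInfo P (fun ω => (ω.2.1, ω.2.2)) (fun ω => ω.1) < c₂)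
    {κ δ η : ℝ} (hκ : 0 < κ) (hδ : 0 < δ) (hη : 0 < η) :
    ∀ᶠ n : ℕ in atTop, ∀ (I J : Type) [Fintype I] [Fintype J],
      κ * (2 : ℝ) ^ (n * c₁) ≤ Fintype.card I →
      κ * (2 : ℝ) ^ (n * c₂) ≤ Fintype.card I * Fintype.card J →
      ∃ (cu : I → Fin n → U) (cv : I → J → Fin n → V),
        prob (iid n (law P fun ω => ω.1)) {s | ∀ i j,
          ¬(∑ t, d₁ (s t) (cu i t) ≤ n * (expect P (fun ω => d₁ ω.1 ω.2.1) + δ) ∧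
            ∑ t, d₂ (s t) (cv i j t) ≤ n * (expect P (fun ω => d₂ ω.1 ω.2.2) + δ))} ≤ η := by
  set I₁ := mutualInfo P (fun ω => ω.2.1) (fun ω => ω.1) with hI₁
  set I₂ := mutualInfo P (fun ω => (ω.2.1, ω.2.2)) (fun ω => ω.1) with hI₂
  -- One γ pays for atypicality, and the other leaves 2^(nγ) surplus codewords, so the probability
  -- of no match decays doubly exponentially. The constant κ absorbs rounding of the codebook sizes.
  obtain ⟨γ, hγ, hγ₁, hγ₂⟩ : ∃ γ > 0, I₁ + 2 * γ ≤ c₁ ∧ I₂ + 2 * γ ≤ c₂ := by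
    refine ⟨min (c₁ - I₁) (c₂ - I₂) / 2, half_pos (lt_min (by linarith) (by linarith)), ?_, ?_⟩
    · linarith [min_le_left (c₁ - I₁) (c₂ - I₂)]
    · linarith [min_le_right (c₁ - I₁) (c₂ - I₂)]
  set PS := law P (fun ω => ω.1) with hPS
  set PU := law P (fun ω => ω.2.1) with hPU
  have hPSm : PS ∈ stdSimplex ℝ S := law_mem_stdSimplex hP _
  have hPUm : PU ∈ stdSimplex ℝ U := law_mem_stdSimplex hP _
  -- Satellites are drawn from the conditional law of V given U, so that Q₁ Q₂ is exactly the law of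
  -- (U,V).
  obtain ⟨K, hK, hPK⟩ := exists_kernel (law_mem_stdSimplex hP (fun ω => ω.2))
  rw [law_law] at hPK
  have hposS : ∀ ω, 0 < P ω → 0 < PS ω.1 := fun ω h => law_pos hP.1 (fun ω => ω.1) h
  obtain ⟨C₁, -, hC₁⟩ := exists_aep hP (fun ω => law P (fun ω => (ω.1, ω.2.1)) (ω.1, ω.2.1))
    (fun ω => PS ω.1 * PU ω.2.1) (m := I₁) (δ := γ)
    (fun ω h => law_pos hP.1 (fun ω => (ω.1, ω.2.1)) h)
    (fun ω h => mul_pos (hposS ω h) (law_pos hP.1 (fun ω => ω.2.1) h)) hγ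
    (by
      have h := sum_mul_logb_sub hP (fun ω => ω.1) (fun ω => ω.2.1)
      rw [← mutualInfo_comm hP, ← hI₁, eq_neg_iff_add_eq_zero, add_comm,
        ← eq_neg_iff_add_eq_zero, ← Finset.sum_neg_distrib] at h
      refine le_of_eq ?_
      rw [h]
      exact Finset.sum_congr rfl fun ω _ => by ring)
  obtain ⟨C₂, -, hC₂⟩ := exists_aep hP P
    (fun ω => PS ω.1 * (PU ω.2.1 * K ω.2.1 ω.2.2)) (m := I₂) (δ := γ)
    (fun ω h => h)
    (fun ω h => by
      rw [← hPK]
      exact mul_pos (hposS ω h) (law_pos hP.1 (fun ω => ω.2) h)) hγ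
    (by
      have h := sum_mul_logb_sub hP (fun ω => ω.1) (fun ω => ω.2)
      have e : mutualInfo P (fun ω => ω.1) (fun ω => ω.2) = I₂ := mutualInfo_comm hP _ _
      rw [e, eq_neg_iff_add_eq_zero, add_comm,
        ← eq_neg_iff_add_eq_zero, ← Finset.sum_neg_distrib] at h
      refine le_of_eq ?_
      rw [h]
      refine Finset.sum_congr rfl fun ω _ => ?_
      rw [← hPK]
      have : law P (fun ω => (ω.1, ω.2)) (ω.1, ω.2) = P ω := congrFun (law_id P) ω
      rw [this]
      ring)
  obtain ⟨C₃, -, hC₃⟩ := exists_weak_law hP (fun ω => d₁ ω.1 ω.2.1) hδ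
    (le_refl (expect P (fun ω => d₁ ω.1 ω.2.1)))
  obtain ⟨C₄, -, hC₄⟩ := exists_weak_law hP (fun ω => d₂ ω.1 ω.2.2) hδ
    (le_refl (expect P (fun ω => d₂ ω.1 ω.2.2)))
  have hη5 : 0 < η / 5 := by positivity
  filter_upwards [eventually_le_of_mul_le hη5 _ hC₁, eventually_le_of_mul_le hη5 _ hC₂,
    eventually_le_of_mul_le hη5 _ hC₃, eventually_le_of_mul_le hη5 _ hC₄,
    (tendsto_exp_neg_mul_two_rpow (half_pos hκ) hγ).eventually_le_const hη5]
    with n b₁ b₂ b₃ b₄ b₅ I J _ _ hI hIJ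
  set D₁ := expect P (fun ω => d₁ ω.1 ω.2.1) + δ
  set D₂ := expect P (fun ω => d₂ ω.1 ω.2.2) + δ
  set z : (Fin n → S × U × V) → (Fin n → S) × (Fin n → U) × (Fin n → V) :=
    fun φ => (fun i => (φ i).1, fun i => (φ i).2.1, fun i => (φ i).2.2) with hz
  set PB := law (iid n P) z with hPB
  have hPBm : PB ∈ stdSimplex ℝ _ := law_mem_stdSimplex (iid_mem hP) _
  have hBS : ∀ s, law PB (fun ω => ω.1) s = iid n PS s := fun s => by
    rw [hPB, law_law]
    exact law_iid _ _ _ _ _ fun φ => by simp [hz, funext_iff]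
  have hBSU : ∀ s u, law PB (fun ω => (ω.1, ω.2.1)) (s, u)
      = ∏ i, law P (fun ω => (ω.1, ω.2.1)) (s i, u i) := fun s u => by
    rw [hPB, law_law]
    exact law_iid _ _ _ _ (fun i => (s i, u i)) fun φ => by simp [hz, funext_iff, forall_and]
  have hB : ∀ s u v, PB (s, u, v) = ∏ i, P (s i, u i, v i) := fun s u v => by
    rw [hPB, law_iid _ _ _ (fun ω => ω) (fun i => (s i, u i, v i)) (fun φ => by
      simp [hz, funext_iff, forall_and, Prod.ext_iff]), law_id]
  set α := (2 : ℝ) ^ (-(n * (I₁ + γ)))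
  set β := (2 : ℝ) ^ (-(n * (I₂ + γ)))
  -- The typical set consists of the two likelihood bounds demanded by the covering lemma and of the
  -- two distortion constraints.
  obtain ⟨cu, cv, hcov⟩ := exists_covering (I := I) (J := J) hPBm
    {ω | law PB (fun ω => (ω.1, ω.2.1)) (ω.1, ω.2.1) * α
        ≤ law PB (fun ω => ω.1) ω.1 * iid n PU ω.2.1 ∧
      PB ω * β ≤ law PB (fun ω => ω.1) ω.1 * (iid n PU ω.2.1 * block n K ω.2.1 ω.2.2) ∧
      ∑ t, d₁ (ω.1 t) (ω.2.1 t) ≤ n * D₁ ∧ ∑ t, d₂ (ω.1 t) (ω.2.2 t) ≤ n * D₂}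
    (iid_mem hPUm) (block_mem hK) (α := α) (β := β) (by positivity) (by positivity)
    (fun s u v h => h.1) (fun s u v h => h.2.1)
  refine ⟨cu, cv, ?_⟩
  have hlawS : law PB (fun ω => ω.1) = iid n PS := funext hBS
  rw [hlawS] at hcov
  have hp : ∀ φ, 0 ≤ iid n P φ := (iid_mem hP).1
  have hexp : Real.exp (-(1 / 2 * min (Fintype.card I * α) (Fintype.card I * Fintype.card J * β)))
      ≤ η / 5 := by
    refine le_trans (Real.exp_le_exp.2 (neg_le_neg ?_)) b₅
    have e : ∀ c I' : ℝ, I' + 2 * γ ≤ c →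
        (2 : ℝ) ^ (n * γ) ≤ (2 : ℝ) ^ (n * c) * (2 : ℝ) ^ (-(n * (I' + γ))) := by
      intro c I' h
      rw [← Real.rpow_add (by norm_num)]
      refine Real.rpow_le_rpow_of_exponent_le (by norm_num) ?_
      have : (n : ℝ) * (I' + 2 * γ) ≤ n * c := by gcongr
      linarith
    have hm : κ * (2 : ℝ) ^ (n * γ)
        ≤ min (Fintype.card I * α) (Fintype.card I * Fintype.card J * β) := by
      refine le_min ?_ ?_
      · calc _ ≤ κ * ((2 : ℝ) ^ (n * c₁) * α) := by gcongr; exact e _ _ hγ₁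
          _ = κ * (2 : ℝ) ^ (n * c₁) * α := by ring
          _ ≤ _ := by gcongr
      · calc _ ≤ κ * ((2 : ℝ) ^ (n * c₂) * β) := by gcongr; exact e _ _ hγ₂
          _ = κ * (2 : ℝ) ^ (n * c₂) * β := by ring
          _ ≤ _ := by gcongr
    linarith
  have hAc : prob PB {ω | law PB (fun ω => (ω.1, ω.2.1)) (ω.1, ω.2.1) * α
        ≤ iid n PS ω.1 * iid n PU ω.2.1 ∧
      PB ω * β ≤ iid n PS ω.1 * (iid n PU ω.2.1 * block n K ω.2.1 ω.2.2) ∧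
      ∑ t, d₁ (ω.1 t) (ω.2.1 t) ≤ n * D₁ ∧ ∑ t, d₂ (ω.1 t) (ω.2.2 t) ≤ n * D₂}ᶜ
      ≤ η / 5 + η / 5 + (η / 5 + η / 5) := by
    refine le_trans ?_ (add_le_add (add_le_add b₁ b₂) (add_le_add b₃ b₄))
    rw [hPB, prob_law, ← hPB]
    refine le_trans (prob_mono hp ?_) ((prob_union_le hp _ _).trans
      (add_le_add (prob_union_le hp _ _) (prob_union_le hp _ _)))
    intro φ hφ
    simp only [Set.mem_ofPred_eq, Set.mem_compl_iff, not_and_or, not_le, hBSU, hB, hz] at hφ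
    simp only [Set.mem_union, Set.mem_ofPred_eq]
    rcases hφ with h | h | h | h
    · refine Or.inl (Or.inl ?_)
      rw [Finset.prod_mul_distrib]
      exact lt_of_lt_of_eq h (mul_comm _ _)
    · refine Or.inl (Or.inr ?_)
      rw [Finset.prod_mul_distrib, Finset.prod_mul_distrib]
      exact lt_of_lt_of_eq h (mul_comm _ _)
    · exact Or.inr (Or.inl h)
    · exact Or.inr (Or.inr h)
  refine le_trans (prob_mono (iid_mem hPSm).1 ?_) (hcov.trans ((add_le_add hAc hexp).trans
    (by linarith)))
  intro s hs i j hmem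
  exact hs i j ⟨hmem.2.2.1, hmem.2.2.2⟩

end Source

/-! ### Concatenation of source and channel codes -/

section SourceChannel

variable {S X Y Z : Type*} [Fintype S] [Fintype X] [Fintype Y] [Fintype Z] {n l : ℕ}

/-- The law of `(Sⁿ, Yˡ, Zˡ)` when the channel input is the function `x` of `Sⁿ`. -/
def sourceChanLaw (PS : S → ℝ) (PYX : X → Y → ℝ) (PZY : Y → Z → ℝ)
    (x : (Fin n → S) → Fin l → X) : (Fin n → S) × (Fin l → Y) × (Fin l → Z) → ℝ :=
  fun ω => iid n PS ω.1 * (block l PYX (x ω.1) ω.2.1 * block l PZY ω.2.1 ω.2.2)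

variable {PS : S → ℝ} {PYX : X → Y → ℝ} {PZY : Y → Z → ℝ}

theorem block_mul_block_mem (hPYX : ∀ x, PYX x ∈ stdSimplex ℝ Y)
    (hPZY : ∀ y, PZY y ∈ stdSimplex ℝ Z) (x : Fin l → X) :
    (fun t : (Fin l → Y) × (Fin l → Z) => block l PYX x t.1 * block l PZY t.1 t.2)
      ∈ stdSimplex ℝ ((Fin l → Y) × (Fin l → Z)) := by
  refine ⟨fun t => mul_nonneg ((block_mem hPYX _).1 _) ((block_mem hPZY _).1 _), ?_⟩
  rw [Fintype.sum_prod_type]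
  simp only [← Finset.mul_sum, (block_mem hPZY _).2, (block_mem hPYX _).2, mul_one]

theorem sum_sourceChanLaw_mul (x : (Fin n → S) → Fin l → X)
    (F : (Fin n → S) → (Fin l → Y) × (Fin l → Z) → ℝ) :
    ∑ ω, sourceChanLaw PS PYX PZY x ω * F ω.1 ω.2
      = ∑ s, iid n PS s * ∑ t : (Fin l → Y) × (Fin l → Z),
        block l PYX (x s) t.1 * block l PZY t.1 t.2 * F s t := by
  simp only [Fintype.sum_prod_type (α₁ := Fin n → S), sourceChanLaw, Finset.mul_sum, mul_assoc]

theorem sum_sourceChanLaw_mul_fst (hPYX : ∀ x, PYX x ∈ stdSimplex ℝ Y)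
    (hPZY : ∀ y, PZY y ∈ stdSimplex ℝ Z) (x : (Fin n → S) → Fin l → X) (F : (Fin n → S) → ℝ) :
    ∑ ω, sourceChanLaw PS PYX PZY x ω * F ω.1 = ∑ s, iid n PS s * F s := by
  rw [sum_sourceChanLaw_mul x (fun s _ => F s)]
  refine Finset.sum_congr rfl fun s _ => ?_
  rw [← Finset.sum_mul, (block_mul_block_mem hPYX hPZY _).2, one_mul]

theorem sourceChanLaw_mem (hPS : PS ∈ stdSimplex ℝ S) (hPYX : ∀ x, PYX x ∈ stdSimplex ℝ Y)
    (hPZY : ∀ y, PZY y ∈ stdSimplex ℝ Z) (x : (Fin n → S) → Fin l → X) :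
    sourceChanLaw PS PYX PZY x ∈ stdSimplex ℝ _ := by
  refine ⟨fun ω => mul_nonneg ((iid_mem hPS).1 _) ((block_mul_block_mem hPYX hPZY _).1 ω.2), ?_⟩
  have h := sum_sourceChanLaw_mul_fst (PS := PS) hPYX hPZY x (fun _ => 1)
  simp only [mul_one, (iid_mem hPS).2] at h
  exact h

/-- When the helper observes the source itself, the law of the outcome of a code is determined by
the law of the source word and the channel outputs. -/
theorem outcomeLaw_diagLaw {S₁ S₂ : Type*} {R : ℝ} (c : SepCode S S S₁ S₂ X Y Z R n l) :
    c.outcomeLaw (diagLaw PS) PYX PZY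
      = law (sourceChanLaw PS PYX PZY fun s => c.f₂₂ (c.f₂₁ s))
        (fun ω => (ω.1, ω.1, ω.2.1, ω.2.2)) := by
  classical
  funext ω
  obtain ⟨s, t, y, z⟩ := ω
  rw [law_eq_sum]
  simp only [SepCode.outcomeLaw, diagLaw, Finset.prod_mul_distrib, Fintype.prod_ite_zero]
  by_cases h : s = t
  · subst h
    rw [Finset.sum_eq_single (s, y, z)]
    · simp [sourceChanLaw, iid, block]
    · rintro ⟨s', y', z'⟩ - h
      rw [if_neg]
      contrapose! h
      simp only [Prod.mk.injEq] at h ⊢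
      tauto
    · simp
  · rw [if_neg (fun h' => h (funext h')), zero_mul]
    symm
    refine Finset.sum_eq_zero fun ω _ => if_neg fun h' => h ?_
    simp only [Prod.mk.injEq] at h'
    rw [← h'.1, ← h'.2.1]

end SourceChannel

section Bridge

variable {S S₁ S₂ X Y Z : Type*} [Fintype S] [Fintype S₁] [Fintype S₂] [Fintype X]
  [Fintype Y] [Fintype Z] {n l : ℕ}
  {PS : S → ℝ} {PYX : X → Y → ℝ} {PZY : Y → Z → ℝ}

theorem avgDist_le_of_forall_le {S A : Type*} (d : S → A → ℝ≥0) {δ : ℝ} (hd : ∀ s a, (d s a : ℝ) ≤ δ)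
    (hδ : 0 ≤ δ) (s : Fin n → S) (a : Fin n → A) : avgDist d s a ≤ δ := by
  unfold avgDist
  refine div_le_of_le_mul₀ (Nat.cast_nonneg n) hδ ?_
  calc _ ≤ ∑ _i : Fin n, δ := Finset.sum_le_sum fun i _ => hd _ _
    _ = _ := by simp [mul_comm]

theorem exists_distortion_bound {S A : Type*} [Fintype S] [Fintype A] (d : S → A → ℝ≥0) :
    ∃ δ : ℝ, 0 ≤ δ ∧ ∀ s a, (d s a : ℝ) ≤ δ := by
  refine ⟨∑ s, ∑ a, (d s a : ℝ), by positivity, fun s a => ?_⟩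
  calc (d s a : ℝ) ≤ ∑ a, (d s a : ℝ) :=
        Finset.single_le_sum (f := fun a => (d s a : ℝ)) (fun _ _ => NNReal.coe_nonneg _)
          (Finset.mem_univ a)
    _ ≤ _ := Finset.single_le_sum (f := fun s => ∑ a, (d s a : ℝ))
        (fun _ _ => by positivity) (Finset.mem_univ s)

/-- Outside the bad event the distortion is at most D; on it the trivial bound δ costs δη. This
turns small error probability into small expected distortion. -/
theorem expect_avgDist_le {Ω S A : Type*} [Fintype Ω] {p : Ω → ℝ} (hp : p ∈ stdSimplex ℝ Ω)
    (d : S → A → ℝ≥0) (s : Ω → Fin n → S) (a : Ω → Fin n → A) {D δ η : ℝ} (hD : 0 ≤ D)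
    (hd : ∀ s a, (d s a : ℝ) ≤ δ) (hδ : 0 ≤ δ) {E : Set Ω} (hE : prob p E ≤ η)
    (h : ∀ ω ∉ E, avgDist d (s ω) (a ω) ≤ D) :
    expect p (fun ω => avgDist d (s ω) (a ω)) ≤ D + δ * η := by
  classical
  have hpt : ∀ ω, p ω * avgDist d (s ω) (a ω) ≤ p ω * D + δ * if ω ∈ E then p ω else 0 := by
    intro ω
    have h0 := hp.1 ω
    by_cases hb : ω ∈ E
    · have := avgDist_le_of_forall_le d hd hδ (s ω) (a ω)
      simp only [hb, if_true]
      nlinarith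
    · have := h ω hb
      simp only [hb, if_false]
      nlinarith
  calc _ ≤ ∑ ω, (p ω * D + δ * if ω ∈ E then p ω else 0) := Finset.sum_le_sum fun ω _ => hpt ω
    _ = D + δ * prob p E := by
        rw [prob_eq_sum, Finset.sum_add_distrib, ← Finset.sum_mul, hp.2, one_mul, Finset.mul_sum]
    _ ≤ _ := by gcongr

/-- Concatenation of a source code with a superposition channel code. The strong receiver decodes
the message of the weak receiver as well. -/
theorem exists_sepCode (hPS : PS ∈ stdSimplex ℝ S) (hPYX : ∀ x, PYX x ∈ stdSimplex ℝ Y)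
    (hPZY : ∀ y, PZY y ∈ stdSimplex ℝ Z) (d₁ : S → S₁ → ℝ≥0) (d₂ : S → S₂ → ℝ≥0) {R : ℝ}
    {k₁ k₂ : ℕ} (e : (Fin n → S) → Message n R × Fin k₁ × Fin k₂)
    (u : Message n R × Fin k₁ → Fin n → S₁) (v : Message n R × Fin k₁ × Fin k₂ → Fin n → S₂)
    (f : Fin k₁ × Fin k₂ → Fin l → X) (g₁ : (Fin l → Z) → Fin k₁)
    (g₂ : (Fin l → Y) → Fin k₁ × Fin k₂) {η D₁ D₂ δ : ℝ} (hD₁ : 0 ≤ D₁) (hD₂ : 0 ≤ D₂)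
    (hδ₁ : ∀ s a, (d₁ s a : ℝ) ≤ δ) (hδ₂ : ∀ s a, (d₂ s a : ℝ) ≤ δ) (hδ : 0 ≤ δ)
    (B : Set (Fin n → S)) (hB : prob (iid n PS) B ≤ η)
    (hu : ∀ s ∉ B, avgDist d₁ s (u ((e s).1, (e s).2.1)) ≤ D₁)
    (hv : ∀ s ∉ B, avgDist d₂ s (v (e s)) ≤ D₂)
    (hg : ∑ m, law (iid n PS) (fun s => (e s).2) m *
      prob (fun t : (Fin l → Y) × (Fin l → Z) => block l PYX (f m) t.1 * block l PZY t.1 t.2)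
        {t | g₁ t.2 ≠ m.1 ∨ g₂ t.1 ≠ m} ≤ η) :
    ∃ c : SepCode S S S₁ S₂ X Y Z R n l,
      prob (c.outcomeLaw (diagLaw PS) PYX PZY) {ω | c.f₂₁ ω.2.1 ≠ c.decoded ω} ≤ η ∧
      expect (c.outcomeLaw (diagLaw PS) PYX PZY) (fun ω => avgDist d₁ ω.1 (c.recon₁ ω))
        ≤ D₁ + δ * (2 * η) ∧
      expect (c.outcomeLaw (diagLaw PS) PYX PZY) (fun ω => avgDist d₂ ω.1 (c.recon₂ ω))
        ≤ D₂ + δ * (2 * η) := by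
  classical
  -- The strong receiver reconstructs from its own helper message alone, so this message must
  -- contain the cloud index too: `M₂` is the whole pair, encoded in `Fin (k₁ * k₂)`.
  let c : SepCode S S S₁ S₂ X Y Z R n l :=
    { k₁ := k₁
      k₂ := k₁ * k₂
      f₁ := fun s => (e s).1
      f₂₁ := fun s => ((e s).2.1, finProdFinEquiv (e s).2)
      f₂₂ := fun m => f (finProdFinEquiv.symm m.2)
      g₁₁ := g₁
      g₁₂ := u
      g₂₁ := fun y => finProdFinEquiv (g₂ y)
      g₂₂ := fun m => v (m.1, finProdFinEquiv.symm m.2) }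
  set Q := sourceChanLaw PS PYX PZY fun s => c.f₂₂ (c.f₂₁ s) with hQd
  have hQ : Q ∈ stdSimplex ℝ _ := sourceChanLaw_mem hPS hPYX hPZY _
  set E : Set ((Fin n → S) × (Fin l → Y) × (Fin l → Z)) :=
    {ω | g₁ ω.2.2 ≠ (e ω.1).2.1 ∨ g₂ ω.2.1 ≠ (e ω.1).2} with hEd
  have hE : prob Q E ≤ η := by
    refine le_of_eq_of_le ?_ hg
    rw [sum_law_mul, prob_eq_sum]
    have h := sum_sourceChanLaw_mul (PS := PS) (PYX := PYX) (PZY := PZY)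
      (fun s => c.f₂₂ (c.f₂₁ s))
      (fun s t => if g₁ t.2 ≠ (e s).2.1 ∨ g₂ t.1 ≠ (e s).2 then 1 else 0)
    calc _ = _ := by
          refine Finset.sum_congr rfl fun ω _ => ?_
          simp only [hEd, Set.mem_ofPred_eq]
          rw [← mul_boole, ← hQd]
      _ = _ := h
      _ = _ := by
        refine Finset.sum_congr rfl fun s _ => ?_
        rw [prob_eq_sum]
        congr 1
        refine Finset.sum_congr rfl fun t _ => ?_
        simp only [Set.mem_ofPred_eq, mul_boole, c, Equiv.symm_apply_apply]
  -- An uncovered source word or a channel error: one η each.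
  have hbad : prob Q ({ω | ω.1 ∈ B} ∪ E) ≤ 2 * η := by
    refine (prob_union_le hQ.1 _ _).trans ?_
    have hBQ : prob Q {ω | ω.1 ∈ B} = prob (iid n PS) B := by
      rw [prob_eq_sum, prob_eq_sum]
      simp only [← mul_boole _ (Q _), ← mul_boole _ (iid n PS _), Set.mem_ofPred_eq]
      exact sum_sourceChanLaw_mul_fst hPYX hPZY _ (fun s => if s ∈ B then 1 else 0)
    linarith
  refine ⟨c, ?_, ?_, ?_⟩
  · rw [outcomeLaw_diagLaw, prob_law]
    refine (prob_mono hQ.1 ?_).trans hE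
    intro ω hω
    simp only [Set.mem_ofPred_eq, SepCode.decoded, c, ne_eq, Prod.mk.injEq,
      EmbeddingLike.apply_eq_iff_eq, not_and_or] at hω
    exact hω.imp (fun h => Ne.symm h) (fun h => Ne.symm h)
  · rw [outcomeLaw_diagLaw, expect_law]
    refine expect_avgDist_le hQ d₁ (fun ω => ω.1) _ hD₁ hδ₁ hδ hbad fun ω hω => ?_
    simp only [hEd, Set.mem_union, Set.mem_ofPred_eq, not_or, not_not] at hω
    obtain ⟨hb, he⟩ := hω
    have hr : c.recon₁ (ω.1, ω.1, ω.2.1, ω.2.2) = u ((e ω.1).1, g₁ ω.2.2) := rfl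
    rw [hr, he.1]
    exact hu _ hb
  · rw [outcomeLaw_diagLaw, expect_law]
    refine expect_avgDist_le hQ d₂ (fun ω => ω.1) _ hD₂ hδ₂ hδ hbad fun ω hω => ?_
    simp only [hEd, Set.mem_union, Set.mem_ofPred_eq, not_or, not_not] at hω
    obtain ⟨hb, he⟩ := hω
    have hr : c.recon₂ (ω.1, ω.1, ω.2.1, ω.2.2) = v (e ω.1) := by
      simp only [SepCode.recon₂, SepCode.decoded, c, Equiv.symm_apply_apply, he.2]
    rw [hr]
    exact hv _ hb

end Bridge

/-! ### Time sharing and convexity of information -/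

section Mixture

variable {T Ω A B : Type*} [Fintype T] [Fintype Ω] [Fintype A] [Fintype B]

/-- The joint law of a time-sharing variable `t ∼ w` and an outcome with law `p t`. -/
def timeShare (w : T → ℝ) (p : T → Ω → ℝ) : T × Ω → ℝ := fun t => w t.1 * p t.1 t.2

variable {w : T → ℝ} {p : T → Ω → ℝ}

theorem timeShare_mem (hw : w ∈ stdSimplex ℝ T) (hp : ∀ t, p t ∈ stdSimplex ℝ Ω) :
    timeShare w p ∈ stdSimplex ℝ (T × Ω) := by
  refine ⟨fun t => mul_nonneg (hw.1 _) ((hp _).1 _), ?_⟩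
  rw [Fintype.sum_prod_type]
  simp only [timeShare, ← Finset.mul_sum, (hp _).2, mul_one, hw.2]

theorem law_timeShare_snd : law (timeShare w p) (fun t => t.2) = fun ω => ∑ t, w t * p t ω := by
  classical
  funext ω
  rw [law_eq_sum, Fintype.sum_prod_type]
  simp [timeShare]

theorem law_timeShare_fst (hp : ∀ t, p t ∈ stdSimplex ℝ Ω) :
    law (timeShare w p) (fun t => t.1) = w := by
  classical
  funext t
  rw [law_eq_sum, Fintype.sum_prod_type_right]
  simp [timeShare, ← Finset.mul_sum, (hp _).2]

theorem mixture_mem (hw : w ∈ stdSimplex ℝ T) (hp : ∀ t, p t ∈ stdSimplex ℝ Ω) :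
    (fun ω => ∑ t, w t * p t ω) ∈ stdSimplex ℝ Ω := by
  rw [← law_timeShare_snd]
  exact law_mem_stdSimplex (timeShare_mem hw hp) _

theorem entropy_timeShare_pair (hp : ∀ t, p t ∈ stdSimplex ℝ Ω)
    (U : Ω → A) :
    entropy (timeShare w p) (fun t => (t.1, U t.2)) = entropy (timeShare w p) (fun t => t.1)
      + ∑ t, w t * entropy (p t) U := by
  classical
  rw [entropy_pair_of_kernel (timeShare w p) (fun t => t.1) (fun t => U t.2)
    (fun t => law (p t) U) (fun t => law_mem_stdSimplex (hp t) U)]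
  · congr 1
    rw [Fintype.sum_prod_type]
    refine Finset.sum_congr rfl fun t _ => ?_
    dsimp only
    rw [← Finset.sum_mul]
    simp only [timeShare, ← Finset.mul_sum, (hp _).2, mul_one]
    rfl
  · intro t c
    rw [law_timeShare_fst hp]
    simp only [law_eq_sum, Fintype.sum_prod_type, Prod.mk.injEq, ite_and, timeShare,
      Finset.sum_ite_irrel, Finset.sum_const_zero, Finset.sum_ite_eq', Finset.mem_univ, if_true,
      Finset.mul_sum, mul_ite, mul_zero]

/-- Conditional entropy is concave. -/
theorem sum_mul_condEntropy_le (hw : w ∈ stdSimplex ℝ T) (hp : ∀ t, p t ∈ stdSimplex ℝ Ω)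
    (U : Ω → A) (V : Ω → B) :
    ∑ t, w t * (entropy (p t) (fun ω => (U ω, V ω)) - entropy (p t) V)
      ≤ entropy (fun ω => ∑ t, w t * p t ω) (fun ω => (U ω, V ω))
        - entropy (fun ω => ∑ t, w t * p t ω) V := by
  have hQ := timeShare_mem hw hp
  have h1 := entropy_timeShare_pair (w := w) hp (fun ω => (U ω, V ω))
  have h2 := entropy_timeShare_pair (w := w) hp V
  have h3 := entropy_submodular hQ (fun t => U t.2) (fun t => t.1) (fun t => V t.2)
  have h4 := entropy_eq_of_comp hQ (U := fun t => (t.1, U t.2, V t.2))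
    (V := fun t => (U t.2, t.1, V t.2)) (fun x => (x.2.1, x.1, x.2.2))
    (fun x => (x.2.1, x.1, x.2.2)) (fun _ => rfl) (fun _ => rfl)
  rw [← law_timeShare_snd, entropy_law, entropy_law]
  simp_rw [mul_sub, Finset.sum_sub_distrib]
  linarith

theorem law_mixture (U : Ω → A) (a : A) :
    law (fun ω => ∑ t, w t * p t ω) U a = ∑ t, w t * law (p t) U a := by
  classical
  simp_rw [law_eq_sum, Finset.mul_sum]
  rw [Finset.sum_comm]
  refine Finset.sum_congr rfl fun ω _ => ?_
  split_ifs <;> simp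

theorem expect_mixture (f : Ω → ℝ) :
    expect (fun ω => ∑ t, w t * p t ω) f = ∑ t, w t * expect (p t) f := by
  simp_rw [expect, Finset.mul_sum, Finset.sum_mul]
  rw [Finset.sum_comm]
  exact Finset.sum_congr rfl fun t _ => Finset.sum_congr rfl fun ω _ => by ring

/-- Mutual information is convex in the channel for a fixed law of the input `V`. -/
theorem mutualInfo_mixture_le (hw : w ∈ stdSimplex ℝ T) (hp : ∀ t, p t ∈ stdSimplex ℝ Ω)
    (U : Ω → A) (V : Ω → B) {μ : B → ℝ} (hμ : ∀ t, law (p t) V = μ) :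
    mutualInfo (fun ω => ∑ t, w t * p t ω) U V ≤ ∑ t, w t * mutualInfo (p t) U V := by
  -- With the law of V fixed, H(V) is common to all components, and I(U;V) varies only through
  -- -H(V|U), which is convex.
  have h := sum_mul_condEntropy_le hw hp V U
  have hV : law (fun ω => ∑ t, w t * p t ω) V = μ := by
    funext b
    rw [law_mixture]
    simp_rw [hμ]
    rw [← Finset.sum_mul, hw.2, one_mul]
  have e : ∀ t, entropy (p t) (fun ω => (U ω, V ω)) = entropy (p t) (fun ω => (V ω, U ω)) :=
    fun t => entropy_eq_of_comp (hp t) Prod.swap Prod.swap (fun _ => rfl) (fun _ => rfl)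
  have e' := entropy_eq_of_comp (mixture_mem hw hp) (U := fun ω => (V ω, U ω))
    (V := fun ω => (U ω, V ω)) Prod.swap Prod.swap (fun _ => rfl) (fun _ => rfl)
  have hs : ∑ t, w t * mutualInfo (p t) U V
      = pmfEntropy μ - ∑ t, w t * (entropy (p t) (fun ω => (V ω, U ω)) - entropy (p t) U) := by
    have : ∀ t, w t * mutualInfo (p t) U V = w t * pmfEntropy μ
        - w t * (entropy (p t) (fun ω => (V ω, U ω)) - entropy (p t) U) := fun t => by
      rw [mutualInfo, e, entropy_eq_pmfEntropy (p t) V, hμ]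
      ring
    simp_rw [this]
    rw [Finset.sum_sub_distrib, ← Finset.sum_mul, hw.2, one_mul]
  rw [hs, mutualInfo, e', entropy_eq_pmfEntropy _ V, hV]
  linarith

end Mixture

/-! ### Vanishing mutual information -/

section Independence

variable {Ω A B : Type*} [Fintype Ω] [Fintype A] [Fintype B]

/-- Random variables without mutual information are independent. -/
theorem law_pair_eq_mul_of_mutualInfo_le_zero {p : Ω → ℝ} (hp : p ∈ stdSimplex ℝ Ω) (U : Ω → A)
    (V : Ω → B) (h : mutualInfo p U V ≤ 0) (a : A) (b : B) :
    law p (fun ω => (U ω, V ω)) (a, b) = law p U a * law p V b := by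
  have h2 : 0 < Real.log 2 := Real.log_pos (by norm_num)
  have hU := law_mem_stdSimplex hp U
  have hV := law_mem_stdSimplex hp V
  have hUV := law_mem_stdSimplex hp (fun ω => (U ω, V ω))
  set q : A × B → ℝ := fun t => law p U t.1 * law p V t.2
  set r := law p (fun ω => (U ω, V ω))
  have hq0 : ∀ t, 0 ≤ q t := fun t => mul_nonneg (hU.1 _) (hV.1 _)
  have hqpos : ∀ t, 0 < r t → 0 < q t := fun t ht =>
    mul_pos (ht.trans_le (law_le_law_comp hp.1 (fun ω => (U ω, V ω)) Prod.fst t))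
      (ht.trans_le (law_le_law_comp hp.1 (fun ω => (U ω, V ω)) Prod.snd t))
  -- The slack in log x ≤ x - 1 at x = q/r, weighted by r. The slacks are nonnegative and sum to the
  -- mutual information, hence all vanish, and equality forces q = r.
  let f : A × B → ℝ := fun t => (q t - r t) / Real.log 2
    - r t * (Real.logb 2 (q t) - Real.logb 2 (r t))
  have hf0 : ∀ t, 0 ≤ f t := by
    intro t
    simp only [f]
    rcases (hUV.1 t).eq_or_lt with h0 | h0
    · rw [show r t = 0 from h0.symm, zero_mul, sub_zero, sub_zero]
      exact div_nonneg (hq0 t) h2.le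
    · have h3 := logb_two_le_div (q t / r t) (div_pos (hqpos t h0) h0)
      rw [Real.logb_div (hqpos t h0).ne' h0.ne'] at h3
      have h4 := mul_le_mul_of_nonneg_left h3 h0.le
      have h5 : r t * ((q t / r t - 1) / Real.log 2) = (q t - r t) / Real.log 2 := by
        field_simp
      linarith
  have hsum : ∑ t, f t ≤ 0 := by
    simp only [f]
    have hm := sum_mul_logb_sub hp U V
    have hm' := sum_law_mul p (fun ω => (U ω, V ω))
      (fun t => Real.logb 2 (q t) - Real.logb 2 (r t))
    have hq1 : ∑ t, q t = 1 := by
      rw [Fintype.sum_prod_type]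
      simp only [q, ← Finset.mul_sum, hV.2, mul_one, hU.2]
    rw [Finset.sum_sub_distrib, ← Finset.sum_div, Finset.sum_sub_distrib, hq1, hUV.2, hm',
      show ∑ ω, p ω * (Real.logb 2 (q (U ω, V ω)) - Real.logb 2 (r (U ω, V ω)))
        = -mutualInfo p U V from hm]
    linarith [show (1 - 1 : ℝ) / Real.log 2 = 0 by simp]
  have hf : f (a, b) = 0 :=
    (Finset.sum_eq_zero_iff_of_nonneg fun t _ => hf0 t).1
      (le_antisymm hsum (Finset.sum_nonneg fun t _ => hf0 t)) (a, b) (Finset.mem_univ _)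
  change r (a, b) = q (a, b)
  simp only [f] at hf
  rcases (hUV.1 (a, b)).eq_or_lt with h0 | h0
  · rw [show r (a, b) = 0 from h0.symm, zero_mul, sub_zero, sub_zero,
      div_eq_zero_iff] at hf
    rw [show r (a, b) = 0 from h0.symm]
    rcases hf with hf | hf
    · exact hf.symm
    · exact absurd hf h2.ne'
  · have hx := div_pos (hqpos _ h0) h0
    by_contra hne
    have h1 : q (a, b) / r (a, b) ≠ 1 := fun h1 => hne ((div_eq_one_iff_eq h0.ne').1 h1).symm
    have h3 := Real.log_lt_sub_one_of_pos hx h1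
    rw [Real.log_div (hqpos _ h0).ne' h0.ne'] at h3
    have h4 := mul_lt_mul_of_pos_left h3 h0
    have h5 : r (a, b) * (q (a, b) / r (a, b) - 1) = q (a, b) - r (a, b) := by field_simp
    rw [Real.logb, Real.logb, ← sub_div, mul_div_assoc', ← sub_div, div_eq_zero_iff] at hf
    rcases hf with hf | hf
    · linarith
    · exact absurd hf h2.ne'

/-- If `U` and `V` are independent then `U` can be replaced by one of its values without increasing
the expectation of a function of `(U,V)`. -/
theorem exists_expect_le_of_mutualInfo_le_zero {p : Ω → ℝ} (hp : p ∈ stdSimplex ℝ Ω) (U : Ω → A)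
    (V : Ω → B) (h : mutualInfo p U V ≤ 0) (f : B → A → ℝ) {D : ℝ}
    (hD : expect p (fun ω => f (V ω) (U ω)) ≤ D) :
    ∃ a, expect p (fun ω => f (V ω) a) ≤ D := by
  have hU := law_mem_stdSimplex hp U
  refine exists_le_of_expect_le hU _ (le_of_eq_of_le ?_ hD)
  have h1 := sum_law_mul p (fun ω => (U ω, V ω)) (fun t => f t.2 t.1)
  rw [Fintype.sum_prod_type] at h1
  rw [expect, ← h1]
  refine Finset.sum_congr rfl fun a _ => ?_
  rw [expect, ← sum_law_mul p V (fun b => f b a), Finset.mul_sum]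
  refine Finset.sum_congr rfl fun b _ => ?_
  rw [law_pair_eq_mul_of_mutualInfo_le_zero hp U V h]
  ring

end Independence

/-! ### Achievability under strict inequalities -/

section Achievability

variable {S S₁ S₂ X Y Z : Type*} [Fintype S] [Fintype S₁] [Fintype S₂] [Fintype X]
  [Fintype Y] [Fintype Z] {PS : S → ℝ} {PYX : X → Y → ℝ} {PZY : Y → Z → ℝ}
  {d₁ : S → S₁ → ℝ≥0} {d₂ : S → S₂ → ℝ≥0} {R D₁ D₂ ρ : ℝ}

/-- Achievability is closed under limits in the distortions, so a reconstruction may be perturbed at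
an arbitrarily small cost. -/
theorem sepAchievable_of_forall_add {PST : S × S → ℝ} (h : ∀ ε > 0,
    SepAchievable PST PYX PZY d₁ d₂ R (D₁ + ε) (D₂ + ε) ρ) :
    SepAchievable PST PYX PZY d₁ d₂ R D₁ D₂ ρ := by
  intro ε hε
  obtain ⟨n, l, c, h₀, h₁, h₂, h₃, h₄⟩ := h (ε / 2) (half_pos hε) (ε / 2) (half_pos hε)
  exact ⟨n, l, c, h₀, by linarith, by linarith, by linarith, by linarith⟩

theorem half_le_floor {x : ℝ} (hx : 1 ≤ x) : x / 2 ≤ ⌊x⌋₊ := by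
  have h1 := Nat.lt_floor_add_one x
  have h2 : (1 : ℝ) ≤ ⌊x⌋₊ := by exact_mod_cast (Nat.one_le_floor_iff x).2 hx
  linarith

theorem one_le_two_rpow_mul {r : ℝ} (hr : 0 ≤ r) (n : ℕ) : 1 ≤ (2 : ℝ) ^ (n * r) :=
  Real.one_le_rpow (by norm_num) (by positivity)

theorem message_pos {r : ℝ} (hr : 0 ≤ r) (n : ℕ) : 0 < ⌊(2 : ℝ) ^ (n * r)⌋₊ :=
  Nat.floor_pos.2 (one_le_two_rpow_mul hr n)

theorem avgDist_le_of_sum_le {A : Type*} (d : S → A → ℝ≥0) {n : ℕ} (hn : 0 < n) {D : ℝ}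
    {s : Fin n → S} {a : Fin n → A} (h : ∑ i, (d (s i) (a i) : ℝ) ≤ n * D) : avgDist d s a ≤ D := by
  have hn' : (0 : ℝ) < n := by exact_mod_cast hn
  rw [avgDist, div_le_iff₀ hn']
  linarith

/-- Source codes with helper rates below the superposition rates give achievability. -/
theorem sepAchievable_of_eventually_source_code [Nonempty X] {W : Type*} [Fintype W]
    {PW : W → ℝ} {PXW : W → X → ℝ}
    (hPS : PS ∈ stdSimplex ℝ S) (hPW : PW ∈ stdSimplex ℝ W) (hPXW : ∀ w, PXW w ∈ stdSimplex ℝ X)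
    (hPYX : ∀ x, PYX x ∈ stdSimplex ℝ Y) (hPZY : ∀ y, PZY y ∈ stdSimplex ℝ Z)
    {r₁ r₂ : ℝ} (hρ : 0 ≤ ρ) (hD₁ : 0 ≤ D₁) (hD₂ : 0 ≤ D₂)
    (hr₁ : r₁ = 0 ∨ 0 ≤ r₁ ∧ r₁ < ρ * mutualInfo (chanLaw PW PXW PYX PZY)
      (fun ω => ω.1) (fun ω => ω.2.2.2))
    (hr₂ : r₂ = 0 ∨ 0 ≤ r₂ ∧ r₂ < ρ * condMutualInfo (chanLaw PW PXW PYX PZY)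
      (fun ω => ω.2.1) (fun ω => ω.2.2.1) (fun ω => ω.1))
    (hsrc : ∀ η > 0, ∀ᶠ n : ℕ in atTop,
      ∃ (e : (Fin n → S) → Message n R × Fin ⌊(2 : ℝ) ^ (n * r₁)⌋₊ × Fin ⌊(2 : ℝ) ^ (n * r₂)⌋₊)
        (u : Message n R × Fin ⌊(2 : ℝ) ^ (n * r₁)⌋₊ → Fin n → S₁)
        (v : Message n R × Fin ⌊(2 : ℝ) ^ (n * r₁)⌋₊ × Fin ⌊(2 : ℝ) ^ (n * r₂)⌋₊ → Fin n → S₂)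
        (B : Set (Fin n → S)), prob (iid n PS) B ≤ η ∧
        (∀ s ∉ B, avgDist d₁ s (u ((e s).1, (e s).2.1)) ≤ D₁ + η) ∧
        (∀ s ∉ B, avgDist d₂ s (v (e s)) ≤ D₂ + η)) :
    SepAchievable (diagLaw PS) PYX PZY d₁ d₂ R D₁ D₂ ρ := by
  intro ε hε
  obtain ⟨δ₁, hδ₁0, hδ₁⟩ := exists_distortion_bound d₁
  obtain ⟨δ₂, hδ₂0, hδ₂⟩ := exists_distortion_bound d₂
  set δ := max δ₁ δ₂
  have hδ0 : 0 ≤ δ := hδ₁0.trans (le_max_left _ _)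
  obtain ⟨η, hη, hηε, hηδ⟩ : ∃ η > 0, η ≤ ε ∧ η + δ * (2 * η) ≤ ε := by
    have h0 : 0 < 1 + 2 * δ := by positivity
    refine ⟨ε / (1 + 2 * δ), by positivity, div_le_self hε.le (by linarith), le_of_eq ?_⟩
    field_simp
  obtain ⟨n, ⟨⟨hsrcn, hch⟩, hn1⟩, hnε⟩ := (((hsrc η hη).and
    (eventually_exists_channel_code hPW hPXW hPYX hPZY hρ hr₁ hr₂ hη)).and
    (eventually_ge_atTop 1)).and (tendsto_natCast_atTop_atTop.eventually_ge_atTop (1 / ε)) |>.exists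
  obtain ⟨e, u, v, B, hB, hu, hv⟩ := hsrcn
  obtain ⟨f, g₁, g₂, hg⟩ := hch _ (law_mem_stdSimplex (iid_mem hPS) fun s => (e s).2)
  obtain ⟨c, hc₁, hc₂, hc₃⟩ := exists_sepCode hPS hPYX hPZY d₁ d₂ e u v f g₁ g₂
    (add_nonneg hD₁ hη.le) (add_nonneg hD₂ hη.le)
    (fun s a => (hδ₁ s a).trans (le_max_left _ _)) (fun s a => (hδ₂ s a).trans (le_max_right _ _))
    hδ0 B hB hu hv hg
  have hn0 : (0 : ℝ) < n := by exact_mod_cast hn1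
  refine ⟨n, _, c, hn1, ?_, hc₁.trans hηε, hc₂.trans (by linarith), hc₃.trans (by linarith)⟩
  rw [div_le_iff₀ hn0]
  have h1 := (Nat.ceil_lt_add_one (a := ρ * n) (by positivity)).le
  rw [div_le_iff₀ hε] at hnε
  linarith

/-- Achievability under strict rate constraints. -/
theorem sepAchievable_of_lt [Nonempty X] {W : Type*} [Fintype W]
    {PW : W → ℝ} {PXW : W → X → ℝ} {P : S × S₁ × S₂ → ℝ}
    (hP : P ∈ stdSimplex ℝ (S × S₁ × S₂)) (hPW : PW ∈ stdSimplex ℝ W)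
    (hPXW : ∀ w, PXW w ∈ stdSimplex ℝ X)
    (hPYX : ∀ x, PYX x ∈ stdSimplex ℝ Y) (hPZY : ∀ y, PZY y ∈ stdSimplex ℝ Z)
    (hR : 0 ≤ R) (hρ : 0 ≤ ρ) (hPS : law P (fun ω => ω.1) = PS)
    (hD₁ : expect P (fun ω => (d₁ ω.1 ω.2.1 : ℝ)) ≤ D₁)
    (hD₂ : expect P (fun ω => (d₂ ω.1 ω.2.2 : ℝ)) ≤ D₂)
    (h₁ : mutualInfo P (fun ω => ω.2.1) (fun ω => ω.1)
      < R + ρ * mutualInfo (chanLaw PW PXW PYX PZY) (fun ω => ω.1) (fun ω => ω.2.2.2))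
    (h₂ : mutualInfo P (fun ω => (ω.2.1, ω.2.2)) (fun ω => ω.1)
      < R + ρ * mutualInfo (chanLaw PW PXW PYX PZY) (fun ω => ω.1) (fun ω => ω.2.2.2)
        + ρ * condMutualInfo (chanLaw PW PXW PYX PZY)
              (fun ω => ω.2.1) (fun ω => ω.2.2.1) (fun ω => ω.1)) :
    SepAchievable (diagLaw PS) PYX PZY d₁ d₂ R D₁ D₂ ρ := by
  classical
  have hJ := chanLaw_mem hPW hPXW hPYX hPZY
  set I₁ := ρ * mutualInfo (chanLaw PW PXW PYX PZY) (fun ω => ω.1) (fun ω => ω.2.2.2) with hI₁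
  set I₂ := ρ * condMutualInfo (chanLaw PW PXW PYX PZY)
              (fun ω => ω.2.1) (fun ω => ω.2.2.1) (fun ω => ω.1) with hI₂
  have hI₁0 : 0 ≤ I₁ := mul_nonneg hρ (mutualInfo_nonneg hJ _ _)
  have hI₂0 : 0 ≤ I₂ := mul_nonneg hρ (condMutualInfo_nonneg hJ _ _ _)
  have hE₁ : 0 ≤ expect P (fun ω => (d₁ ω.1 ω.2.1 : ℝ)) :=
    Finset.sum_nonneg fun ω _ => mul_nonneg (hP.1 ω) (NNReal.coe_nonneg _)
  have hE₂ : 0 ≤ expect P (fun ω => (d₂ ω.1 ω.2.2 : ℝ)) :=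
    Finset.sum_nonneg fun ω _ => mul_nonneg (hP.1 ω) (NNReal.coe_nonneg _)
  -- The rates are truncated at 0, where the channel code needs no strict inequality.
  have hrate : ∀ I γ : ℝ, 0 ≤ I → 0 < γ → max 0 (I - γ) = 0 ∨ 0 ≤ max 0 (I - γ) ∧
      max 0 (I - γ) < I := by
    intro I γ hI hγ
    rcases le_total (I - γ) 0 with h | h
    · exact Or.inl (max_eq_left h)
    · exact Or.inr ⟨le_max_left _ _, by rw [max_eq_right h]; linarith⟩
  -- The sum constraint loses γ twice; a third of the smaller gap suffices for both.
  obtain ⟨γ, hγ, hγ₁, hγ₂⟩ : ∃ γ > 0,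
      mutualInfo P (fun ω => ω.2.1) (fun ω => ω.1) < R + (I₁ - γ) ∧
      mutualInfo P (fun ω => (ω.2.1, ω.2.2)) (fun ω => ω.1) < R + (I₁ - γ) + (I₂ - γ) := by
    set a := R + I₁ - mutualInfo P (fun ω => ω.2.1) (fun ω => ω.1)
    set b := R + I₁ + I₂ - mutualInfo P (fun ω => (ω.2.1, ω.2.2)) (fun ω => ω.1)
    have ha : 0 < a := by simp only [a]; linarith
    have hb : 0 < b := by simp only [b]; linarith
    refine ⟨min a b / 3, by positivity, ?_, ?_⟩
    · linarith [min_le_left a b]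
    · linarith [min_le_right a b]
  set r₁ := max 0 (I₁ - γ)
  set r₂ := max 0 (I₂ - γ)
  have hr₁0 : 0 ≤ r₁ := le_max_left _ _
  have hr₂0 : 0 ≤ r₂ := le_max_left _ _
  have hr₁ : I₁ - γ ≤ r₁ := le_max_right _ _
  have hr₂ : I₂ - γ ≤ r₂ := le_max_right _ _
  refine sepAchievable_of_eventually_source_code (by rw [← hPS]; exact law_mem_stdSimplex hP _)
    hPW hPXW hPYX hPZY hρ (hE₁.trans hD₁) (hE₂.trans hD₂) (hrate I₁ γ hI₁0 hγ)
    (hrate I₂ γ hI₂0 hγ) ?_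
  intro η hη
  -- Clouds are indexed by source message and first helper index, satellites by the second helper
  -- index. Three floors each lose at most a factor 2, whence κ = 1/8.
  filter_upwards [eventually_exists_source_code hP (fun s a => (d₁ s a : ℝ))
    (fun s a => (d₂ s a : ℝ)) (c₁ := R + r₁) (c₂ := R + r₁ + r₂) (by linarith) (by linarith)
    (κ := 1 / 8) (by norm_num) hη hη, eventually_ge_atTop 1] with n hn hn1
  have f0 := half_le_floor (one_le_two_rpow_mul hR n)
  have f1 := half_le_floor (one_le_two_rpow_mul hr₁0 n)
  have f2 := half_le_floor (one_le_two_rpow_mul hr₂0 n)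
  have q0 : (0 : ℝ) < (2 : ℝ) ^ (n * R) := by positivity
  have q1 : (0 : ℝ) < (2 : ℝ) ^ (n * r₁) := by positivity
  have q2 : (0 : ℝ) < (2 : ℝ) ^ (n * r₂) := by positivity
  have p1 : 1 / 4 * ((2 : ℝ) ^ (n * R) * (2 : ℝ) ^ (n * r₁))
      ≤ (⌊(2 : ℝ) ^ (n * R)⌋₊ : ℝ) * ⌊(2 : ℝ) ^ (n * r₁)⌋₊ := by
    have := mul_le_mul f0 f1 (by positivity) (Nat.cast_nonneg _)
    linarith
  obtain ⟨cu, cv, hcov⟩ := hn (Message n R × Fin ⌊(2 : ℝ) ^ (n * r₁)⌋₊)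
    (Fin ⌊(2 : ℝ) ^ (n * r₂)⌋₊)
    (by
      rw [Fintype.card_prod, Fintype.card_fin, Fintype.card_fin, Nat.cast_mul, mul_add,
        Real.rpow_add (by norm_num)]
      have : 0 ≤ (2 : ℝ) ^ (n * R) * (2 : ℝ) ^ (n * r₁) := by positivity
      linarith)
    (by
      rw [Fintype.card_prod, Fintype.card_fin, Fintype.card_fin, Fintype.card_fin, Nat.cast_mul,
        mul_add, mul_add, Real.rpow_add (by norm_num), Real.rpow_add (by norm_num)]
      have := mul_le_mul p1 f2 (by positivity) (by positivity)
      linarith)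
  rw [hPS] at hcov
  let good : (Fin n → S) → Message n R × Fin ⌊(2 : ℝ) ^ (n * r₁)⌋₊ × Fin ⌊(2 : ℝ) ^ (n * r₂)⌋₊
      → Prop := fun s t =>
    ∑ i, (d₁ (s i) (cu (t.1, t.2.1) i) : ℝ)
        ≤ n * (expect P (fun ω => (d₁ ω.1 ω.2.1 : ℝ)) + η) ∧
      ∑ i, (d₂ (s i) (cv (t.1, t.2.1) t.2.2 i) : ℝ)
        ≤ n * (expect P (fun ω => (d₂ ω.1 ω.2.2 : ℝ)) + η)
  have hne : Nonempty (Message n R × Fin ⌊(2 : ℝ) ^ (n * r₁)⌋₊ × Fin ⌊(2 : ℝ) ^ (n * r₂)⌋₊) :=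
    ⟨⟨0, message_pos hR n⟩, ⟨0, message_pos hr₁0 n⟩, ⟨0, message_pos hr₂0 n⟩⟩
  -- The encoder picks a good index if there is one and an arbitrary index otherwise.
  have hgood : ∀ s, ∃ t, (∃ t', good s t') → good s t := fun s => by
    by_cases h : ∃ t', good s t'
    · exact ⟨h.choose, fun _ => h.choose_spec⟩
    · exact ⟨hne.some, fun h' => absurd h' h⟩
  choose e he using hgood
  refine ⟨e, cu, fun t => cv (t.1, t.2.1) t.2.2, {s | ¬∃ t, good s t}, ?_, ?_, ?_⟩
  · refine le_trans (prob_mono (iid_mem (by rw [← hPS]; exact law_mem_stdSimplex hP _)).1 ?_) hcov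
    intro s hs i j hij
    exact hs ⟨(i.1, i.2, j), hij⟩
  · intro s hs
    simp only [Set.mem_ofPred_eq, not_not] at hs
    refine (avgDist_le_of_sum_le d₁ hn1 (he s hs).1).trans (by linarith)
  · intro s hs
    simp only [Set.mem_ofPred_eq, not_not] at hs
    refine (avgDist_le_of_sum_le d₂ hn1 (he s hs).2).trans (by linarith)

/-- Achievability when the weak receiver uses a constant reconstruction. -/
theorem sepAchievable_of_const_of_lt [Nonempty X] {W : Type*} [Fintype W]
    {PW : W → ℝ} {PXW : W → X → ℝ} {P : S × S₂ → ℝ}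
    (hP : P ∈ stdSimplex ℝ (S × S₂)) (hPW : PW ∈ stdSimplex ℝ W)
    (hPXW : ∀ w, PXW w ∈ stdSimplex ℝ X)
    (hPYX : ∀ x, PYX x ∈ stdSimplex ℝ Y) (hPZY : ∀ y, PZY y ∈ stdSimplex ℝ Z)
    (hR : 0 ≤ R) (hρ : 0 ≤ ρ) (hPS : law P (fun ω => ω.1) = PS) (a : S₁)
    (hD₁ : expect PS (fun s => (d₁ s a : ℝ)) ≤ D₁)
    (hD₂ : expect P (fun ω => (d₂ ω.1 ω.2 : ℝ)) ≤ D₂)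
    (h : mutualInfo P (fun ω => ω.2) (fun ω => ω.1)
      < R + ρ * condMutualInfo (chanLaw PW PXW PYX PZY)
              (fun ω => ω.2.1) (fun ω => ω.2.2.1) (fun ω => ω.1)) :
    SepAchievable (diagLaw PS) PYX PZY d₁ d₂ R D₁ D₂ ρ := by
  classical
  have hPSm : PS ∈ stdSimplex ℝ S := by rw [← hPS]; exact law_mem_stdSimplex hP _
  have hJ := chanLaw_mem hPW hPXW hPYX hPZY
  set I₂ := ρ * condMutualInfo (chanLaw PW PXW PYX PZY)
              (fun ω => ω.2.1) (fun ω => ω.2.2.1) (fun ω => ω.1) with hI₂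
  have hI₂0 : 0 ≤ I₂ := mul_nonneg hρ (condMutualInfo_nonneg hJ _ _ _)
  have hE₁ : 0 ≤ expect PS (fun s => (d₁ s a : ℝ)) :=
    Finset.sum_nonneg fun ω _ => mul_nonneg (hPSm.1 ω) (NNReal.coe_nonneg _)
  have hE₂ : 0 ≤ expect P (fun ω => (d₂ ω.1 ω.2 : ℝ)) :=
    Finset.sum_nonneg fun ω _ => mul_nonneg (hP.1 ω) (NNReal.coe_nonneg _)
  -- Either no helper rate is available and R alone suffices, or r is taken just below I₂, by at
  -- most half of the gap b.
  obtain ⟨r, hr0, hr, hrI⟩ : ∃ r, 0 ≤ r ∧ (r = 0 ∨ 0 ≤ r ∧ r < I₂) ∧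
      mutualInfo P (fun ω => ω.2) (fun ω => ω.1) < R + r := by
    rcases hI₂0.eq_or_lt with h0 | h0
    · exact ⟨0, le_rfl, Or.inl rfl, by linarith⟩
    · set b := R + I₂ - mutualInfo P (fun ω => ω.2) (fun ω => ω.1)
      have hb : 0 < b := by simp only [b]; linarith
      refine ⟨I₂ - min I₂ (b / 2), by linarith [min_le_left I₂ (b / 2)],
        Or.inr ⟨by linarith [min_le_left I₂ (b / 2)], ?_⟩, ?_⟩
      · linarith [lt_min h0 (half_pos hb)]
      · linarith [min_le_right I₂ (b / 2)]
  refine sepAchievable_of_eventually_source_code (r₁ := 0) (r₂ := r) hPSm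
    hPW hPXW hPYX hPZY hρ (hE₁.trans hD₁) (hE₂.trans hD₂) (Or.inl rfl) hr ?_
  intro η hη
  -- The roles in the source code are exchanged: the words of the strong receiver form the clouds
  -- and the satellites are trivial. The distortion of the constant `a`, a function of s only, rides
  -- along as the second constraint.
  have hP' : law P (fun ω => (ω.1, ω.2, ())) ∈ stdSimplex ℝ (S × S₂ × Unit) :=
    law_mem_stdSimplex hP _
  have hm : mutualInfo (law P (fun ω => (ω.1, ω.2, ()))) (fun ω => (ω.2.1, ω.2.2)) (fun ω => ω.1)
      = mutualInfo P (fun ω => ω.2) (fun ω => ω.1) := by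
    rw [mutualInfo_law]
    unfold mutualInfo
    rw [entropy_eq_of_comp hP (U := fun ω => ω.2) (V := fun ω => (ω.2, ())) (fun t => (t, ()))
      Prod.fst (fun _ => rfl) (fun _ => rfl),
      entropy_eq_of_comp hP (U := fun ω => (ω.2, ω.1)) (V := fun ω => ((ω.2, ()), ω.1))
        (fun t => ((t.1, ()), t.2)) (fun t => (t.1.1, t.2)) (fun _ => rfl) (fun _ => rfl)]
  filter_upwards [eventually_exists_source_code hP' (fun s b => (d₂ s b : ℝ))
    (fun s _ => (d₁ s a : ℝ)) (c₁ := R + r) (c₂ := R + r) (by rw [mutualInfo_law]; exact hrI)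
    (by rw [hm]; exact hrI)
    (κ := 1 / 4) (by norm_num) hη hη, eventually_ge_atTop 1] with n hn hn1
  have f0 := half_le_floor (one_le_two_rpow_mul hR n)
  have f1 := half_le_floor (one_le_two_rpow_mul hr0 n)
  have q0 : (0 : ℝ) < (2 : ℝ) ^ (n * R) := by positivity
  have q1 : (0 : ℝ) < (2 : ℝ) ^ (n * r) := by positivity
  have p1 : 1 / 4 * ((2 : ℝ) ^ (n * R) * (2 : ℝ) ^ (n * r))
      ≤ (⌊(2 : ℝ) ^ (n * R)⌋₊ : ℝ) * ⌊(2 : ℝ) ^ (n * r)⌋₊ := by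
    have := mul_le_mul f0 f1 (by positivity) (Nat.cast_nonneg _)
    linarith
  have hcard : 1 / 4 * (2 : ℝ) ^ (n * (R + r))
      ≤ Fintype.card (Message n R × Fin ⌊(2 : ℝ) ^ (n * r)⌋₊) := by
    rw [Fintype.card_prod, Fintype.card_fin, Fintype.card_fin, Nat.cast_mul, mul_add,
        Real.rpow_add (by norm_num)]
    exact p1
  obtain ⟨cu, cv, hcov⟩ := hn (Message n R × Fin ⌊(2 : ℝ) ^ (n * r)⌋₊) Unit hcard
    (by simpa using hcard)
  rw [law_law, hPS] at hcov
  have hx₁ : expect (law P (fun ω => (ω.1, ω.2, ()))) (fun ω => (d₂ ω.1 ω.2.1 : ℝ)) ≤ D₂ := by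
    rw [expect_law]; exact hD₂
  have hx₂ : expect (law P (fun ω => (ω.1, ω.2, ()))) (fun ω => (d₁ ω.1 a : ℝ)) ≤ D₁ := by
    rw [expect_law, ← expect_law P (fun ω => ω.1) (fun s => (d₁ s a : ℝ)), hPS]; exact hD₁
  let good : (Fin n → S) → Message n R × Fin ⌊(2 : ℝ) ^ ((n : ℝ) * 0)⌋₊
      × Fin ⌊(2 : ℝ) ^ (n * r)⌋₊ → Prop := fun s t =>
    ∑ i, (d₂ (s i) (cu (t.1, t.2.2) i) : ℝ)
        ≤ n * (expect (law P (fun ω => (ω.1, ω.2, ()))) (fun ω => (d₂ ω.1 ω.2.1 : ℝ)) + η) ∧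
      ∑ i, (d₁ (s i) a : ℝ)
        ≤ n * (expect (law P (fun ω => (ω.1, ω.2, ()))) (fun ω => (d₁ ω.1 a : ℝ)) + η)
  have hne : Nonempty (Message n R × Fin ⌊(2 : ℝ) ^ ((n : ℝ) * 0)⌋₊
      × Fin ⌊(2 : ℝ) ^ (n * r)⌋₊) :=
    ⟨⟨0, message_pos hR n⟩, ⟨0, message_pos le_rfl n⟩, ⟨0, message_pos hr0 n⟩⟩
  have hgood : ∀ s, ∃ t, (∃ t', good s t') → good s t := fun s => by
    by_cases h : ∃ t', good s t'
    · exact ⟨h.choose, fun _ => h.choose_spec⟩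
    · exact ⟨hne.some, fun h' => absurd h' h⟩
  choose e he using hgood
  refine ⟨e, fun _ _ => a, fun t => cu (t.1, t.2.2), {s | ¬∃ t, good s t}, ?_, ?_, ?_⟩
  · refine le_trans (prob_mono (iid_mem hPSm).1 ?_) hcov
    intro s hs i j hij
    exact hs ⟨(i.1, hne.some.2.1, i.2), hij⟩
  · intro s hs
    simp only [Set.mem_ofPred_eq, not_not] at hs
    refine (avgDist_le_of_sum_le d₁ (a := fun _ => a) hn1 (he s hs).2).trans (by linarith)
  · intro s hs
    simp only [Set.mem_ofPred_eq, not_not] at hs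
    refine (avgDist_le_of_sum_le d₂ hn1 (he s hs).1).trans (by linarith)

/-- Achievability with constant reconstructions. -/
theorem sepAchievable_of_const [Nonempty X] (hPS : PS ∈ stdSimplex ℝ S)
    (hPYX : ∀ x, PYX x ∈ stdSimplex ℝ Y) (hPZY : ∀ y, PZY y ∈ stdSimplex ℝ Z)
    (hR : 0 ≤ R) (hρ : 0 ≤ ρ) (a : S₁) (b : S₂)
    (hD₁ : expect PS (fun s => (d₁ s a : ℝ)) ≤ D₁)
    (hD₂ : expect PS (fun s => (d₂ s b : ℝ)) ≤ D₂) :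
    SepAchievable (diagLaw PS) PYX PZY d₁ d₂ R D₁ D₂ ρ := by
  intro ε hε
  -- One source letter, no channel use and trivial helper messages, so decoding is never wrong.
  let c : SepCode S S S₁ S₂ X Y Z R 1 0 :=
    { k₁ := 1
      k₂ := 1
      f₁ := fun _ => ⟨0, message_pos hR 1⟩
      f₂₁ := fun _ => (0, 0)
      f₂₂ := fun _ => Fin.elim0
      g₁₁ := fun _ => 0
      g₁₂ := fun _ _ => a
      g₂₁ := fun _ => 0
      g₂₂ := fun _ _ => b }
  have hexp : ∀ f : S → ℝ, ∑ ω, sourceChanLaw PS PYX PZY (fun s => c.f₂₂ (c.f₂₁ s)) ω * f (ω.1 0)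
      = expect PS f := fun f => by
    rw [sum_sourceChanLaw_mul_fst hPYX hPZY _ (fun s => f (s 0))]
    exact sum_pi_prod_mul_apply (p := fun _ : Fin 1 => PS) (fun _ => hPS) 0 f
  refine ⟨1, 0, c, one_pos, by simp; positivity, ?_, ?_, ?_⟩
  · have : {ω : SepCode.Outcome S S Y Z 1 0 | c.f₂₁ ω.2.1 ≠ c.decoded ω} = ∅ := by
      ext ω
      simp [SepCode.decoded, c]
    rw [this]
    simp [prob, hε.le]
  · rw [outcomeLaw_diagLaw, expect_law]
    have : ∀ s : Fin 1 → S, avgDist d₁ s (fun _ => a) = d₁ (s 0) a := fun s => by simp [avgDist]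
    calc _ = expect PS (fun s => (d₁ s a : ℝ)) := by
          rw [← hexp]
          exact Finset.sum_congr rfl fun ω _ => by rw [← this ω.1]; rfl
      _ ≤ _ := by linarith
  · rw [outcomeLaw_diagLaw, expect_law]
    have : ∀ s : Fin 1 → S, avgDist d₂ s (fun _ => b) = d₂ (s 0) b := fun s => by simp [avgDist]
    calc _ = expect PS (fun s => (d₂ s b : ℝ)) := by
          rw [← hexp]
          exact Finset.sum_congr rfl fun ω _ => by rw [← this ω.1]; rfl
      _ ≤ _ := by linarith

end Achievability

/-- Data processing, obtained from submodularity conditioned on g(U). -/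
theorem mutualInfo_comp_le {Ω A B C : Type*} [Fintype Ω] [Fintype A] [Fintype B] [Fintype C]
    {p : Ω → ℝ} (hp : p ∈ stdSimplex ℝ Ω) (U : Ω → A) (g : A → C) (V : Ω → B) :
    mutualInfo p (fun ω => g (U ω)) V ≤ mutualInfo p U V := by
  have h := entropy_submodular hp U V (fun ω => g (U ω))
  have h1 := entropy_eq_of_comp hp (U := fun ω => (U ω, V ω)) (V := fun ω => (U ω, V ω, g (U ω)))
    (fun t => (t.1, t.2, g t.1)) (fun t => (t.1, t.2.1)) (fun _ => rfl) (fun _ => rfl)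
  have h2 := entropy_eq_of_comp hp (U := U) (V := fun ω => (U ω, g (U ω)))
    (fun t => (t, g t)) Prod.fst (fun _ => rfl) (fun _ => rfl)
  have h3 := entropy_eq_of_comp hp (U := fun ω => (g (U ω), V ω)) (V := fun ω => (V ω, g (U ω)))
    Prod.swap Prod.swap (fun _ => rfl) (fun _ => rfl)
  unfold mutualInfo
  linarith

/-! ### Perturbation to strict inequalities and the direct part -/

section Perturbation

variable {S V A : Type*} [Fintype S] [Fintype V] [Fintype A] {P : S × V → ℝ} {θ : ℝ}

/-- Replace the reconstruction by the constant `v` with probability `θ`. -/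
def perturb (θ : ℝ) (P : S × V → ℝ) (v : V) : S × V → ℝ :=
  fun ω => ∑ t : Bool, (bif t then θ else 1 - θ) *
    (bif t then law P (fun ω => (ω.1, v)) else P) ω

theorem weights_mem (h0 : 0 ≤ θ) (h1 : θ ≤ 1) :
    (fun t : Bool => bif t then θ else 1 - θ) ∈ stdSimplex ℝ Bool :=
  ⟨fun t => by cases t <;> simp [h0, h1], by simp⟩

theorem components_mem (hP : P ∈ stdSimplex ℝ (S × V)) (v : V) (t : Bool) :
    (bif t then law P (fun ω => (ω.1, v)) else P) ∈ stdSimplex ℝ (S × V) := by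
  cases t
  · exact hP
  · exact law_mem_stdSimplex hP _

theorem perturb_mem (hP : P ∈ stdSimplex ℝ (S × V)) (h0 : 0 ≤ θ) (h1 : θ ≤ 1) (v : V) :
    perturb θ P v ∈ stdSimplex ℝ (S × V) :=
  mixture_mem (weights_mem h0 h1) (components_mem hP v)

theorem law_perturb (v : V) : law (perturb θ P v) (fun ω => ω.1) = law P (fun ω => ω.1) := by
  funext s
  unfold perturb
  rw [law_mixture]
  simp only [Fintype.sum_bool, cond_true, cond_false, law_law]
  ring

theorem expect_perturb_le (hP : P ∈ stdSimplex ℝ (S × V)) (h0 : 0 ≤ θ) (v : V)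
    (f : S × V → ℝ) (hf : ∀ ω, 0 ≤ f ω) {δ : ℝ} (hδ : ∀ ω, f ω ≤ δ) :
    expect (perturb θ P v) f ≤ expect P f + θ * δ := by
  unfold perturb
  rw [expect_mixture]
  simp only [Fintype.sum_bool, cond_true, cond_false, expect_law]
  have hE : 0 ≤ expect P f := Finset.sum_nonneg fun ω _ => mul_nonneg (hP.1 ω) (hf ω)
  have h : expect P (fun ω => f (ω.1, v)) ≤ δ := by
    calc _ ≤ ∑ ω, P ω * δ := Finset.sum_le_sum fun ω _ => mul_le_mul_of_nonneg_left (hδ _) (hP.1 ω)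
      _ = δ := by rw [← Finset.sum_mul, hP.2, one_mul]
  nlinarith [mul_le_mul_of_nonneg_left h h0]

/-- The source marginal is the same in both components, so mutual information is convex along the
mixture, and the constant component carries none. -/
theorem mutualInfo_perturb_le (hP : P ∈ stdSimplex ℝ (S × V)) (h0 : 0 ≤ θ) (h1 : θ ≤ 1) (v : V)
    (g : V → A) :
    mutualInfo (perturb θ P v) (fun ω => g ω.2) (fun ω => ω.1)
      ≤ (1 - θ) * mutualInfo P (fun ω => g ω.2) (fun ω => ω.1) := by
  have h := mutualInfo_mixture_le (weights_mem h0 h1) (components_mem hP v) (fun ω => g ω.2)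
    (fun ω => ω.1) (μ := law P (fun ω => ω.1)) (fun t => by cases t <;> simp [law_law])
  refine h.trans (le_of_eq ?_)
  simp only [Fintype.sum_bool, cond_true, cond_false, mutualInfo_law]
  have : mutualInfo P (fun _ => g v) (fun ω => ω.1) = 0 := by
    unfold mutualInfo
    rw [entropy_const hP, entropy_eq_of_comp hP (U := fun ω => ω.1) (V := fun ω => (g v, ω.1))
      (fun t => (g v, t)) Prod.snd (fun _ => rfl) (fun _ => rfl)]
    ring
  rw [this]
  ring

theorem mutualInfo_perturb_lt (hP : P ∈ stdSimplex ℝ (S × V)) (h0 : 0 < θ) (h1 : θ ≤ 1) (v : V)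
    (g : V → A) {M : ℝ} (hM : 0 < M) (h : mutualInfo P (fun ω => g ω.2) (fun ω => ω.1) ≤ M) :
    mutualInfo (perturb θ P v) (fun ω => g ω.2) (fun ω => ω.1) < M := by
  refine (mutualInfo_perturb_le hP h0.le h1 v g).trans_lt ?_
  have h3 : (1 - θ) * mutualInfo P (fun ω => g ω.2) (fun ω => ω.1) ≤ (1 - θ) * M :=
    mul_le_mul_of_nonneg_left h (by linarith)
  nlinarith

end Perturbation

section Achievability

variable {S S₁ S₂ X Y Z : Type*} [Fintype S] [Fintype S₁] [Fintype S₂] [Fintype X]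
  [Fintype Y] [Fintype Z] {PS : S → ℝ} {PYX : X → Y → ℝ} {PZY : Y → Z → ℝ}
  {d₁ : S → S₁ → ℝ≥0} {d₂ : S → S₂ → ℝ≥0} {R D₁ D₂ ρ : ℝ}

theorem exists_perturbation_weight {ε δ : ℝ} (hε : 0 < ε) (hδ : 0 ≤ δ) :
    ∃ θ : ℝ, 0 < θ ∧ θ ≤ 1 ∧ θ * δ ≤ ε := by
  refine ⟨min 1 (ε / (δ + 1)), by positivity, min_le_left _ _, ?_⟩
  calc _ ≤ ε / (δ + 1) * δ := mul_le_mul_of_nonneg_right (min_le_right _ _) hδ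
    _ ≤ ε := by
      rw [div_mul_eq_mul_div, div_le_iff₀ (by linarith)]
      nlinarith

/-- The direct part of the coding theorem. -/
theorem sepAchievable_of_le [Nonempty X] {W : Type*} [Fintype W]
    {PW : W → ℝ} {PXW : W → X → ℝ} {P : S × S₁ × S₂ → ℝ}
    (hP : P ∈ stdSimplex ℝ (S × S₁ × S₂)) (hPW : PW ∈ stdSimplex ℝ W)
    (hPXW : ∀ w, PXW w ∈ stdSimplex ℝ X)
    (hPYX : ∀ x, PYX x ∈ stdSimplex ℝ Y) (hPZY : ∀ y, PZY y ∈ stdSimplex ℝ Z)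
    (hR : 0 ≤ R) (hρ : 0 ≤ ρ) (hPS : law P (fun ω => ω.1) = PS)
    (hD₁ : expect P (fun ω => (d₁ ω.1 ω.2.1 : ℝ)) ≤ D₁)
    (hD₂ : expect P (fun ω => (d₂ ω.1 ω.2.2 : ℝ)) ≤ D₂)
    (h₁ : mutualInfo P (fun ω => ω.2.1) (fun ω => ω.1)
      ≤ R + ρ * mutualInfo (chanLaw PW PXW PYX PZY) (fun ω => ω.1) (fun ω => ω.2.2.2))
    (h₂ : mutualInfo P (fun ω => (ω.2.1, ω.2.2)) (fun ω => ω.1)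
      ≤ R + ρ * mutualInfo (chanLaw PW PXW PYX PZY) (fun ω => ω.1) (fun ω => ω.2.2.2)
        + ρ * condMutualInfo (chanLaw PW PXW PYX PZY)
              (fun ω => ω.2.1) (fun ω => ω.2.2.1) (fun ω => ω.1)) :
    SepAchievable (diagLaw PS) PYX PZY d₁ d₂ R D₁ D₂ ρ := by
  have hJ := chanLaw_mem hPW hPXW hPYX hPZY
  set I₁ := ρ * mutualInfo (chanLaw PW PXW PYX PZY) (fun ω => ω.1) (fun ω => ω.2.2.2) with hI₁
  set I₂ := ρ * condMutualInfo (chanLaw PW PXW PYX PZY)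
              (fun ω => ω.2.1) (fun ω => ω.2.2.1) (fun ω => ω.1) with hI₂
  have hI₁0 : 0 ≤ I₁ := mul_nonneg hρ (mutualInfo_nonneg hJ _ _)
  have hI₂0 : 0 ≤ I₂ := mul_nonneg hρ (condMutualInfo_nonneg hJ _ _ _)
  obtain ⟨δ₁, hδ₁0, hδ₁⟩ := exists_distortion_bound d₁
  obtain ⟨δ₂, hδ₂0, hδ₂⟩ := exists_distortion_bound d₂
  have hδ0 : 0 ≤ max δ₁ δ₂ := hδ₁0.trans (le_max_left _ _)
  obtain ⟨v, -⟩ := exists_le_of_expect_le hP (fun _ => 0) (t := 0) (by simp)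
  have hPSm : PS ∈ stdSimplex ℝ S := by rw [← hPS]; exact law_mem_stdSimplex hP _
  -- If R + I₁ is positive, one perturbation makes both constraints strict. If it is zero, the first
  -- constraint cannot be strict, but then Ŝ₁ is independent of S and a constant does as well.
  rcases (add_nonneg hR hI₁0).eq_or_lt with hM | hM
  swap
  · refine sepAchievable_of_forall_add fun ε hε => ?_
    obtain ⟨θ, hθ0, hθ1, hθ⟩ := exists_perturbation_weight hε hδ0
    refine sepAchievable_of_lt (P := perturb θ P v.2) (perturb_mem hP hθ0.le hθ1 _) hPW hPXW
      hPYX hPZY hR hρ ((law_perturb _).trans hPS) ?_ ?_ ?_ ?_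
    · have := expect_perturb_le hP hθ0.le v.2 (fun ω => (d₁ ω.1 ω.2.1 : ℝ))
        (fun _ => NNReal.coe_nonneg _) (fun ω => (hδ₁ _ _).trans (le_max_left δ₁ δ₂))
      linarith
    · have := expect_perturb_le hP hθ0.le v.2 (fun ω => (d₂ ω.1 ω.2.2 : ℝ))
        (fun _ => NNReal.coe_nonneg _) (fun ω => (hδ₂ _ _).trans (le_max_right δ₁ δ₂))
      linarith
    · exact mutualInfo_perturb_lt hP hθ0 hθ1 v.2 (fun t => t.1) hM h₁
    · exact mutualInfo_perturb_lt hP hθ0 hθ1 v.2 (fun t => (t.1, t.2)) (by linarith) h₂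
  obtain ⟨a, ha⟩ := exists_expect_le_of_mutualInfo_le_zero hP (fun ω => ω.2.1) (fun ω => ω.1)
    (h₁.trans hM.ge) (fun s a => (d₁ s a : ℝ)) hD₁
  rw [← expect_law P (fun ω => ω.1) (fun s => (d₁ s a : ℝ)), hPS] at ha
  have h₃ : mutualInfo P (fun ω => ω.2.2) (fun ω => ω.1) ≤ I₂ := by
    have := mutualInfo_comp_le hP (fun ω => (ω.2.1, ω.2.2)) Prod.snd (fun ω => ω.1)
    linarith
  -- The same dichotomy for the strong receiver, whose constraint is now I(Ŝ₂;S) ≤ I₂.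
  rcases hI₂0.eq_or_lt with hM₂ | hM₂
  · obtain ⟨b, hb⟩ := exists_expect_le_of_mutualInfo_le_zero hP (fun ω => ω.2.2) (fun ω => ω.1)
      (h₃.trans hM₂.ge) (fun s b => (d₂ s b : ℝ)) hD₂
    rw [← expect_law P (fun ω => ω.1) (fun s => (d₂ s b : ℝ)), hPS] at hb
    exact sepAchievable_of_const hPSm hPYX hPZY hR hρ a b ha hb
  · refine sepAchievable_of_forall_add fun ε hε => ?_
    obtain ⟨θ, hθ0, hθ1, hθ⟩ := exists_perturbation_weight hε hδ0
    have hP₂ : law P (fun ω => (ω.1, ω.2.2)) ∈ stdSimplex ℝ (S × S₂) := law_mem_stdSimplex hP _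
    refine sepAchievable_of_const_of_lt (P := perturb θ (law P (fun ω => (ω.1, ω.2.2))) v.2.2)
      (perturb_mem hP₂ hθ0.le hθ1 _) hPW hPXW
      hPYX hPZY hR hρ (by rw [law_perturb, law_law]; exact hPS) a (by linarith) ?_ ?_
    · have := expect_perturb_le hP₂ hθ0.le v.2.2 (fun ω => (d₂ ω.1 ω.2 : ℝ))
        (fun _ => NNReal.coe_nonneg _) (fun ω => (hδ₂ _ _).trans (le_max_right δ₁ δ₂))
      rw [expect_law] at this
      linarith
    · exact mutualInfo_perturb_lt hP₂ hθ0 hθ1 v.2.2 (fun t => t) (by linarith)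
        (by rw [mutualInfo_law]; exact h₃.trans (by linarith))

end Achievability

/-! ### Compactness of convex hulls and continuity of entropy -/

section ConvexHull

/-- In finite dimension the convex hull of a compact set is compact. -/
theorem isCompact_convexHull {E : Type*} [NormedAddCommGroup E] [NormedSpace ℝ E]
    [FiniteDimensional ℝ E] {s : Set E} (hs : IsCompact s) : IsCompact (convexHull ℝ s) := by
  rcases s.eq_empty_or_nonempty with rfl | ⟨x₀, hx₀⟩
  · simp
  set N := Module.finrank ℝ E + 1
  -- By Carathéodory, dim + 1 points suffice, so the hull is a continuous image of a compact set.
  have hc : IsCompact ((fun t : (Fin N → ℝ) × (Fin N → E) => ∑ i, t.1 i • t.2 i) ''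
      (stdSimplex ℝ (Fin N) ×ˢ Set.pi Set.univ fun _ => s)) :=
    ((isCompact_stdSimplex ℝ (Fin N)).prod (isCompact_univ_pi fun _ => hs)).image (by fun_prop)
  convert hc using 1
  ext x
  constructor
  · intro hx
    obtain ⟨ι, hι, z, w, hz, haff, hw0, hw1, rfl⟩ := eq_pos_convex_span_of_mem_convexHull hx
    have hcard : Fintype.card ι ≤ Fintype.card (Fin N) := by
      rw [Fintype.card_fin]
      exact haff.card_le_finrank_succ.trans (Nat.succ_le_succ (Submodule.finrank_le _))
    obtain ⟨e⟩ := Function.Embedding.nonempty_of_card_le hcard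
    -- Shorter combinations are padded with weight 0 at the point x₀.
    refine ⟨(Function.extend e w 0, Function.extend e z fun _ => x₀),
      ⟨⟨fun i => ?_, ?_⟩, fun i _ => ?_⟩, ?_⟩
    · by_cases h : ∃ j, e j = i
      · obtain ⟨j, rfl⟩ := h
        dsimp only
        rw [e.injective.extend_apply]
        exact (hw0 j).le
      · dsimp only
        rw [Function.extend_apply' _ _ _ h]
        exact le_rfl
    · rw [← hw1]
      refine (Fintype.sum_of_injective e e.injective w _ (fun i h => ?_) fun i => ?_).symm
      · exact Function.extend_apply' _ _ _ h
      · exact (e.injective.extend_apply _ _ _).symm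
    · by_cases h : ∃ j, e j = i
      · obtain ⟨j, rfl⟩ := h
        dsimp only
        rw [e.injective.extend_apply]
        exact hz ⟨j, rfl⟩
      · dsimp only
        rw [Function.extend_apply' _ _ _ h]
        exact hx₀
    · refine (Fintype.sum_of_injective e e.injective (fun i => w i • z i) _
        (fun i h => ?_) fun i => ?_).symm
      · dsimp only
        rw [Function.extend_apply' _ _ _ h]
        simp
      · dsimp only
        rw [e.injective.extend_apply, e.injective.extend_apply]
  · rintro ⟨⟨w, z⟩, ⟨hw, hz⟩, rfl⟩
    exact (convex_convexHull ℝ s).sum_mem (fun i _ => hw.1 i) hw.2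
      fun i _ => subset_convexHull ℝ s (hz i (Set.mem_univ i))

end ConvexHull

section PmfEntropy

variable {T A B : Type*} [Fintype T] [Fintype A] [Fintype B]

theorem pmfEntropy_eq_sum_negMulLog (q : A → ℝ) :
    pmfEntropy q = (∑ a, Real.negMulLog (q a)) / Real.log 2 := by
  rw [pmfEntropy, Finset.sum_div, ← Finset.sum_neg_distrib]
  refine Finset.sum_congr rfl fun a _ => ?_
  rw [Real.negMulLog, Real.logb]
  ring

theorem continuous_pmfEntropy : Continuous (pmfEntropy : (A → ℝ) → ℝ) := by
  rw [show (pmfEntropy : (A → ℝ) → ℝ) = fun q => (∑ a, Real.negMulLog (q a)) / Real.log 2 from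
    funext pmfEntropy_eq_sum_negMulLog]
  refine Continuous.div_const (continuous_finsetSum _ fun a _ => ?_) _
  exact Real.continuous_negMulLog.comp (continuous_apply a)

theorem pmfEntropy_eq_entropy (q : A → ℝ) : pmfEntropy q = entropy q fun a => a := by
  rw [entropy_eq_pmfEntropy, law_id]

/-- Concavity of entropy is subadditivity H(T,A) ≤ H(T) + H(A) for a time-sharing variable T. -/
theorem sum_mul_pmfEntropy_le {w : T → ℝ} (hw : w ∈ stdSimplex ℝ T) {q : T → A → ℝ}
    (hq : ∀ t, q t ∈ stdSimplex ℝ A) :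
    ∑ t, w t * pmfEntropy (q t) ≤ pmfEntropy fun a => ∑ t, w t * q t a := by
  have h1 := entropy_timeShare_pair (w := w) hq (fun a => a)
  have h2 := entropy_pair_le (timeShare_mem hw hq) (fun t => t.1) (fun t => t.2)
  rw [← law_timeShare_snd, ← entropy_eq_pmfEntropy]
  simp_rw [pmfEntropy_eq_entropy]
  linarith

/-- The chain rule for the input and the output of a channel. -/
theorem pmfEntropy_prod (q : A → ℝ) (k : A → B → ℝ) (hk : ∀ a, k a ∈ stdSimplex ℝ B) :
    pmfEntropy (fun t : A × B => q t.1 * k t.1 t.2)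
      = pmfEntropy q + ∑ a, q a * pmfEntropy (k a) := by
  classical
  have hfst : law (fun t : A × B => q t.1 * k t.1 t.2) (fun t => t.1) = q := by
    funext a
    rw [law_eq_sum, Fintype.sum_prod_type_right]
    simp [← Finset.mul_sum, (hk _).2]
  have h := entropy_pair_of_kernel (fun t : A × B => q t.1 * k t.1 t.2) (fun t => t.1)
    (fun t => t.2) k hk (fun a b => by
      rw [hfst]
      exact congrFun (law_id (fun t : A × B => q t.1 * k t.1 t.2)) (a, b))
  have h' := sum_law_mul (fun t : A × B => q t.1 * k t.1 t.2) (fun t => t.1)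
    (fun a => pmfEntropy (k a))
  rw [hfst] at h'
  rw [entropy_eq_pmfEntropy, entropy_eq_pmfEntropy, hfst, ← h'] at h
  rw [← h]
  congr 1
  exact (law_id _).symm

theorem pmfEntropy_pi {ι : Type*} [Fintype ι] [DecidableEq ι] {p : ι → A → ℝ}
    (hp : ∀ i, p i ∈ stdSimplex ℝ A) :
    pmfEntropy (fun φ : ι → A => ∏ i, p i (φ i)) = ∑ i, pmfEntropy (p i) := by
  have h : ∀ φ : ι → A, (∏ i, p i (φ i)) * Real.logb 2 (∏ i, p i (φ i))
      = ∑ i, (∏ i, p i (φ i)) * Real.logb 2 (p i (φ i)) := by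
    intro φ
    by_cases h0 : ∏ i, p i (φ i) = 0
    · simp [h0]
    · rw [Real.logb_prod _ _ fun i _ => Finset.prod_ne_zero_iff.1 h0 i (Finset.mem_univ i),
        Finset.mul_sum]
  rw [pmfEntropy]
  simp_rw [h]
  rw [Finset.sum_comm, ← Finset.sum_neg_distrib]
  refine Finset.sum_congr rfl fun i _ => ?_
  rw [sum_pi_prod_mul_apply hp i (fun a => Real.logb 2 (p i a)), pmfEntropy]

end PmfEntropy

/-! ### The compact region of auxiliary variables -/

section Region

variable {W X Y Z : Type*} [Fintype W] [Fintype X] [Fintype Y] [Fintype Z]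
  (PYX : X → Y → ℝ) (PZY : Y → Z → ℝ)

/-- The output mass function of a channel. -/
def output {A B : Type*} [Fintype A] (k : A → B → ℝ) (q : A → ℝ) : B → ℝ := fun b => ∑ a, q a * k a b

theorem output_mem {A B : Type*} [Fintype A] [Fintype B] {k : A → B → ℝ} {q : A → ℝ}
    (hk : ∀ a, k a ∈ stdSimplex ℝ B) (hq : q ∈ stdSimplex ℝ A) : output k q ∈ stdSimplex ℝ B := by
  refine ⟨fun b => Finset.sum_nonneg fun a _ => mul_nonneg (hq.1 a) ((hk a).1 b), ?_⟩
  simp only [output]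
  rw [Finset.sum_comm]
  simp only [← Finset.mul_sum, (hk _).2, mul_one, hq.2]

/-- The channel from the input to both outputs. -/
def pairChan : X → Y × Z → ℝ := fun x t => PYX x t.1 * PZY t.1 t.2

/-- An input mass function with the entropies of the two outputs. -/
def entropyPoint (q : X → ℝ) : (X → ℝ) × ℝ × ℝ :=
  (q, pmfEntropy (output PZY (output PYX q)), pmfEntropy (output PYX q))

/-- The set of averages of input mass functions with the entropies of the outputs. -/
def entropyRegion : Set ((X → ℝ) × ℝ × ℝ) :=
  convexHull ℝ (entropyPoint PYX PZY '' stdSimplex ℝ X)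

/-- The rate `I(W;Z)` of the weak receiver. -/
def rateZ (v : (X → ℝ) × ℝ × ℝ) : ℝ := pmfEntropy (output PZY (output PYX v.1)) - v.2.1

/-- The rate `I(X;Y|W)` of the strong receiver. -/
def rateY (v : (X → ℝ) × ℝ × ℝ) : ℝ := v.2.2 - ∑ x, v.1 x * pmfEntropy (PYX x)

theorem continuous_output {A B : Type*} [Fintype A] (k : A → B → ℝ) : Continuous (output k) := by
  unfold output
  fun_prop

theorem isCompact_entropyRegion : IsCompact (entropyRegion PYX PZY) := by
  refine isCompact_convexHull ((isCompact_stdSimplex ℝ X).image ?_)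
  have h1 := continuous_output PYX
  have h2 := continuous_output PZY
  exact continuous_id.prodMk ((continuous_pmfEntropy.comp (h2.comp h1)).prodMk
    (continuous_pmfEntropy.comp h1))

theorem continuous_rateZ : Continuous (rateZ PYX PZY) := by
  have h1 := continuous_output PYX
  have h2 := continuous_output PZY
  exact (continuous_pmfEntropy.comp (h2.comp (h1.comp continuous_fst))).sub (by fun_prop)

theorem continuous_rateY : Continuous (rateY (Y := Y) PYX) := by
  unfold rateY
  fun_prop

variable {PYX PZY} {PW : W → ℝ} {PXW : W → X → ℝ}

theorem pairChan_mem (hPYX : ∀ x, PYX x ∈ stdSimplex ℝ Y) (hPZY : ∀ y, PZY y ∈ stdSimplex ℝ Z)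
    (x : X) : pairChan PYX PZY x ∈ stdSimplex ℝ (Y × Z) := by
  refine ⟨fun t => mul_nonneg ((hPYX _).1 _) ((hPZY _).1 _), ?_⟩
  rw [Fintype.sum_prod_type]
  simp only [pairChan, ← Finset.mul_sum, (hPZY _).2, (hPYX _).2, mul_one]

/-- The point of the region that belongs to an auxiliary random variable. -/
def auxPoint (PYX : X → Y → ℝ) (PZY : Y → Z → ℝ) (PW : W → ℝ) (PXW : W → X → ℝ) :
    (X → ℝ) × ℝ × ℝ := ∑ w, PW w • entropyPoint PYX PZY (PXW w)

theorem auxPoint_mem (hPW : PW ∈ stdSimplex ℝ W) (hPXW : ∀ w, PXW w ∈ stdSimplex ℝ X) :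
    auxPoint PYX PZY PW PXW ∈ entropyRegion PYX PZY :=
  (convex_convexHull ℝ _).sum_mem (fun w _ => hPW.1 w) hPW.2
    fun w _ => subset_convexHull ℝ _ ⟨_, hPXW w, rfl⟩

theorem auxPoint_fst : (auxPoint PYX PZY PW PXW).1 = output PXW PW := by
  funext x
  simp [auxPoint, Prod.fst_sum, entropyPoint, output]

theorem auxPoint_snd_fst : (auxPoint PYX PZY PW PXW).2.1
    = ∑ w, PW w * pmfEntropy (output PZY (output PYX (PXW w))) := by
  simp [auxPoint, Prod.snd_sum, Prod.fst_sum, entropyPoint]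

theorem auxPoint_snd_snd : (auxPoint PYX PZY PW PXW).2.2
    = ∑ w, PW w * pmfEntropy (output PYX (PXW w)) := by
  simp [auxPoint, Prod.snd_sum, entropyPoint]

/-- A convex combination is read as an auxiliary variable: its weights are P_W and its points give
the rows of P_{X|W}. This recovers a finite W from a limit point. -/
theorem exists_auxPoint {v : (X → ℝ) × ℝ × ℝ} (hv : v ∈ entropyRegion PYX PZY) :
    ∃ (k : ℕ), ∃ PW ∈ stdSimplex ℝ (Fin k), ∃ PXW : Fin k → X → ℝ,
      (∀ w, PXW w ∈ stdSimplex ℝ X) ∧ v = auxPoint PYX PZY PW PXW := by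
  rw [entropyRegion, mem_convexHull_iff_exists_fintype] at hv
  obtain ⟨ι, hι, w, z, hw0, hw1, hz, rfl⟩ := hv
  choose q hq hqz using hz
  let e := (Fintype.equivFin ι).symm
  refine ⟨Fintype.card ι, fun i => w (e i), ⟨fun i => hw0 _, ?_⟩, fun i => q (e i),
    fun i => hq _, ?_⟩
  · rw [e.sum_comp w, hw1]
  · simp only [auxPoint, hqz]
    rw [e.sum_comp (fun i => w i • z i)]

section Rates

variable (hPW : PW ∈ stdSimplex ℝ W) (hPXW : ∀ w, PXW w ∈ stdSimplex ℝ X)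
    (hPYX : ∀ x, PYX x ∈ stdSimplex ℝ Y) (hPZY : ∀ y, PZY y ∈ stdSimplex ℝ Z)
include hPW hPXW hPYX hPZY

theorem sum_chanLaw_mul_W (F : W → ℝ) :
    ∑ ω, chanLaw PW PXW PYX PZY ω * F ω.1 = ∑ w, PW w * F w := by
  rw [← sum_law_mul (chanLaw PW PXW PYX PZY) (fun ω => ω.1) F]
  simp only [law_chanLaw_W hPXW hPYX hPZY]

theorem entropy_chanLaw_WY :
    entropy (chanLaw PW PXW PYX PZY) (fun ω => (ω.1, ω.2.2.1))
      = entropy (chanLaw PW PXW PYX PZY) (fun ω => ω.1)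
        + ∑ w, PW w * pmfEntropy (output PYX (PXW w)) := by
  rw [entropy_pair_of_kernel (chanLaw PW PXW PYX PZY) (fun ω => ω.1) (fun ω => ω.2.2.1) (fun w => output PYX (PXW w))
    (fun w => output_mem hPYX (hPXW w)),
    sum_chanLaw_mul_W hPW hPXW hPYX hPZY (fun w => pmfEntropy (output PYX (PXW w)))]
  intro w y
  rw [law_chanLaw_WY hPZY, law_chanLaw_W hPXW hPYX hPZY, output]

theorem law_chanLaw_WZ (w : W) (z : Z) :
    law (chanLaw PW PXW PYX PZY) (fun ω => (ω.1, ω.2.2.2)) (w, z)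
      = PW w * output PZY (output PYX (PXW w)) z := by
  rw [← sum_law_fst (chanLaw PW PXW PYX PZY) (fun ω => ω.2.2.1) (fun ω => (ω.1, ω.2.2.2)) (w, z),
    output, Finset.mul_sum]
  refine Finset.sum_congr rfl fun y _ => ?_
  rw [← mul_assoc, output, ← law_chanLaw_WY hPZY, ← law_chanLaw_WYZ hPZY]
  unfold law
  congr 1
  ext ω
  simp only [Set.mem_ofPred_eq, Prod.mk.injEq]
  tauto

theorem entropy_chanLaw_WZ :
    entropy (chanLaw PW PXW PYX PZY) (fun ω => (ω.1, ω.2.2.2))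
      = entropy (chanLaw PW PXW PYX PZY) (fun ω => ω.1)
        + ∑ w, PW w * pmfEntropy (output PZY (output PYX (PXW w))) := by
  rw [entropy_pair_of_kernel (chanLaw PW PXW PYX PZY) (fun ω => ω.1) (fun ω => ω.2.2.2)
    (fun w => output PZY (output PYX (PXW w)))
    (fun w => output_mem hPZY (output_mem hPYX (hPXW w))),
    sum_chanLaw_mul_W hPW hPXW hPYX hPZY (fun w => pmfEntropy (output PZY (output PYX (PXW w))))]
  intro w z
  rw [law_chanLaw_WZ hPW hPXW hPYX hPZY, law_chanLaw_W hPXW hPYX hPZY]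

theorem law_chanLaw_X (x : X) :
    law (chanLaw PW PXW PYX PZY) (fun ω => ω.2.1) x = output PXW PW x := by
  rw [← sum_law_fst (chanLaw PW PXW PYX PZY) (fun ω => ω.1) (fun ω => ω.2.1) x, output]
  exact Finset.sum_congr rfl fun w _ => law_chanLaw_WX hPYX hPZY w x

theorem law_chanLaw_Y (y : Y) :
    law (chanLaw PW PXW PYX PZY) (fun ω => ω.2.2.1) y = output PYX (output PXW PW) y := by
  rw [← sum_law_fst (chanLaw PW PXW PYX PZY) (fun ω => ω.1) (fun ω => ω.2.2.1) y, output]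
  simp only [law_chanLaw_WY hPZY, output, Finset.sum_mul, Finset.mul_sum]
  rw [Finset.sum_comm]
  exact Finset.sum_congr rfl fun x _ => Finset.sum_congr rfl fun w _ => by ring

theorem law_chanLaw_Z (z : Z) :
    law (chanLaw PW PXW PYX PZY) (fun ω => ω.2.2.2) z
      = output PZY (output PYX (output PXW PW)) z := by
  rw [← sum_law_fst (chanLaw PW PXW PYX PZY) (fun ω => (ω.1, ω.2.2.1)) (fun ω => ω.2.2.2) z,
    Fintype.sum_prod_type_right, output]
  refine Finset.sum_congr rfl fun y _ => ?_
  rw [← law_chanLaw_Y hPW hPXW hPYX hPZY,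
    ← sum_law_fst (chanLaw PW PXW PYX PZY) (fun ω => ω.1) (fun ω => ω.2.2.1) y, Finset.sum_mul]
  exact Finset.sum_congr rfl fun w _ => law_chanLaw_WYZ hPZY w y z

theorem sum_output_mul (F : X → ℝ) :
    ∑ ω, chanLaw PW PXW PYX PZY ω * F ω.2.1 = ∑ x, output PXW PW x * F x := by
  rw [← sum_law_mul (chanLaw PW PXW PYX PZY) (fun ω => ω.2.1) F]
  simp only [law_chanLaw_X hPW hPXW hPYX hPZY]

theorem rateZ_auxPoint : rateZ PYX PZY (auxPoint PYX PZY PW PXW)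
    = mutualInfo (chanLaw PW PXW PYX PZY) (fun ω => ω.1) (fun ω => ω.2.2.2) := by
  rw [mutualInfo, entropy_chanLaw_WZ hPW hPXW hPYX hPZY, rateZ, auxPoint_fst, auxPoint_snd_fst,
    entropy_eq_pmfEntropy (chanLaw PW PXW PYX PZY) (fun ω => ω.2.2.2),
    show law (chanLaw PW PXW PYX PZY) (fun ω => ω.2.2.2) = _ from
      funext (law_chanLaw_Z hPW hPXW hPYX hPZY)]
  ring

theorem rateY_auxPoint : rateY PYX (auxPoint PYX PZY PW PXW)
    = condMutualInfo (chanLaw PW PXW PYX PZY) (fun ω => ω.2.1) (fun ω => ω.2.2.1)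
        (fun ω => ω.1) := by
  have hJ := chanLaw_mem hPW hPXW hPYX hPZY
  have e1 := entropy_eq_of_comp hJ (U := fun ω => (ω.1, ω.2.1)) (V := fun ω => (ω.2.1, ω.1))
    Prod.swap Prod.swap (fun _ => rfl) (fun _ => rfl)
  have e2 := entropy_eq_of_comp hJ (U := fun ω => (ω.1, ω.2.2.1)) (V := fun ω => (ω.2.2.1, ω.1))
    Prod.swap Prod.swap (fun _ => rfl) (fun _ => rfl)
  have e3 := entropy_eq_of_comp hJ (U := fun ω => ((ω.1, ω.2.1), ω.2.2.1))
    (V := fun ω => (ω.2.1, ω.2.2.1, ω.1)) (fun t => (t.1.2, t.2, t.1.1))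
    (fun t => ((t.2.2, t.1), t.2.1)) (fun _ => rfl) (fun _ => rfl)
  have e4 := entropy_pair_of_kernel (chanLaw PW PXW PYX PZY) (fun ω => (ω.1, ω.2.1))
    (fun ω => ω.2.2.1) (fun t => PYX t.2) (fun t => hPYX t.2) (fun t y => by
      rw [law_chanLaw_WX hPYX hPZY, ← law_chanLaw_WXY hPZY]
      unfold law
      congr 1
      ext ω
      simp only [Set.mem_ofPred_eq, Prod.ext_iff]
      tauto)
  rw [condMutualInfo, e1, e2, e3, e4, entropy_chanLaw_WY hPW hPXW hPYX hPZY, rateY,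
    auxPoint_fst, auxPoint_snd_snd, sum_output_mul hPW hPXW hPYX hPZY (fun x => pmfEntropy (PYX x))]
  ring

/-- I(X;Y|W) equals H(Y,Z|W) - H(Y,Z|X): by degradedness the same H(Z|Y) is added to both terms. The
converse works with the pair of outputs and needs this form. -/
theorem rateY_auxPoint_eq_sub : rateY PYX (auxPoint PYX PZY PW PXW)
    = entropy (chanLaw PW PXW PYX PZY) (fun ω => (ω.1, ω.2.2))
      - entropy (chanLaw PW PXW PYX PZY) (fun ω => ω.1)
      - ∑ ω, chanLaw PW PXW PYX PZY ω * pmfEntropy (pairChan PYX PZY ω.2.1) := by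
  have hJ := chanLaw_mem hPW hPXW hPYX hPZY
  have e1 := entropy_eq_of_comp hJ (U := fun ω => ((ω.1, ω.2.2.1), ω.2.2.2))
    (V := fun ω => (ω.1, ω.2.2)) (fun t => (t.1.1, t.1.2, t.2))
    (fun t => ((t.1, t.2.1), t.2.2)) (fun _ => rfl) (fun _ => rfl)
  have e2 := entropy_pair_of_kernel (chanLaw PW PXW PYX PZY) (fun ω => (ω.1, ω.2.2.1))
    (fun ω => ω.2.2.2) (fun t => PZY t.2) (fun t => hPZY t.2)
    (fun t z => law_chanLaw_WYZ hPZY t.1 t.2 z)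
  have e3 : ∑ ω, chanLaw PW PXW PYX PZY ω * pmfEntropy (pairChan PYX PZY ω.2.1)
      = ∑ x, output PXW PW x * pmfEntropy (PYX x)
        + ∑ ω, chanLaw PW PXW PYX PZY ω * pmfEntropy (PZY ω.2.2.1) := by
    rw [sum_output_mul hPW hPXW hPYX hPZY (fun x => pmfEntropy (pairChan PYX PZY x)),
      ← sum_law_mul (chanLaw PW PXW PYX PZY) (fun ω => ω.2.2.1) (fun y => pmfEntropy (PZY y))]
    simp only [law_chanLaw_Y hPW hPXW hPYX hPZY]
    have : ∀ x, pmfEntropy (pairChan PYX PZY x)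
        = pmfEntropy (PYX x) + ∑ y, PYX x y * pmfEntropy (PZY y) := fun x =>
      pmfEntropy_prod (PYX x) PZY hPZY
    generalize output PXW PW = q
    simp only [this, mul_add, Finset.sum_add_distrib, output, Finset.sum_mul, Finset.mul_sum,
      mul_assoc]
    rw [Finset.sum_comm (s := (Finset.univ : Finset X)) (t := (Finset.univ : Finset Y))]
  rw [e1, e2, e3, entropy_chanLaw_WY hPW hPXW hPYX hPZY, rateY, auxPoint_fst, auxPoint_snd_snd]
  ring

end Rates

variable (hPYX : ∀ x, PYX x ∈ stdSimplex ℝ Y) (hPZY : ∀ y, PZY y ∈ stdSimplex ℝ Z)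
include hPYX hPZY

theorem rateZ_nonneg {v : (X → ℝ) × ℝ × ℝ} (hv : v ∈ entropyRegion PYX PZY) :
    0 ≤ rateZ PYX PZY v := by
  obtain ⟨k, PW, hPW, PXW, hPXW, rfl⟩ := exists_auxPoint hv
  rw [rateZ_auxPoint hPW hPXW hPYX hPZY]
  exact mutualInfo_nonneg (chanLaw_mem hPW hPXW hPYX hPZY) _ _

theorem rateY_nonneg {v : (X → ℝ) × ℝ × ℝ} (hv : v ∈ entropyRegion PYX PZY) :
    0 ≤ rateY PYX v := by
  obtain ⟨k, PW, hPW, PXW, hPXW, rfl⟩ := exists_auxPoint hv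
  rw [rateY_auxPoint hPW hPXW hPYX hPZY]
  exact condMutualInfo_nonneg (chanLaw_mem hPW hPXW hPYX hPZY) _ _ _

theorem fst_mem_of_mem_entropyRegion {v : (X → ℝ) × ℝ × ℝ} (hv : v ∈ entropyRegion PYX PZY) :
    v.1 ∈ stdSimplex ℝ X := by
  obtain ⟨k, PW, hPW, PXW, hPXW, rfl⟩ := exists_auxPoint hv
  rw [auxPoint_fst]
  exact output_mem hPXW hPW

/-- Averaging points of the region does not decrease the sum of the rates. -/
theorem exists_average [Nonempty X] {l : ℕ} (v : Fin l → (X → ℝ) × ℝ × ℝ)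
    (hv : ∀ i, v i ∈ entropyRegion PYX PZY) :
    ∃ u ∈ entropyRegion PYX PZY, ∑ i, rateZ PYX PZY (v i) ≤ l * rateZ PYX PZY u ∧
      ∑ i, rateY PYX (v i) ≤ l * rateY PYX u := by
  classical
  -- Without channel uses both sums are empty and any point of the region will do.
  rcases Nat.eq_zero_or_pos l with rfl | hl
  · refine ⟨entropyPoint PYX PZY (Pi.single (Classical.arbitrary X) 1),
      subset_convexHull ℝ _ ⟨_, single_mem_stdSimplex ℝ _, rfl⟩, by simp, by simp⟩
  have hl0 : (l : ℝ) ≠ 0 := by exact_mod_cast hl.ne'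
  have hw : (fun _ : Fin l => (l : ℝ)⁻¹) ∈ stdSimplex ℝ (Fin l) :=
    ⟨fun _ => by positivity, by simp [hl0]⟩
  refine ⟨∑ i, (l : ℝ)⁻¹ • v i, (convex_convexHull ℝ _).sum_mem (fun i _ => hw.1 i) hw.2
    fun i _ => hv i, ?_, le_of_eq ?_⟩
  · have h := sum_mul_pmfEntropy_le hw (q := fun i => output PZY (output PYX (v i).1))
      (fun i => output_mem hPZY (output_mem hPYX (fst_mem_of_mem_entropyRegion hPYX hPZY (hv i))))
    have e : (fun z => ∑ i, (l : ℝ)⁻¹ * output PZY (output PYX (v i).1) z)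
        = output PZY (output PYX (∑ i, (l : ℝ)⁻¹ • v i).1) := by
      funext z
      simp only [output, Prod.fst_sum, Finset.sum_apply, Prod.smul_fst, Pi.smul_apply, smul_eq_mul,
        Finset.sum_mul, Finset.mul_sum]
      rw [Finset.sum_comm]
      refine Finset.sum_congr rfl fun y _ => ?_
      rw [Finset.sum_comm]
      exact Finset.sum_congr rfl fun x _ => Finset.sum_congr rfl fun i _ => by ring
    rw [e, ← Finset.mul_sum, inv_mul_le_iff₀ (by positivity)] at h
    simp only [rateZ, Finset.sum_sub_distrib, Prod.snd_sum, Prod.fst_sum, Prod.smul_snd,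
      Prod.smul_fst, smul_eq_mul] at h ⊢
    rw [mul_sub, ← Finset.mul_sum, mul_inv_cancel_left₀ hl0]
    linarith
  · simp only [rateY, Finset.sum_sub_distrib, Prod.snd_sum, Prod.fst_sum, Prod.smul_snd,
      Prod.smul_fst, smul_eq_mul, Finset.sum_apply, Pi.smul_apply, Finset.sum_mul]
    rw [mul_sub, ← Finset.mul_sum, mul_inv_cancel_left₀ hl0]
    congr 1
    rw [Finset.sum_comm, Finset.mul_sum]
    refine Finset.sum_congr rfl fun x _ => ?_
    rw [Finset.mul_sum]
    refine Finset.sum_congr rfl fun i _ => ?_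
    field_simp

end Region

/-! ### Chain rule and memoryless outputs -/

section ChainRule

variable {Ω A B C T : Type*} [Fintype Ω] [Fintype A] [Fintype B] [Fintype C] [Fintype T]
  {p : Ω → ℝ}

theorem condEntropy_le_comp (hp : p ∈ stdSimplex ℝ Ω) (W : Ω → A) (Z : Ω → B) (g : A → C) :
    entropy p (fun ω => (W ω, Z ω)) - entropy p W
      ≤ entropy p (fun ω => (g (W ω), Z ω)) - entropy p (fun ω => g (W ω)) := by
  have h := entropy_submodular hp W Z (fun ω => g (W ω))
  have e1 := entropy_eq_of_comp hp (U := fun ω => (W ω, Z ω)) (V := fun ω => (W ω, Z ω, g (W ω)))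
    (fun t => (t.1, t.2, g t.1)) (fun t => (t.1, t.2.1)) (fun _ => rfl) (fun _ => rfl)
  have e2 := entropy_eq_of_comp hp (U := W) (V := fun ω => (W ω, g (W ω)))
    (fun t => (t, g t)) (fun t => t.1) (fun _ => rfl) (fun _ => rfl)
  have e3 := entropy_eq_of_comp hp (U := fun ω => (g (W ω), Z ω)) (V := fun ω => (Z ω, g (W ω)))
    Prod.swap Prod.swap (fun _ => rfl) (fun _ => rfl)
  linarith

/-- The first `i` letters of a sequence. -/
def initial {l : ℕ} (i : ℕ) (t : Fin l → T) : Fin l → Option T :=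
  fun j => if (j : ℕ) < i then some (t j) else none

theorem initial_update {l : ℕ} (i : Fin l) (t : Fin l → T) (a : T) :
    initial (i : ℕ) (Function.update t i a) = initial (i : ℕ) t := by
  funext j
  unfold initial
  split_ifs with h
  · rw [Function.update_of_ne]
    rintro rfl
    exact lt_irrefl _ h
  · rfl

theorem initial_map {l : ℕ} (i : ℕ) (g : T → A) (t : Fin l → T) :
    initial i (fun j => g (t j)) = fun j => (initial i t j).map g := by
  funext j
  unfold initial
  split_ifs <;> rfl

/-- Telescoping: a prefix of length i together with letter i is equivalent to the prefix of length i
+ 1. Prefixes are padded with `none` so that all have one type. -/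
theorem chain_rule (hp : p ∈ stdSimplex ℝ Ω) {l : ℕ} (b : Ω → B) (t : Ω → Fin l → T) :
    entropy p (fun ω => (b ω, t ω)) = entropy p b + ∑ i : Fin l,
      (entropy p (fun ω => ((b ω, initial (i : ℕ) (t ω)), t ω i))
        - entropy p (fun ω => (b ω, initial (i : ℕ) (t ω)))) := by
  set a : ℕ → ℝ := fun i => entropy p (fun ω => (b ω, initial i (t ω))) with ha
  have h0 : a 0 = entropy p b :=
    entropy_eq_of_comp hp (fun x => (x, fun _ => none)) (fun x => x.1)
      (fun ω => by simp [initial, funext_iff]) (fun _ => rfl)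
  -- Supplies default letters for inverting `some`; the inverse maps never fall back on them at
  -- values that occur.
  obtain ⟨ω₀⟩ : Nonempty Ω := by
    by_contra hΩ
    rw [not_nonempty_iff] at hΩ
    exact absurd hp.2 (by simp)
  have hl : entropy p (fun ω => (b ω, t ω)) = a l :=
    entropy_eq_of_comp hp (fun x => (x.1, fun j => (x.2 j).getD (t ω₀ j)))
      (fun x => (x.1, initial l x.2)) (fun ω => by simp [initial]) (fun _ => rfl)
  have hs : ∀ i : Fin l, entropy p (fun ω => ((b ω, initial (i : ℕ) (t ω)), t ω i))
      = a ((i : ℕ) + 1) := by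
    intro i
    refine entropy_eq_of_comp hp
      (fun x => ((x.1, fun j => if (j : ℕ) < i then x.2 j else none), (x.2 i).getD (t ω₀ i)))
      (fun x => (x.1.1, Function.update x.1.2 i (some x.2))) (fun ω => ?_) (fun ω => ?_)
    · refine Prod.ext (Prod.ext rfl (funext fun j => ?_)) (by simp [initial])
      by_cases h : (j : ℕ) < i
      · simp [initial, h, Nat.lt_succ_of_lt h]
      · simp [initial, h]
    · refine Prod.ext rfl (funext fun j => ?_)
      rcases eq_or_ne j i with rfl | hj
      · simp [initial]
      · have : (j : ℕ) < i + 1 ↔ (j : ℕ) < i := by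
          have := Fin.val_ne_of_ne hj
          omega
        simp [initial, hj, this]
  rw [hl, ← h0]
  simp_rw [hs]
  rw [Fin.sum_univ_eq_sum_range (fun i => a (i + 1) - a i) l, Finset.sum_range_sub]
  ring

theorem entropy_pi_le (hp : p ∈ stdSimplex ℝ Ω) {l : ℕ} (t : Ω → Fin l → T) :
    entropy p t ≤ ∑ i, entropy p (fun ω => t ω i) := by
  have h := chain_rule hp (fun _ => ()) t
  rw [entropy_const hp, zero_add, entropy_eq_of_comp hp (U := t) (fun x => ((), x)) (fun x => x.2)
    (fun _ => rfl) (fun _ => rfl)] at h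
  rw [h]
  refine Finset.sum_le_sum fun i _ => ?_
  linarith [entropy_pair_le hp (fun ω => ((), initial (i : ℕ) (t ω))) (fun ω => t ω i)]

end ChainRule

section Memoryless

variable {ι Q A B X T : Type*} [Fintype ι] [DecidableEq ι] [Fintype Q] [Fintype A] [Fintype B]
  [Fintype T]

/-- Under a product mass function a coordinate is independent of the functions of the others. -/
theorem sum_pi_prod_mul_of_update {p : ι → T → ℝ} (hp : ∀ i, p i ∈ stdSimplex ℝ T) (i : ι)
    (F : (ι → T) → ℝ) (hF : ∀ t a, F (Function.update t i a) = F t) (G : T → ℝ) :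
    ∑ t, (∏ j, p j (t j)) * (F t * G (t i)) = (∑ t, (∏ j, p j (t j)) * F t) * ∑ a, p i a * G a := by
  -- Swaps coordinate i with an independent copy; this preserves the product law and leaves F
  -- unchanged.
  let e : (ι → T) × T → (ι → T) × T := fun x => (Function.update x.1 i x.2, x.1 i)
  have he : Function.Involutive e := by
    intro x
    simp [e]
  have hprod : ∀ (t : ι → T) (a : T), (∏ j, p j (Function.update t i a j)) * p i (t i)
      = (∏ j, p j (t j)) * p i a := by
    intro t a
    rw [← Finset.mul_prod_erase Finset.univ _ (Finset.mem_univ i),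
      ← Finset.mul_prod_erase Finset.univ (fun j => p j (t j)) (Finset.mem_univ i),
      Finset.prod_congr rfl (fun j hj => by
        rw [Function.update_of_ne (Finset.ne_of_mem_erase hj)]), Function.update_self]
    ring
  calc _ = ∑ t, ∑ a, (∏ j, p j (t j)) * (F t * G (t i)) * p i a := by
        simp_rw [← Finset.mul_sum, (hp i).2, mul_one]
    _ = ∑ x : (ι → T) × T, (∏ j, p j (x.1 j)) * (F x.1 * G (x.1 i)) * p i x.2 := by
        rw [Fintype.sum_prod_type]
    _ = ∑ x : (ι → T) × T, (∏ j, p j (x.1 j)) * F x.1 * (p i x.2 * G x.2) := by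
        rw [← Equiv.sum_comp (Function.Involutive.toPerm e he)]
        refine Finset.sum_congr rfl fun x _ => ?_
        simp only [Function.Involutive.coe_toPerm, e, hF, Function.update_self]
        linear_combination F x.1 * G x.2 * hprod x.1 x.2
    _ = _ := by
        rw [Fintype.sum_prod_type, Finset.sum_mul_sum]

/-- The joint mass function of a message with mass function `r` and of the output of a memoryless
channel that is used with the codeword of the message. -/
def codeLaw {l : ℕ} (r : Q → ℝ) (x : Q → Fin l → X) (V : X → T → ℝ) : Q × (Fin l → T) → ℝ :=
  fun ω => r ω.1 * block l V (x ω.1) ω.2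

variable {l : ℕ} {r : Q → ℝ} {x : Q → Fin l → X} {V : X → T → ℝ}

theorem codeLaw_mem (hr : r ∈ stdSimplex ℝ Q) (hV : ∀ x, V x ∈ stdSimplex ℝ T) :
    codeLaw r x V ∈ stdSimplex ℝ (Q × (Fin l → T)) := by
  refine ⟨fun ω => mul_nonneg (hr.1 _) ((block_mem hV _).1 _), ?_⟩
  rw [Fintype.sum_prod_type]
  simp only [codeLaw, ← Finset.mul_sum, (block_mem hV _).2, mul_one, hr.2]

theorem law_codeLaw_fst (hV : ∀ x, V x ∈ stdSimplex ℝ T) (g : Q → A) (a : A) :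
    law (codeLaw r x V) (fun ω => g ω.1) a = law r g a := by
  classical
  rw [law_eq_sum, law_eq_sum, Fintype.sum_prod_type]
  refine Finset.sum_congr rfl fun q _ => ?_
  split_ifs
  · simp only [codeLaw, ← Finset.mul_sum, (block_mem hV _).2, mul_one]
  · simp

/-- A letter of the output depends on the previous letters only through the letter of the input. -/
theorem law_codeLaw_letter (hV : ∀ x, V x ∈ stdSimplex ℝ T) (i : Fin l) (U : Q × (Fin l → T) → A)
    (hU : ∀ q t a, U (q, Function.update t i a) = U (q, t)) (ξ : A → X)
    (hξ : ∀ q t, x q i = ξ (U (q, t))) (u : A) (y : T) :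
    law (codeLaw r x V) (fun ω => (U ω, ω.2 i)) (u, y) = law (codeLaw r x V) U u * V (ξ u) y := by
  classical
  rw [law_eq_sum, law_eq_sum, Fintype.sum_prod_type, Fintype.sum_prod_type, Finset.sum_mul]
  refine Finset.sum_congr rfl fun q _ => ?_
  have h := sum_pi_prod_mul_of_update (p := fun j => V (x q j)) (fun j => hV _) i
    (fun t => if U (q, t) = u then 1 else 0) (fun t a => by simp only [hU])
    (fun a => if a = y then 1 else 0)
  have e1 : ∀ t, (if (U (q, t), t i) = (u, y) then codeLaw r x V (q, t) else 0)
      = r q * ((∏ j, V (x q j) (t j)) * ((if U (q, t) = u then 1 else 0)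
        * if t i = y then 1 else 0)) := by
    intro t
    by_cases h1 : U (q, t) = u <;> by_cases h2 : t i = y <;> simp [h1, h2, codeLaw, block]
  have e2 : ∀ t, (if U (q, t) = u then codeLaw r x V (q, t) else 0)
      = r q * ((∏ j, V (x q j) (t j)) * if U (q, t) = u then 1 else 0) := by
    intro t
    by_cases h1 : U (q, t) = u <;> simp [h1, codeLaw, block]
  simp only [e1, e2]
  rw [← Finset.mul_sum, ← Finset.mul_sum, h, mul_assoc]
  congr 1
  simp only [mul_ite, mul_one, mul_zero, Finset.sum_ite_eq', Finset.mem_univ, if_true]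
  -- If q attains u, then `hξ` identifies its input letter with ξ(u); otherwise both sides are 0.
  by_cases h0 : ∃ t, U (q, t) = u
  · obtain ⟨t, ht⟩ := h0
    rw [hξ q t, ht]
  · push Not at h0
    simp [h0]

theorem entropy_codeLaw (hV : ∀ x, V x ∈ stdSimplex ℝ T) (b : Q → B) (ξ : B → Fin l → X)
    (hξ : ∀ q, x q = ξ (b q)) :
    entropy (codeLaw r x V) (fun ω => (b ω.1, ω.2)) = entropy (codeLaw r x V) (fun ω => b ω.1)
      + ∑ i, ∑ ω, codeLaw r x V ω * pmfEntropy (V (x ω.1 i)) := by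
  classical
  rw [entropy_pair_of_kernel (codeLaw r x V) (fun ω => b ω.1) (fun ω => ω.2)
    (fun u => block l V (ξ u)) (fun u => block_mem hV _), Finset.sum_comm]
  · congr 1
    refine Finset.sum_congr rfl fun ω _ => ?_
    rw [← Finset.mul_sum, ← hξ]
    congr 1
    exact pmfEntropy_pi (p := fun i => V (x ω.1 i)) fun i => hV _
  · intro u t
    rw [law_codeLaw_fst hV, law_eq_sum, law_eq_sum, Fintype.sum_prod_type, Finset.sum_mul]
    refine Finset.sum_congr rfl fun q _ => ?_
    by_cases h : b q = u
    · simp [h, codeLaw, hξ]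
    · simp [h]

end Memoryless

/-! ### Converse for the channel: single-letter rates -/

section Converse

variable {Q A B X Y Z : Type*} [Fintype Q] [Fintype A] [Fintype B] [Fintype X] [Fintype Y]
  [Fintype Z] {l : ℕ} {r : Q → ℝ} {x : Q → Fin l → X} {PYX : X → Y → ℝ} {PZY : Y → Z → ℝ}

/-- U does not involve letter i and the channel is memoryless, so U, the input xᵢ and the output
pair form a Markov chain. Thus U serves as W, with P_{X|W} the conditional law of xᵢ given U. -/
theorem exists_auxPoint_letter (hr : r ∈ stdSimplex ℝ Q) (hPYX : ∀ x, PYX x ∈ stdSimplex ℝ Y)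
    (hPZY : ∀ y, PZY y ∈ stdSimplex ℝ Z) (i : Fin l) (U : Q × (Fin l → Y × Z) → A)
    (hU : ∀ q t a, U (q, Function.update t i a) = U (q, t)) :
    ∃ v ∈ entropyRegion PYX PZY,
      rateZ PYX PZY v = mutualInfo (codeLaw r x (pairChan PYX PZY)) U (fun ω => (ω.2 i).2) ∧
      rateY PYX v = entropy (codeLaw r x (pairChan PYX PZY)) (fun ω => (U ω, ω.2 i))
        - entropy (codeLaw r x (pairChan PYX PZY)) U
        - ∑ ω, codeLaw r x (pairChan PYX PZY) ω * pmfEntropy (pairChan PYX PZY (x ω.1 i)) := by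
  have hV := pairChan_mem hPYX hPZY
  set J := codeLaw r x (pairChan PYX PZY) with hJdef
  have hJ : J ∈ stdSimplex ℝ _ := codeLaw_mem hr hV
  obtain ⟨k, hk, hkJ⟩ := exists_kernel (law_mem_stdSimplex hJ (fun ω => (U ω, x ω.1 i)))
  rw [law_law] at hkJ
  have hW : law J U ∈ stdSimplex ℝ A := law_mem_stdSimplex hJ U
  have hc : law J (fun ω => (U ω, x ω.1 i, ω.2 i)) = chanLaw (law J U) k PYX PZY := by
    funext t
    obtain ⟨w, ξ, y, z⟩ := t
    have h := law_codeLaw_letter (r := r) (x := x) hV i (fun ω => (U ω, x ω.1 i))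
      (fun q t a => by simp only [hU]) (fun t => t.2) (fun _ _ => rfl) (w, ξ) (y, z)
    rw [← hJdef, hkJ] at h
    rw [chanLaw, mul_assoc (law J U w * k w ξ)]
    refine Eq.trans ?_ h
    unfold law
    congr 1
    ext ω
    simp only [Set.mem_ofPred_eq, Prod.mk.injEq, and_assoc]
  refine ⟨auxPoint PYX PZY (law J U) k, auxPoint_mem hW hk, ?_, ?_⟩
  · rw [rateZ_auxPoint hW hk hPYX hPZY, ← hc, mutualInfo_law]
  · rw [rateY_auxPoint_eq_sub hW hk hPYX hPZY, ← hc, entropy_law, entropy_law,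
      sum_law_mul J (fun ω => (U ω, x ω.1 i, ω.2 i))
        (fun t => pmfEntropy (pairChan PYX PZY t.2.1))]

/-- The rates of a code over the degraded broadcast channel are bounded by a point of the region,
where `a` is a function of the message and `b` determines the codeword. -/
theorem exists_rate_bound [Nonempty X] (hr : r ∈ stdSimplex ℝ Q)
    (hPYX : ∀ x, PYX x ∈ stdSimplex ℝ Y) (hPZY : ∀ y, PZY y ∈ stdSimplex ℝ Z)
    (a : Q → A) (b : Q → B) (ξ : B → Fin l → X) (hξ : ∀ q, x q = ξ (b q)) :
    ∃ u ∈ entropyRegion PYX PZY,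
      mutualInfo (codeLaw r x (pairChan PYX PZY)) (fun ω => a ω.1) (fun ω i => (ω.2 i).2)
        ≤ l * rateZ PYX PZY u ∧
      entropy (codeLaw r x (pairChan PYX PZY)) (fun ω => (a ω.1, ω.2))
          - entropy (codeLaw r x (pairChan PYX PZY)) (fun ω => a ω.1)
          - (entropy (codeLaw r x (pairChan PYX PZY)) (fun ω => (b ω.1, ω.2))
            - entropy (codeLaw r x (pairChan PYX PZY)) (fun ω => b ω.1))
        ≤ l * rateY PYX u := by
  have hV := pairChan_mem hPYX hPZY
  have hJ : codeLaw r x (pairChan PYX PZY) ∈ stdSimplex ℝ _ := codeLaw_mem hr hV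
  have hb := entropy_codeLaw (r := r) hV b ξ hξ
  -- The auxiliary variable of position i is Wᵢ = (a, Yⁱ⁻¹, Zⁱ⁻¹).
  choose v hv hvZ hvY using fun i : Fin l => exists_auxPoint_letter (x := x) hr hPYX hPZY i
    (fun ω => (a ω.1, initial (i : ℕ) ω.2)) (fun q t y => by simp only [initial_update])
  obtain ⟨u, hu, huZ, huY⟩ := exists_average hPYX hPZY v hv
  refine ⟨u, hu, le_trans ?_ huZ, le_trans (le_of_eq ?_) huY⟩
  · simp only [hvZ]
    set J := codeLaw r x (pairChan PYX PZY)
    have h1 := chain_rule hJ (fun ω => a ω.1) (fun ω i => (ω.2 i).2)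
    have h2 := entropy_pi_le hJ (fun ω i => (ω.2 i).2)
    have h3 : ∀ i : Fin l, entropy J (fun ω => (((a ω.1, initial (i : ℕ) ω.2)), (ω.2 i).2))
          - entropy J (fun ω => (a ω.1, initial (i : ℕ) ω.2))
        ≤ entropy J (fun ω => ((a ω.1, initial (i : ℕ) fun j => (ω.2 j).2), (ω.2 i).2))
          - entropy J (fun ω => (a ω.1, initial (i : ℕ) fun j => (ω.2 j).2)) := by
      intro i
      -- The prefix of output pairs determines the prefix of Z, so conditioning on it only lowers
      -- the entropy of Zᵢ.
      have := condEntropy_le_comp hJ (fun ω => (a ω.1, initial (i : ℕ) ω.2)) (fun ω => (ω.2 i).2)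
        (fun t => (t.1, fun j => (t.2 j).map Prod.snd))
      simpa only [initial_map] using this
    have h4 := Finset.sum_le_sum fun i (_ : i ∈ Finset.univ) => h3 i
    simp only [mutualInfo, Finset.sum_sub_distrib, Finset.sum_add_distrib] at h1 h4 ⊢
    linarith
  · simp only [hvY, Finset.sum_sub_distrib, hb]
    set J := codeLaw r x (pairChan PYX PZY)
    have h1 := chain_rule hJ (fun ω => a ω.1) (fun ω => ω.2)
    rw [Finset.sum_sub_distrib] at h1
    linarith

end Converse

/-! ### Converse for the source: single-letter information -/

section SingleLetter

variable {Ω S C C' : Type*} [Fintype Ω] [Fintype S] [Fintype C] [Fintype C'] {p : Ω → ℝ}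
  {PS : S → ℝ} {n : ℕ}

theorem law_apply_of_law_eq_iid (hPS : PS ∈ stdSimplex ℝ S) {s : Ω → Fin n → S}
    (hs : law p s = iid n PS) (j : Fin n) : law p (fun ω => s ω j) = PS := by
  classical
  rw [← law_law p s (fun φ => φ j), hs]
  funext a
  have h := sum_pi_prod_mul_apply (p := fun _ : Fin n => PS) (fun _ => hPS) j
    (fun b => if b = a then 1 else 0)
  simp only [mul_ite, mul_one, mul_zero, Finset.sum_ite_eq', Finset.mem_univ, if_true] at h
  rw [law_eq_sum, ← h]
  rfl

/-- H(Cⁿ) ≥ H(Sⁿ) - H(Sⁿ|Cⁿ). The first term splits because the source is i.i.d., and each term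
H(Sⱼ|Cⁿ,Sʲ⁻¹) of the second is at most H(Sⱼ|Cⱼ). -/
theorem sum_mutualInfo_le_entropy (hp : p ∈ stdSimplex ℝ Ω) (hPS : PS ∈ stdSimplex ℝ S)
    {s : Ω → Fin n → S} (hs : law p s = iid n PS) (c : Ω → Fin n → C) :
    ∑ j, mutualInfo p (fun ω => c ω j) (fun ω => s ω j) ≤ entropy p c := by
  have h1 : entropy p s = ∑ j, entropy p (fun ω => s ω j) := by
    simp only [entropy_eq_pmfEntropy, law_apply_of_law_eq_iid hPS hs, hs]
    exact pmfEntropy_pi (p := fun _ : Fin n => PS) fun _ => hPS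
  have h2 := chain_rule hp c s
  have h3 : ∀ j : Fin n, entropy p (fun ω => ((c ω, initial (j : ℕ) (s ω)), s ω j))
        - entropy p (fun ω => (c ω, initial (j : ℕ) (s ω)))
      ≤ entropy p (fun ω => (c ω j, s ω j)) - entropy p (fun ω => c ω j) := fun j =>
    condEntropy_le_comp hp (fun ω => (c ω, initial (j : ℕ) (s ω))) (fun ω => s ω j)
      (fun t => t.1 j)
  have h4 := Finset.sum_le_sum fun j (_ : j ∈ Finset.univ) => h3 j
  have h5 := entropy_le_of_comp hp (U := fun ω => (c ω, s ω)) (V := s) (fun t => t.2)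
    (fun _ => rfl)
  simp only [mutualInfo, Finset.sum_sub_distrib, Finset.sum_add_distrib] at h2 h4 ⊢
  linarith

/-- The mass function of a pair of letters at a uniformly chosen position. -/
def letterLaw (p : Ω → ℝ) (s : Ω → Fin n → S) (c : Ω → Fin n → C) : S × C → ℝ :=
  fun t => ∑ j : Fin n, (n : ℝ)⁻¹ * law p (fun ω => (s ω j, c ω j)) t

theorem uniform_mem (hn : 0 < n) : (fun _ : Fin n => (n : ℝ)⁻¹) ∈ stdSimplex ℝ (Fin n) :=
  ⟨fun _ => by positivity, by simp [hn.ne']⟩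

variable (hp : p ∈ stdSimplex ℝ Ω) (hn : 0 < n)
include hp hn

theorem letterLaw_mem (s : Ω → Fin n → S) (c : Ω → Fin n → C) :
    letterLaw p s c ∈ stdSimplex ℝ (S × C) :=
  mixture_mem (uniform_mem hn) fun _ => law_mem_stdSimplex hp _

theorem law_letterLaw_fst (hPS : PS ∈ stdSimplex ℝ S) {s : Ω → Fin n → S}
    (hs : law p s = iid n PS) (c : Ω → Fin n → C) :
    law (letterLaw p s c) (fun t => t.1) = PS := by
  funext a
  unfold letterLaw
  rw [law_mixture]
  simp_rw [law_law, law_apply_of_law_eq_iid hPS hs]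
  rw [← Finset.sum_mul, (uniform_mem hn).2, one_mul]

theorem expect_letterLaw (s : Ω → Fin n → S) (c : Ω → Fin n → C) (d : S → C' → ℝ≥0) (g : C → C') :
    expect (letterLaw p s c) (fun t => (d t.1 (g t.2) : ℝ))
      = expect p (fun ω => avgDist d (s ω) (fun j => g (c ω j))) := by
  unfold letterLaw
  rw [expect_mixture]
  simp_rw [expect_law, expect, Finset.mul_sum]
  rw [Finset.sum_comm]
  refine Finset.sum_congr rfl fun ω _ => ?_
  rw [avgDist, Finset.sum_div, Finset.mul_sum]
  exact Finset.sum_congr rfl fun j _ => by rw [div_eq_mul_inv]; ring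

/-- All positions share the marginal P_S, so the uniform mixture of positions is covered by
convexity. The map g selects one reconstruction or the pair. -/
theorem mutualInfo_letterLaw_le (hPS : PS ∈ stdSimplex ℝ S) {s : Ω → Fin n → S}
    (hs : law p s = iid n PS) (c : Ω → Fin n → C) (g : C → C') :
    n * mutualInfo (letterLaw p s c) (fun t => g t.2) (fun t => t.1)
      ≤ entropy p (fun ω j => g (c ω j)) := by
  have h := mutualInfo_mixture_le (uniform_mem hn)
    (p := fun j => law p (fun ω => (s ω j, c ω j))) (fun _ => law_mem_stdSimplex hp _)
    (fun t => g t.2) (fun t => t.1) (μ := PS)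
    (fun j => by rw [law_law, law_apply_of_law_eq_iid hPS hs])
  rw [← Finset.mul_sum, ← div_eq_inv_mul, le_div_iff₀ (by exact_mod_cast hn), mul_comm] at h
  refine h.trans ?_
  simp_rw [mutualInfo_law]
  exact sum_mutualInfo_le_entropy hp hPS hs (fun ω j => g (c ω j))

end SingleLetter

/-! ### From a code to the region: Fano's inequality -/

section Converse

variable {Ω A B M : Type*} [Fintype Ω] [Fintype A] [Fintype B] [Fintype M] {p : Ω → ℝ}

theorem law_apply_of_injective {U : Ω → A} (hU : Function.Injective U) (ω : Ω) :
    law p U (U ω) = p ω := by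
  classical
  rw [law_eq_sum]
  simp [hU.eq_iff]

theorem entropy_message_le (hp : p ∈ stdSimplex ℝ Ω) {n : ℕ} {R : ℝ} (hR : 0 ≤ R)
    (m : Ω → Message n R) : entropy p m ≤ n * R := by
  refine (entropy_le_logb_card hp m).trans ?_
  rw [Fintype.card_fin]
  calc _ ≤ Real.logb 2 ((2 : ℝ) ^ ((n : ℝ) * R)) := by
        refine Real.logb_le_logb_of_le (by norm_num) ?_ (Nat.floor_le (by positivity))
        exact_mod_cast message_pos hR n
    _ = _ := Real.logb_rpow (by norm_num) (by norm_num)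

/-- The bound of Fano's inequality on a conditional entropy, for error probability `ε` and
at most `2 ^ L` values. -/
def fanoBound (L ε : ℝ) : ℝ := -Real.logb 2 (1 - ε) + ε * (L - Real.logb 2 ε)

theorem fanoBound_mono {L L' ε : ℝ} (hε : 0 ≤ ε) (h : L ≤ L') : fanoBound L ε ≤ fanoBound L' ε := by
  unfold fanoBound
  gcongr

/-- The block length can be pulled out because the terms of the bound not involving L are
nonnegative. -/
theorem fanoBound_mul_le {L ε c : ℝ} (hε0 : 0 < ε) (hε1 : ε < 1) (hc : 1 ≤ c) :
    fanoBound (c * L) ε ≤ c * fanoBound L ε := by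
  have h1 : Real.logb 2 (1 - ε) ≤ 0 := Real.logb_nonpos (by norm_num) (by linarith) (by linarith)
  have h2 : Real.logb 2 ε ≤ 0 := Real.logb_nonpos (by norm_num) hε0.le hε1.le
  unfold fanoBound
  nlinarith [mul_nonneg (sub_nonneg.2 hc) (neg_nonneg.2 h1),
    mul_nonneg (mul_nonneg (sub_nonneg.2 hc) hε0.le) (neg_nonneg.2 h2)]

/-- If `a` and `b` can be decoded from the outputs `z` and `t` with small error probability, then
the entropies of the decoded messages are bounded by the information of the channel. -/
theorem entropy_decoded_le {T Z A' Q : Type*} [Fintype T] [Fintype Z] [Fintype A'] [Fintype Q]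
    (hp : p ∈ stdSimplex ℝ Ω) (b : Ω → A × A') (t : Ω → T) (z : Ω → Z)
    (γ : Z → A) (hγ : T → A × A') (s : Ω → Q) (β : Q → A × A') (hb : ∀ ω, b ω = β (s ω))
    (hz : ∀ ω, (hγ (t ω)).1 = γ (z ω))
    {ε L : ℝ} (hε0 : 0 < ε) (hε1 : ε < 1) (hε : prob p {ω | b ω ≠ hγ (t ω)} ≤ ε)
    (hL₁ : Real.logb 2 (Fintype.card Q) ≤ L) (hL₂ : Real.logb 2 (Fintype.card T) ≤ L) :
    entropy p (fun ω => (hγ (t ω)).1) ≤ mutualInfo p (fun ω => (b ω).1) z + fanoBound L ε ∧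
    entropy p (fun ω => hγ (t ω)) ≤ mutualInfo p (fun ω => (b ω).1) z
      + (entropy p (fun ω => ((b ω).1, t ω)) - entropy p (fun ω => (b ω).1)
        - (entropy p (fun ω => (b ω, t ω)) - entropy p b)) + 3 * fanoBound L ε := by
  have hε' : prob p {ω | (b ω).1 ≠ (hγ (t ω)).1} ≤ ε := by
    refine (prob_mono hp.1 ?_).trans hε
    intro ω h h'
    exact h (by rw [h'])
  have hεs : prob p {ω | hγ (t ω) ≠ b ω} ≤ ε := by
    simpa only [ne_comm] using hε
  have hεs' : prob p {ω | (hγ (t ω)).1 ≠ (b ω).1} ≤ ε := by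
    simpa only [ne_comm] using hε'
  -- Fano in both directions, for the pair and for its first component. Messages are functions of
  -- the source words and decoded messages are functions of the outputs, which replaces a bound on
  -- the message sets.
  have F1 := (fano hp (fun ω => hγ (t ω)) b t hγ (fun _ => rfl) hε0 hε1 hεs).trans
    (fanoBound_mono hε0.le hL₂)
  have F2 := (fano hp b (fun ω => hγ (t ω)) s β hb hε0 hε1 hε).trans
    (fanoBound_mono hε0.le hL₁)
  have F3 := (fano hp (fun ω => (b ω).1) (fun ω => (hγ (t ω)).1) s (fun x => (β x).1)
    (fun ω => by rw [hb]) hε0 hε1 hε').trans (fanoBound_mono hε0.le hL₁)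
  have F4 := (fano hp (fun ω => (hγ (t ω)).1) (fun ω => (b ω).1) t (fun x => (hγ x).1)
    (fun _ => rfl) hε0 hε1 hεs').trans (fanoBound_mono hε0.le hL₂)
  have I1 := mutualInfo_comp_le hp z γ (fun ω => (b ω).1)
  rw [mutualInfo_comm hp z, ← show (fun ω => (hγ (t ω)).1) = fun ω => γ (z ω) from funext hz] at I1
  have E1 := entropy_eq_of_comp hp (U := fun ω => ((b ω).1, (hγ (t ω)).1))
    (V := fun ω => ((hγ (t ω)).1, (b ω).1)) Prod.swap Prod.swap (fun _ => rfl) (fun _ => rfl)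
  have G1 := entropy_le_of_comp hp (U := fun ω => (hγ (t ω), b ω)) (V := fun ω => hγ (t ω))
    (fun x => x.1) (fun _ => rfl)
  have G2 := condEntropy_le_comp hp t b hγ
  have E2 := entropy_eq_of_comp hp (U := fun ω => (t ω, b ω)) (V := fun ω => (b ω, t ω))
    Prod.swap Prod.swap (fun _ => rfl) (fun _ => rfl)
  have E3 := entropy_eq_of_comp hp (U := fun ω => (hγ (t ω), b ω))
    (V := fun ω => (b ω, hγ (t ω))) Prod.swap Prod.swap (fun _ => rfl) (fun _ => rfl)
  have G3 := entropy_le_of_comp hp (U := fun ω => ((b ω).1, t ω)) (V := t) (fun x => x.2)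
    (fun _ => rfl)
  rw [mutualInfo] at I1
  -- First, H(M̂₁) = I(M̂₁;M₁) + H(M̂₁|M₁). Second, H(M̂) ≤ H(M) + H(M̂|M), then H(M) ≤ I(M;t) +
  -- H(M|M̂), then I(M;t) ≤ H(M₁) + I(M;t|M₁), and finally H(M₁) ≤ I(M₁;z) + H(M₁|M̂₁): three Fano
  -- terms.
  constructor <;> linarith

variable {S S₁ S₂ X Y Z : Type*} [Fintype S] [Fintype S₁] [Fintype S₂] [Fintype X]
  [Fintype Y] [Fintype Z] {PS : S → ℝ} {PYX : X → Y → ℝ} {PZY : Y → Z → ℝ} {n l : ℕ} {R : ℝ}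

theorem outcomeLaw_eq_law_codeLaw (c : SepCode S S S₁ S₂ X Y Z R n l) :
    c.outcomeLaw (diagLaw PS) PYX PZY
      = law (codeLaw (iid n PS) (fun s => c.f₂₂ (c.f₂₁ s)) (pairChan PYX PZY))
        (fun ω => (ω.1, ω.1, fun j => (ω.2 j).1, fun j => (ω.2 j).2)) := by
  rw [outcomeLaw_diagLaw]
  refine Eq.trans ?_ (law_law (codeLaw (iid n PS) (fun s => c.f₂₂ (c.f₂₁ s)) (pairChan PYX PZY))
    (fun ω => (ω.1, (fun j => (ω.2 j).1), fun j => (ω.2 j).2))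
    (fun ω => (ω.1, ω.1, ω.2.1, ω.2.2)))
  congr 1
  funext ω
  obtain ⟨s, y, z⟩ := ω
  have h := law_apply_of_injective
    (p := codeLaw (iid n PS) (fun s => c.f₂₂ (c.f₂₁ s)) (pairChan PYX PZY))
    (U := fun ω => (ω.1, (fun j => (ω.2 j).1), fun j => (ω.2 j).2)) (fun ω ω' h => by
      simp only [Prod.mk.injEq, funext_iff] at h
      exact Prod.ext (funext h.1) (funext fun j => Prod.ext (h.2.1 j) (h.2.2 j))) (s, fun j => (y j, z j))
  rw [h]
  simp only [sourceChanLaw, codeLaw, block, pairChan, Finset.prod_mul_distrib]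

/-- A code with small error probability yields a joint law of the letters and a point of the
region that almost satisfy the conditions on the rates. -/
theorem exists_letterLaw_of_sepCode [Nonempty X] (hPS : PS ∈ stdSimplex ℝ S)
    (hPYX : ∀ x, PYX x ∈ stdSimplex ℝ Y) (hPZY : ∀ y, PZY y ∈ stdSimplex ℝ Z)
    (d₁ : S → S₁ → ℝ≥0) (d₂ : S → S₂ → ℝ≥0) (hR : 0 ≤ R) (hn : 0 < n)
    (c : SepCode S S S₁ S₂ X Y Z R n l) {ε ρ : ℝ} (hε0 : 0 < ε) (hε1 : ε < 1)
    (hρ : (l : ℝ) / n ≤ ρ)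
    (hε : prob (c.outcomeLaw (diagLaw PS) PYX PZY) {ω | c.f₂₁ ω.2.1 ≠ c.decoded ω} ≤ ε) :
    ∃ P ∈ stdSimplex ℝ (S × S₁ × S₂), ∃ u ∈ entropyRegion PYX PZY,
      law P (fun ω => ω.1) = PS ∧
      expect P (fun ω => (d₁ ω.1 ω.2.1 : ℝ))
        = expect (c.outcomeLaw (diagLaw PS) PYX PZY) (fun ω => avgDist d₁ ω.1 (c.recon₁ ω)) ∧
      expect P (fun ω => (d₂ ω.1 ω.2.2 : ℝ))
        = expect (c.outcomeLaw (diagLaw PS) PYX PZY) (fun ω => avgDist d₂ ω.1 (c.recon₂ ω)) ∧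
      mutualInfo P (fun ω => ω.2.1) (fun ω => ω.1) ≤ R + ρ * rateZ PYX PZY u
        + fanoBound (Real.logb 2 (Fintype.card S) + ρ * Real.logb 2 (Fintype.card (Y × Z))) ε ∧
      mutualInfo P (fun ω => (ω.2.1, ω.2.2)) (fun ω => ω.1) ≤ R + ρ * rateZ PYX PZY u
        + ρ * rateY PYX u + 3 *
          fanoBound (Real.logb 2 (Fintype.card S) + ρ * Real.logb 2 (Fintype.card (Y × Z))) ε := by
  have hn' : (0 : ℝ) < n := by exact_mod_cast hn
  have hl : (l : ℝ) ≤ n * ρ := by rwa [div_le_iff₀ hn', mul_comm] at hρ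
  set J := codeLaw (iid n PS) (fun s => c.f₂₂ (c.f₂₁ s)) (pairChan PYX PZY) with hJdef
  have hV := pairChan_mem hPYX hPZY
  have hJ : J ∈ stdSimplex ℝ _ := codeLaw_mem (iid_mem hPS) hV
  rw [outcomeLaw_eq_law_codeLaw c, ← hJdef] at hε ⊢
  rw [prob_law] at hε
  simp only [expect_law]
  obtain ⟨u, hu, huZ, huY⟩ := exists_rate_bound (x := fun s => c.f₂₂ (c.f₂₁ s)) (iid_mem hPS) hPYX
    hPZY (fun s => (c.f₂₁ s).1) c.f₂₁ c.f₂₂ (fun _ => rfl)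
  rw [← hJdef] at huZ huY
  let r₁ : (Fin n → S) × (Fin l → Y × Z) → Fin n → S₁ := fun ω =>
    c.recon₁ (ω.1, ω.1, fun j => (ω.2 j).1, fun j => (ω.2 j).2)
  let r₂ : (Fin n → S) × (Fin l → Y × Z) → Fin n → S₂ := fun ω =>
    c.recon₂ (ω.1, ω.1, fun j => (ω.2 j).1, fun j => (ω.2 j).2)
  let dec : (Fin l → Y × Z) → Fin c.k₁ × Fin c.k₂ := fun t =>
    (c.g₁₁ fun j => (t j).2, c.g₂₁ fun j => (t j).1)
  have hs : law J (fun ω => ω.1) = iid n PS := by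
    funext s
    rw [law_codeLaw_fst hV (fun s => s), law_id]
  set LS := Real.logb 2 (Fintype.card S) with hLSdef
  set LT := Real.logb 2 (Fintype.card (Y × Z)) with hLTdef
  have hLS : 0 ≤ LS := div_nonneg (Real.log_natCast_nonneg _) (Real.log_nonneg (by norm_num))
  have hLT : 0 ≤ LT := div_nonneg (Real.log_natCast_nonneg _) (Real.log_nonneg (by norm_num))
  have hρ0 : 0 ≤ ρ := le_trans (by positivity) hρ
  have hcS : Real.logb 2 (Fintype.card (Fin n → S)) = n * LS := by
    rw [Fintype.card_fun, Fintype.card_fin, Nat.cast_pow, Real.logb_pow]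
  have hcT : Real.logb 2 (Fintype.card (Fin l → Y × Z)) = l * LT := by
    rw [Fintype.card_fun, Fintype.card_fin, Nat.cast_pow, Real.logb_pow]
  -- L dominates n log|S| and l log|Y×Z|, the latter because l ≤ nρ; it is n times a constant.
  obtain ⟨h1, h2⟩ := entropy_decoded_le hJ (fun ω => c.f₂₁ ω.1) (fun ω => ω.2)
    (fun ω i => (ω.2 i).2) c.g₁₁ dec (fun ω => ω.1) c.f₂₁ (fun _ => rfl) (fun _ => rfl)
    hε0 hε1 hε (L := n * (LS + ρ * LT))
    (by rw [hcS, mul_add]; exact le_add_of_nonneg_right (by positivity))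
    (by
      rw [hcT, mul_add, ← mul_assoc]
      linarith [mul_le_mul_of_nonneg_right hl hLT, mul_nonneg hn'.le hLS])
  have hF := fanoBound_mul_le (L := LS + ρ * LT) (c := n) hε0 hε1 (by exact_mod_cast hn)
  have hm := entropy_message_le hJ hR (fun ω => c.f₁ ω.1)
  have hZ := rateZ_nonneg hPYX hPZY hu
  have hY := rateY_nonneg hPYX hPZY hu
  have e1 := entropy_pair_le hJ (fun ω => c.f₁ ω.1) (fun ω => (dec ω.2).1)
  have e1' := entropy_le_of_comp hJ (U := fun ω => (c.f₁ ω.1, (dec ω.2).1)) (V := r₁)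
    c.g₁₂ (fun _ => rfl)
  have e2 := entropy_pair_le hJ (fun ω => c.f₁ ω.1) (fun ω => dec ω.2)
  have e2' := entropy_le_of_comp hJ (U := fun ω => (c.f₁ ω.1, dec ω.2))
    (V := fun ω j => (r₁ ω j, r₂ ω j))
    (fun x j => (c.g₁₂ (x.1, x.2.1) j, c.g₂₂ (x.1, x.2.2) j)) (fun _ => rfl)
  have m1 := mutualInfo_letterLaw_le hJ hn hPS hs (fun ω j => (r₁ ω j, r₂ ω j)) Prod.fst
  have m2 := mutualInfo_letterLaw_le hJ hn hPS hs (fun ω j => (r₁ ω j, r₂ ω j)) (fun x => x)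
  have q1 := mul_le_mul_of_nonneg_right hl hZ
  have q2 := mul_le_mul_of_nonneg_right hl hY
  refine ⟨letterLaw J (fun ω => ω.1) (fun ω j => (r₁ ω j, r₂ ω j)), letterLaw_mem hJ hn _ _, u, hu,
    law_letterLaw_fst hJ hn hPS hs _, expect_letterLaw hJ hn _ _ d₁ Prod.fst,
    expect_letterLaw hJ hn _ _ d₂ Prod.snd, ?_, ?_⟩
  · refine le_of_mul_le_mul_left (m1.trans ?_) hn'
    change entropy J r₁ ≤ _
    linarith
  · refine le_of_mul_le_mul_left (m2.trans ?_) hn'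
    linarith

end Converse

/-! ### Passage to the limit -/

section Limit

variable {Ω A B : Type*} [Fintype Ω] [Fintype A] [Fintype B]

theorem continuous_law (U : Ω → A) : Continuous fun p : Ω → ℝ => law p U := by
  classical
  refine continuous_pi fun a => ?_
  simp only [law_eq_sum]
  refine continuous_finsetSum _ fun ω _ => ?_
  split_ifs <;> fun_prop

theorem continuous_entropy (U : Ω → A) : Continuous fun p : Ω → ℝ => entropy p U :=
  continuous_pmfEntropy.comp (continuous_law U)

theorem continuous_mutualInfo (U : Ω → A) (V : Ω → B) :
    Continuous fun p : Ω → ℝ => mutualInfo p U V :=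
  ((continuous_entropy U).add (continuous_entropy V)).sub (continuous_entropy _)

theorem continuous_expect (f : Ω → ℝ) : Continuous fun p : Ω → ℝ => expect p f := by
  unfold expect
  fun_prop

/-- Rests on ε log ε → 0; the normalized alphabet bound L stays bounded. -/
theorem tendsto_fanoBound {ε L : ℕ → ℝ} {L₀ : ℝ} (hε : Tendsto ε atTop (𝓝 0))
    (hL : Tendsto L atTop (𝓝 L₀)) : Tendsto (fun m => fanoBound (L m) (ε m)) atTop (𝓝 0) := by
  have h1 : Tendsto (fun m => Real.log (1 - ε m)) atTop (𝓝 (Real.log (1 - 0))) :=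
    (tendsto_const_nhds.sub hε).log (by norm_num)
  have h2 := (Real.continuous_mul_log.tendsto 0).comp hε
  have h3 := ((h1.div_const (Real.log 2)).neg.add (hε.mul hL)).sub (h2.div_const (Real.log 2))
  simp only [sub_zero, Real.log_one, zero_div, neg_zero, zero_mul, add_zero] at h3
  refine h3.congr fun m => ?_
  simp only [fanoBound, Real.logb, Function.comp]
  ring

end Limit

variable {S S₁ S₂ X Y Z : Type*} [Fintype S] [Fintype S₁] [Fintype S₂] [Fintype X]
  [Fintype Y] [Fintype Z] {PS : S → ℝ} {PYX : X → Y → ℝ} {PZY : Y → Z → ℝ}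
  {d₁ : S → S₁ → ℝ≥0} {d₂ : S → S₂ → ℝ≥0} {R D₁ D₂ ρ : ℝ}

/-- The converse: an achievable quadruple satisfies the conditions on the rates. -/
theorem exists_of_sepAchievable [Nonempty X] (hPS : PS ∈ stdSimplex ℝ S)
    (hPYX : ∀ x, PYX x ∈ stdSimplex ℝ Y) (hPZY : ∀ y, PZY y ∈ stdSimplex ℝ Z) (hR : 0 ≤ R)
    (h : SepAchievable (diagLaw PS) PYX PZY d₁ d₂ R D₁ D₂ ρ) :
    ∃ P ∈ stdSimplex ℝ (S × S₁ × S₂), ∃ u ∈ entropyRegion PYX PZY,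
      law P (fun ω => ω.1) = PS ∧
      expect P (fun ω => (d₁ ω.1 ω.2.1 : ℝ)) ≤ D₁ ∧
      expect P (fun ω => (d₂ ω.1 ω.2.2 : ℝ)) ≤ D₂ ∧
      mutualInfo P (fun ω => ω.2.1) (fun ω => ω.1) ≤ R + ρ * rateZ PYX PZY u ∧
      mutualInfo P (fun ω => (ω.2.1, ω.2.2)) (fun ω => ω.1)
        ≤ R + ρ * rateZ PYX PZY u + ρ * rateY PYX u := by
  -- The shift by 2 keeps ε strictly below 1 already at m = 0, as Fano's inequality requires.
  set ε : ℕ → ℝ := fun m => 1 / ((m : ℝ) + 2) with hε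
  have hε0 : ∀ m, 0 < ε m := fun m => by positivity
  have hε1 : ∀ m, ε m < 1 := fun m => by
    rw [hε, div_lt_one (by positivity)]
    linarith [(Nat.cast_nonneg m : (0 : ℝ) ≤ m)]
  have hεt : Tendsto ε atTop (𝓝 0) := by
    have := (tendsto_one_div_add_atTop_nhds_zero_nat (𝕜 := ℝ)).comp (tendsto_add_atTop_nat 1)
    refine this.congr fun m => ?_
    simp only [Function.comp, hε]
    push_cast
    ring
  choose n l c hn hl hp hd₁ hd₂ using fun m => h (ε m) (hε0 m)
  choose P hP u hu hPS' hP₁ hP₂ hr₁ hr₂ using fun m => exists_letterLaw_of_sepCode hPS hPYX hPZY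
    d₁ d₂ hR (hn m) (c m) (hε0 m) (hε1 m) (hl m) (hp m)
  -- The joint laws and the region points lie in fixed compact sets whatever the block lengths are,
  -- so a subsequence converges in both.
  obtain ⟨⟨Q, v⟩, ⟨hQ, hv⟩, φ, hφ, hlim⟩ := ((isCompact_stdSimplex ℝ (S × S₁ × S₂)).prod
    (isCompact_entropyRegion PYX PZY)).tendsto_subseq (x := fun m => (P m, u m))
    (fun m => ⟨hP m, hu m⟩)
  have hQl : Tendsto (fun m => P (φ m)) atTop (𝓝 Q) := hlim.fst_nhds
  have hvl : Tendsto (fun m => u (φ m)) atTop (𝓝 v) := hlim.snd_nhds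
  have hεφ : Tendsto (fun m => ε (φ m)) atTop (𝓝 0) := hεt.comp hφ.tendsto_atTop
  have hρl : Tendsto (fun m => ρ + ε (φ m)) atTop (𝓝 ρ) := by
    simpa using hεφ.const_add ρ
  have hZ : Tendsto (fun m => rateZ PYX PZY (u (φ m))) atTop (𝓝 (rateZ PYX PZY v)) :=
    ((continuous_rateZ PYX PZY).tendsto v).comp hvl
  have hY : Tendsto (fun m => rateY PYX (u (φ m))) atTop (𝓝 (rateY PYX v)) :=
    ((continuous_rateY PYX).tendsto v).comp hvl
  have hF := tendsto_fanoBound hεφ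
    ((hρl.mul_const (Real.logb 2 (Fintype.card (Y × Z)))).const_add
      (Real.logb 2 (Fintype.card S)))
  refine ⟨Q, hQ, v, hv, ?_, ?_, ?_, ?_, ?_⟩
  · refine tendsto_nhds_unique (((continuous_law _).tendsto Q).comp hQl) ?_
    simp only [Function.comp_def, hPS']
    exact tendsto_const_nhds
  · refine le_of_tendsto_of_tendsto' (((continuous_expect _).tendsto Q).comp hQl)
      (by simpa using hεφ.const_add D₁) fun m => ?_
    exact (hP₁ (φ m)).le.trans (hd₁ (φ m))
  · refine le_of_tendsto_of_tendsto' (((continuous_expect _).tendsto Q).comp hQl)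
      (by simpa using hεφ.const_add D₂) fun m => ?_
    exact (hP₂ (φ m)).le.trans (hd₂ (φ m))
  · refine le_of_tendsto_of_tendsto' (((continuous_mutualInfo _ _).tendsto Q).comp hQl)
      (by simpa using ((hρl.mul hZ).const_add R).add hF) fun m => hr₁ (φ m)
  · refine le_of_tendsto_of_tendsto' (((continuous_mutualInfo _ _).tendsto Q).comp hQl)
      (by simpa using (((hρl.mul hZ).const_add R).add (hρl.mul hY)).add (hF.const_mul 3))
      fun m => hr₂ (φ m)

end HelperBC

end

theorem corollary1
    {S S₁ S₂ X Y Z : Type*} [Fintype S] [Fintype S₁] [Fintype S₂]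
    [Fintype X] [Nonempty X] [Fintype Y] [Fintype Z]
    (PS : S → ℝ) (hPS : PS ∈ stdSimplex ℝ S)
    (PYX : X → Y → ℝ) (hPYX : ∀ x, PYX x ∈ stdSimplex ℝ Y)
    (PZY : Y → Z → ℝ) (hPZY : ∀ y, PZY y ∈ stdSimplex ℝ Z)
    (d₁ : S → S₁ → ℝ≥0) (d₂ : S → S₂ → ℝ≥0)
    (R D₁ D₂ ρ : ℝ) (hR : 0 ≤ R) (hρ : 0 ≤ ρ) :
    HelperBC.SepAchievable (HelperBC.diagLaw PS) PYX PZY d₁ d₂ R D₁ D₂ ρ ↔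
      -- the law `P` of `(S, Ŝ₁, Ŝ₂)`, and `P_W`, `P_{X|W}` for a `W` with a finite alphabet
      ∃ P ∈ stdSimplex ℝ (S × S₁ × S₂), ∃ (k : ℕ), ∃ PW ∈ stdSimplex ℝ (Fin k),
      ∃ PXW : Fin k → X → ℝ, (∀ w, PXW w ∈ stdSimplex ℝ X) ∧
        HelperBC.law P (fun ω => ω.1) = PS ∧
        HelperBC.expect P (fun ω => (d₁ ω.1 ω.2.1 : ℝ)) ≤ D₁ ∧
        HelperBC.expect P (fun ω => (d₂ ω.1 ω.2.2 : ℝ)) ≤ D₂ ∧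
        R + ρ * HelperBC.mutualInfo (HelperBC.chanLaw PW PXW PYX PZY)
              (fun ω => ω.1) (fun ω => ω.2.2.2)
          ≥ HelperBC.mutualInfo P (fun ω => ω.2.1) (fun ω => ω.1) ∧
        R + ρ * HelperBC.mutualInfo (HelperBC.chanLaw PW PXW PYX PZY)
              (fun ω => ω.1) (fun ω => ω.2.2.2)
          + ρ * HelperBC.condMutualInfo (HelperBC.chanLaw PW PXW PYX PZY)
              (fun ω => ω.2.1) (fun ω => ω.2.2.1) (fun ω => ω.1)
          ≥ HelperBC.mutualInfo P (fun ω => (ω.2.1, ω.2.2)) (fun ω => ω.1) := by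
  constructor
  · intro h
    obtain ⟨P, hP, u, hu, hPS', h₁, h₂, h₃, h₄⟩ :=
      HelperBC.exists_of_sepAchievable hPS hPYX hPZY hR h
    obtain ⟨k, PW, hPW, PXW, hPXW, rfl⟩ := HelperBC.exists_auxPoint hu
    rw [HelperBC.rateZ_auxPoint hPW hPXW hPYX hPZY] at h₃ h₄
    rw [HelperBC.rateY_auxPoint hPW hPXW hPYX hPZY] at h₄
    exact ⟨P, hP, k, PW, hPW, PXW, hPXW, hPS', h₁, h₂, h₃, h₄⟩
  · rintro ⟨P, hP, k, PW, hPW, PXW, hPXW, hPS', h₁, h₂, h₃, h₄⟩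
    exact HelperBC.sepAchievable_of_le hP hPW hPXW hPYX hPZY hR hρ hPS' h₁ h₂ h₃ h₄
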